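/- Theorem (Total Regret of OPPO). \emph{Setting.} Let $\mathcal S$ be a measurable state space with an ($s$-finite, e.g. $\sigma$-finite) reference measure $dx'$, $\mathcal A$ a finite non-empty action set, $H,K\ge 1$ integers, $T=HK$, $x_1\in\mathcal S$, and let $\mathcal P_h(\cdot\mid x,a)$, $h\in[H]=\{1,\dots,H\}$, be transition kernels on $\mathcal S$. Let $\psi:\mathcal S\times\mathcal A\times\mathcal S\to\mathbb R^d$ be a known measurable feature map, with $\psi(x,a,\cdot)$ integrable for all $(x,a)$. Assume (linear MDP) that for every $h\in[H]$ there is $\theta_h\in\mathbb R^d$ with $\|\theta_h\|_2\le\sqrt d$ such that $\mathcal P_h(\cdot\mid x,a)$ has the density $\mathcal P_h(x'\mid x,a)=\psi(x,a,x')^\top\theta_h$ for all $(x,a,x')$, and that $\bigl\|\int_{\mathcal S}\psi(x,a,x')V(x')\,dx'\bigr\|_2\le\sqrt d\,H$ for all $(x,a)$ and all measurable $V:\mathcal S\to[0,H]$. \emph{Interaction.} In each episode $k=1,\dots,K$ the environment first chooses reward functions $r^k_h:\mathcal S\times\mathcal A\to[0,1]$, $h\in[H]$, arbitrarily on the basis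 of the past (the previous episodes and possibly additional randomness). The learner executes a policy $\pi^k=\{\pi^k_h(\cdot\mid\cdot)\}_{h=1}^H$: starting from $x^k_1=x_1$, for $h=1,\dots,H$ it draws $a^k_h\sim\pi^k_h(\cdot\mid x^k_h)$, and then $x^k_{h+1}\sim\mathcal P_h(\cdot\mid x^k_h,a^k_h)$; the functions $r^k_h$ are revealed to the learner during the episode. For a policy $\pi$ let $V^{\pi,k}_1(x_1)=\mathbb E_\pi\bigl[\sum_{h=1}^H r^k_h(x_h,a_h)\mid x_1\bigr]$ be the expected total reward when $a_h\sim\pi_h(\cdot\mid x_h)$ and $x_{h+1}\sim\mathcal P_h(\cdot\mid x_h,a_h)$. The regret is $$\mathrm{Regret}(T)=\max_{\pi}\sum_{k=1}^K\bigl(V^{\pi,k}_1(x_1)-V^{\pi^k,k}_1(x_1)\bigr),$$ where the maximum is over all (measurable, Markov, randomized) policies $\pi=\{\pi_h\}_{h=1}^H$. \emph{Algorithm (OPPO with parameters $\alpha,\lambda,\beta$).} Let $\pi^0_h(\cdot\mid x)$ be uniform on $\mathcal A$ and $Q^0_h=0$. In episode $k=1,\dots,K$, OPPO executes the policy $\pi^k_h(\cdot\mid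 x)\propto\pi^{k-1}_h(\cdot\mid x)\exp\{\alpha Q^{k-1}_h(x,\cdot)\}$. Then it sets $V^k_{H+1}=0$ and computes, for $h=H,H-1,\dots,1$, $$\phi^k_h(x,a)=\int_{\mathcal S}\psi(x,a,x')V^k_{h+1}(x')\,dx',\qquad \Lambda^k_h=\sum_{\tau=1}^{k-1}\phi^\tau_h(x^\tau_h,a^\tau_h)\phi^\tau_h(x^\tau_h,a^\tau_h)^\top+\lambda I,$$ $$w^k_h=(\Lambda^k_h)^{-1}\sum_{\tau=1}^{k-1}\phi^\tau_h(x^\tau_h,a^\tau_h)V^\tau_{h+1}(x^\tau_{h+1}),\qquad \Gamma^k_h=\beta\bigl[(\phi^k_h)^\top(\Lambda^k_h)^{-1}\phi^k_h\bigr]^{1/2},$$ $$Q^k_h=\max\bigl\{0,\min\{r^k_h+(\phi^k_h)^\top w^k_h+\Gamma^k_h,\;H-h+1\}\bigr\},\qquad V^k_h(x)=\sum_{a\in\mathcal A}Q^k_h(x,a)\,\pi^k_h(a\mid x).$$ \emph{Claim.} There is an absolute constant $C_0>1$ such that for every $C\ge C_0$ and every $M>0$ there is a constant $C'>0$, depending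 only on $C$ and $M$, with the following property. In every setting as above and for every $\zeta\in(0,1]$ with $\log|\mathcal A|\le M\,d^2[\log(dT/\zeta)]^2$, the regret of OPPO with $$\alpha=\sqrt{2\log|\mathcal A|/(HT)},\qquad\lambda=1,\qquad\beta=C\sqrt{dH^2\log(dT/\zeta)}$$ satisfies, with probability at least $1-\zeta$, $$\mathrm{Regret}(T)\le C'\sqrt{d^2H^3T}\cdot\log(dT/\zeta).$$ -/

import Mathlib

open MeasureTheory ProbabilityTheory Matrix

/-!
Conventions.  Steps and episodes are counted from `0`: the `h`-th step of an episode (`h = 0, …, H - 1`)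
is step `h + 1` in one-based notation, and similarly for the episodes `k = 0, …, K - 1`.
Policies, rewards and transition kernels are families indexed by `ℕ`; only their values
at the steps `h < H` are ever used.
-/

section MDP

variable {S A : Type*} [mS : MeasurableSpace S] [Fintype A] [MeasurableSpace A]

/-- The (measurable) policies `{π_h(· | ·)}_{h < H}`: `π h x a` is the probability of taking the
action `a` in the state `x` at step `h`, and `π h x` lies in the simplex of distributions on `A`. -/
def policies (S A : Type*) [MeasurableSpace S] [Fintype A] (H : ℕ) : Set (ℕ → S → A → ℝ) :=
  {π | ∀ h < H, (∀ x, π h x ∈ stdSimplex ℝ A) ∧ ∀ a, Measurable fun x => π h x a}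

/-- The distribution on the finite set `A` with probability mass function `p`. -/
noncomputable def actionLaw (p : A → ℝ) : Measure A :=
  ∑ a, ENNReal.ofReal (p a) • Measure.dirac a

/-- The joint law of `((x_0, a_0), …, (x_{n-1}, a_{n-1}))` and `x_n` when `x_0 = x₁`,
`a_h ∼ π_h(· | x_h)` and `x_{h+1} ∼ P_h(· | x_h, a_h)`. -/
noncomputable def trajLaw (P : ℕ → Kernel (S × A) S) (π : ℕ → S → A → ℝ) (x₁ : S) :
    (n : ℕ) → Measure ((Fin n → S × A) × S)
  | 0 => Measure.dirac (fun i => i.elim0, x₁)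
  | n + 1 => (trajLaw P π x₁ n).bind fun τ =>
      (actionLaw (π n τ.2)).bind fun a =>
        (P n (τ.2, a)).map fun x' => (Fin.snoc τ.1 (τ.2, a), x')

/-- The value `V^π(x₁)` at the first step: the expectation under the policy `π` of the total reward
`∑_h r_h(x_h, a_h)` over the `H` steps of an episode started in `x₁`. -/
noncomputable def value (H : ℕ) (P : ℕ → Kernel (S × A) S) (x₁ : S)
    (π : ℕ → S → A → ℝ) (r : ℕ → S → A → ℝ) : ℝ :=
  ∫ τ, ∑ h : Fin H, r h (τ.1 h).1 (τ.1 h).2 ∂(trajLaw P π x₁ H)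

/-- The regret of the policies `π^0, …, π^{K-1}` for the reward functions `r^0, …, r^{K-1}`
against the best fixed policy in hindsight. -/
noncomputable def regret (H K : ℕ) (P : ℕ → Kernel (S × A) S) (x₁ : S)
    (r : ℕ → ℕ → S → A → ℝ) (π : ℕ → ℕ → S → A → ℝ) : ℝ :=
  ⨆ π' : policies S A H,
    ∑ k ∈ Finset.range K, (value H P x₁ π' (r k) - value H P x₁ (π k) (r k))

/-- The linear MDP assumption for the transition kernels `P_h`, `h < H`, and the feature map `ψ`.
The integrals `∫ … dx'` over the state space are taken with respect to the reference measure `ν`,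
and `P_h(x' | x, a) = ψ(x, a, x')ᵀ θ_h` is the density of `P_h(· | x, a)` with respect to `ν`. -/
structure IsLinearMDP {d : ℕ} (H : ℕ) (ν : Measure S) (P : ℕ → Kernel (S × A) S)
    (ψ : S → A → S → EuclideanSpace ℝ (Fin d)) : Prop where
  measurable : Measurable fun p : S × A × S => ψ p.1 p.2.1 p.2.2
  integrable : ∀ x a, Integrable (ψ x a) ν
  linear : ∀ h < H, ∃ θ : EuclideanSpace ℝ (Fin d), ‖θ‖ ≤ √d ∧
    ∀ x a, (∀ x', 0 ≤ inner ℝ (ψ x a x') θ) ∧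
      P h (x, a) = ν.withDensity fun x' => ENNReal.ofReal (inner ℝ (ψ x a x') θ)
  bounded : ∀ x a, ∀ V : S → ℝ, Measurable V → (∀ x', V x' ∈ Set.Icc (0 : ℝ) H) →
    ‖∫ x', V x' • ψ x a x' ∂ν‖ ≤ √d * H

/-- The interaction of a learner that uses the policy `π k ω` in episode `k` with the environment,
on a probability space `(Ω, Pr)`.  Here `X k h` and `Act k h` are the state and the action at step `h`
of episode `k`, and `r k h` is the (random) reward function.  The `σ`-algebra `𝓖 (2 * (k * H + h))`
is the information available just before the action `Act k h` is drawn, and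
`𝓖 (2 * (k * H + h) + 1)` the one just before the next state is drawn.  The reward functions of
episode `k` are chosen at the beginning of the episode, arbitrarily on the basis of the past. -/
structure IsInteraction {Ω : Type*} {mΩ : MeasurableSpace Ω}
    (Pr : Measure Ω) (𝓖 : Filtration ℕ mΩ)
    (H K : ℕ) (P : ℕ → Kernel (S × A) S) (x₁ : S) (X : ℕ → ℕ → Ω → S) (Act : ℕ → ℕ → Ω → A)
    (r : ℕ → ℕ → Ω → S → A → ℝ) (π : ℕ → Ω → ℕ → S → A → ℝ) : Prop where
  initial : ∀ k < K, ∀ ω, X k 0 ω = x₁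
  state_measurable : ∀ k < K, ∀ h < H, Measurable[𝓖 (2 * (k * H + h))] (X k h)
  action_measurable : ∀ k < K, ∀ h < H, Measurable[𝓖 (2 * (k * H + h) + 1)] (Act k h)
  reward_measurable : ∀ k < K, ∀ h < H, ∀ a,
    Measurable[(𝓖 (2 * (k * H))).prod mS] fun p : Ω × S => r k h p.1 p.2 a
  reward_mem : ∀ k < K, ∀ h < H, ∀ ω x a, r k h ω x a ∈ Set.Icc (0 : ℝ) 1
  action_law : ∀ k < K, ∀ h < H, ∀ a,
    Pr⟦Act k h ⁻¹' {a} | 𝓖 (2 * (k * H + h))⟧ =ᵐ[Pr] fun ω => π k ω h (X k h ω) a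
  next_state_law : ∀ k < K, ∀ h, h + 1 < H → ∀ B : Set S, MeasurableSet B →
    Pr⟦X k (h + 1) ⁻¹' B | 𝓖 (2 * (k * H + h) + 1)⟧ =ᵐ[Pr]
      fun ω => (P h (X k h ω, Act k h ω)).real B

end MDP

section OPPO

/-- What the policy evaluation step uses of one past episode `τ`: for each step `h`, the vector
`φ^τ_h(x^τ_h, a^τ_h)` and the number `V^τ_{h+1}(x^τ_{h+1})`. -/
structure PastEpisode (d : ℕ) where
  feature : ℕ → EuclideanSpace ℝ (Fin d)
  target : ℕ → ℝ

/-- `Λ_h = ∑_τ φ^τ_h(x^τ_h, a^τ_h) φ^τ_h(x^τ_h, a^τ_h)ᵀ + lam • I`, over the past episodes `τ`. -/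
noncomputable def gram {d : ℕ} (lam : ℝ) (past : List (PastEpisode d)) (h : ℕ) :
    Matrix (Fin d) (Fin d) ℝ :=
  (past.map fun e => vecMulVec (e.feature h).ofLp (e.feature h).ofLp).sum + lam • 1

/-- `w_h = Λ_h⁻¹ ∑_τ φ^τ_h(x^τ_h, a^τ_h) V^τ_{h+1}(x^τ_{h+1})`, over the past episodes `τ`. -/
noncomputable def weight {d : ℕ} (lam : ℝ) (past : List (PastEpisode d)) (h : ℕ) : Fin d → ℝ :=
  (gram lam past h)⁻¹ *ᵥ (past.map fun e => e.target h • (e.feature h).ofLp).sum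

variable {S A : Type*} [MeasurableSpace S] [Fintype A] {d : ℕ}

/-- `φ(x, a) = ∫ ψ(x, a, x') V(x') dx'`. -/
noncomputable def feature (ν : Measure S) (ψ : S → A → S → EuclideanSpace ℝ (Fin d))
    (V : S → ℝ) (x : S) (a : A) : EuclideanSpace ℝ (Fin d) :=
  ∫ x', V x' • ψ x a x' ∂ν

/-- The bonus `Γ_h(x, a) = β (φ_h(x, a)ᵀ Λ_h⁻¹ φ_h(x, a))^{1/2}`, where `V` stands for `V_{h+1}`. -/
noncomputable def bonus (ν : Measure S) (ψ : S → A → S → EuclideanSpace ℝ (Fin d)) (lam β : ℝ)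
    (past : List (PastEpisode d)) (h : ℕ) (V : S → ℝ) (x : S) (a : A) : ℝ :=
  β * √((feature ν ψ V x a).ofLp ⬝ᵥ ((gram lam past h)⁻¹ *ᵥ (feature ν ψ V x a).ofLp))

/-- The estimated Q-function at step `h`, truncated to `[0, H - h]`, where `V` stands for `V_{h+1}`
and `r` is the reward function of the current episode. -/
noncomputable def estQ (H : ℕ) (ν : Measure S) (ψ : S → A → S → EuclideanSpace ℝ (Fin d))
    (lam β : ℝ) (past : List (PastEpisode d)) (r : ℕ → S → A → ℝ) (h : ℕ) (V : S → ℝ)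
    (x : S) (a : A) : ℝ :=
  max (min (r h x a + (feature ν ψ V x a).ofLp ⬝ᵥ weight lam past h
    + bonus ν ψ lam β past h V x a) ((H : ℝ) - h)) 0

/-- The estimated value function with `n` steps to go, that is, at step `H - n`:
`V_H = 0` and `V_h(x) = ∑_a Q_h(x, a) π_h(a | x)`. -/
noncomputable def estVToGo (H : ℕ) (ν : Measure S) (ψ : S → A → S → EuclideanSpace ℝ (Fin d))
    (lam β : ℝ) (past : List (PastEpisode d)) (r π : ℕ → S → A → ℝ) : ℕ → S → ℝ
  | 0 => fun _ => 0
  | n + 1 => fun x => ∑ a,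
      estQ H ν ψ lam β past r (H - (n + 1)) (estVToGo H ν ψ lam β past r π n) x a
        * π (H - (n + 1)) x a

/-- The estimated value function `V_h` at step `h`. -/
noncomputable def estV (H : ℕ) (ν : Measure S) (ψ : S → A → S → EuclideanSpace ℝ (Fin d))
    (lam β : ℝ) (past : List (PastEpisode d)) (r π : ℕ → S → A → ℝ) (h : ℕ) : S → ℝ :=
  estVToGo H ν ψ lam β past r π (H - h)

/-- The policy improvement step: `π_h(a | x) exp(α Q_h(x, a))`, normalized to a distribution. -/
noncomputable def improve (α : ℝ) (π Q : ℕ → S → A → ℝ) : ℕ → S → A → ℝ := fun h x a =>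
  π h x a * Real.exp (α * Q h x a) / ∑ b, π h x b * Real.exp (α * Q h x b)

/-- The memory of OPPO between two episodes: the latest policy, the latest estimated
Q-function, and the data of the past episodes. -/
structure OPPOState (S A : Type*) (d : ℕ) where
  policy : ℕ → S → A → ℝ
  Q : ℕ → S → A → ℝ
  past : List (PastEpisode d)

/-- The memory of OPPO at the beginning of episode `k`, when `x τ h`, `a τ h` are the states and
actions and `r τ h` the reward functions observed in the episodes `τ < k`. -/
noncomputable def oppoState (H : ℕ) (ν : Measure S) (ψ : S → A → S → EuclideanSpace ℝ (Fin d))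
    (α lam β : ℝ) (x : ℕ → ℕ → S) (a : ℕ → ℕ → A) (r : ℕ → ℕ → S → A → ℝ) :
    ℕ → OPPOState S A d
  | 0 => ⟨fun _ _ _ => 1 / (Fintype.card A : ℝ), fun _ _ _ => 0, []⟩
  | k + 1 =>
      let s := oppoState H ν ψ α lam β x a r k
      let π := improve α s.policy s.Q
      let V := estV H ν ψ lam β s.past (r k) π
      { policy := π
        Q := fun h => estQ H ν ψ lam β s.past (r k) h (V (h + 1))
        past := s.past ++ [⟨fun h => feature ν ψ (V (h + 1)) (x k h) (a k h),
                            fun h => V (h + 1) (x k (h + 1))⟩] }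

/-- The policy that OPPO executes in episode `k`. -/
noncomputable def oppoPolicy (H : ℕ) (ν : Measure S) (ψ : S → A → S → EuclideanSpace ℝ (Fin d))
    (α lam β : ℝ) (x : ℕ → ℕ → S) (a : ℕ → ℕ → A) (r : ℕ → ℕ → S → A → ℝ) (k : ℕ) :
    ℕ → S → A → ℝ :=
  improve α (oppoState H ν ψ α lam β x a r k).policy (oppoState H ν ψ α lam β x a r k).Q

end OPPO

/-! Fix a comparator `π'`. In episode `k` the regret splits as (V^{π'} - V^k) + (V^k - V^{π^k}),
where V^k and Q^k are the estimates of OPPO.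

Estimation. In a linear MDP, P_h V = ⟨φ, θ_h⟩ with φ = ∫ ψ V and the same θ_h for every V.
Regressing V^τ_{h+1}(x^τ_{h+1}) on φ^τ_h therefore estimates θ_h, although the target function
changes with the episode. Moreover V^τ is determined by the information at the beginning of episode
τ, so the regression noise is a martingale difference and no union bound over a class of value
functions is required. Self-normalized concentration (`measure_ridge_noise_le`) and Cauchy–Schwarz
(`abs_ridge_sub_le`) bound the prediction error by the bonus Γ^k, whence r + P V^k ≤ Q^k ≤ r + P V^k
+ 2 Γ^k (`oppoQ_bounds`).

First difference. The performance difference lemma (`value_sub_eq_sum`) and the lower bound on Q^k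
leave the expectation, along trajectories of `π'`, of ⟨Q^k_h, π'_h - π^k_h⟩. The law of these
trajectories is the same for all k, so at each state the sum over k is the regret of exponential
weights with gains Q^k (`sum_exp_weights_le`, `sum_value_sub_oppoV_le`).

Second difference. Along the observed trajectory it telescopes (`oppoV_sub_policyV_eq`) into the
Bellman errors at the visited pairs, each at most twice the bonus, and two sums of martingale
differences. The bonuses are summed by the elliptical potential lemma
(`sum_min_one_inv_dotProduct_le`), the martingales by `measure_sum_martingale_difference_le`.

Both concentration inequalities are instances of `measure_self_normalized_le`: with q the squared
self-normalized length and p the determinant, exp(q/2)/√p has nonincreasing expectation, because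
convexity reduces increments in [-1, 1] to the two signs ±1. A union bound over the H(K + 2) events
concludes. -/

set_option linter.unusedSectionVars false

/-! ### Ridge regression: rank-one updates, determinants, elliptical potential -/

section RidgeGram

variable {n : Type*} [Fintype n] [DecidableEq n]

theorem Matrix.PosDef.inv_dotProduct_comm {G : Matrix n n ℝ} (hG : G.PosDef) (x y : n → ℝ) :
    x ⬝ᵥ (G⁻¹ *ᵥ y) = y ⬝ᵥ (G⁻¹ *ᵥ x) := by
  have hsymm : (G⁻¹)ᵀ = G⁻¹ := by
    have := hG.inv.isHermitian
    rwa [Matrix.IsHermitian, conjTranspose_eq_transpose_of_trivial] at this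
  rw [dotProduct_mulVec, ← mulVec_transpose, hsymm, dotProduct_comm]

theorem Matrix.PosDef.inv_dotProduct_self_nonneg {G : Matrix n n ℝ} (hG : G.PosDef) (x : n → ℝ) :
    0 ≤ x ⬝ᵥ (G⁻¹ *ᵥ x) := by
  simpa using hG.inv.posSemidef.dotProduct_mulVec_nonneg x

theorem Matrix.PosDef.add_vecMulVec {G : Matrix n n ℝ} (hG : G.PosDef) (v : n → ℝ) :
    (G + vecMulVec v v).PosDef := by
  have h := posSemidef_vecMulVec_self_star v
  rw [star_trivial] at h
  exact hG.add_posSemidef h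

/-- The Sherman–Morrison formula, applied to a vector. -/
theorem Matrix.PosDef.inv_add_vecMulVec_mulVec {G : Matrix n n ℝ} (hG : G.PosDef) (v y : n → ℝ) :
    (G + vecMulVec v v)⁻¹ *ᵥ y =
      G⁻¹ *ᵥ y - ((v ⬝ᵥ (G⁻¹ *ᵥ y)) / (1 + v ⬝ᵥ (G⁻¹ *ᵥ v))) • (G⁻¹ *ᵥ v) := by
  have hu := hG.inv_dotProduct_self_nonneg v
  have hdet : IsUnit G.det := (isUnit_iff_isUnit_det G).1 hG.isUnit
  have hdet' : IsUnit (G + vecMulVec v v).det :=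
    (isUnit_iff_isUnit_det _).1 (hG.add_vecMulVec v).isUnit
  have key : (G + vecMulVec v v) *ᵥ
      (G⁻¹ *ᵥ y - ((v ⬝ᵥ (G⁻¹ *ᵥ y)) / (1 + v ⬝ᵥ (G⁻¹ *ᵥ v))) • (G⁻¹ *ᵥ v)) = y := by
    have h1 : ∀ z : n → ℝ, vecMulVec v v *ᵥ z = (v ⬝ᵥ z) • v := fun z => by
      rw [vecMulVec_mulVec]; ext i; simp [mul_comm]
    rw [add_mulVec, h1, mulVec_sub, mulVec_smul, mulVec_mulVec, mulVec_mulVec,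
      mul_nonsing_inv _ hdet, one_mulVec, one_mulVec, dotProduct_sub, dotProduct_smul, sub_add,
      ← sub_smul]
    set u := v ⬝ᵥ (G⁻¹ *ᵥ v)
    set t := v ⬝ᵥ (G⁻¹ *ᵥ y)
    have : t / (1 + u) - (t - (t / (1 + u)) • u) = 0 := by
      simp only [smul_eq_mul]; field_simp; ring
    rw [this]; simp
  conv_lhs => rw [← key]
  rw [mulVec_mulVec, nonsing_inv_mul _ hdet', one_mulVec]

theorem Matrix.PosDef.det_add_vecMulVec {G : Matrix n n ℝ} (hG : G.PosDef) (v : n → ℝ) :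
    (G + vecMulVec v v).det = G.det * (1 + v ⬝ᵥ (G⁻¹ *ᵥ v)) := by
  have hdet : IsUnit G.det := (isUnit_iff_isUnit_det G).1 hG.isUnit
  rw [vecMulVec_eq Unit, det_add_replicateCol_mul_replicateRow hdet,
    det_unique (1 + replicateRow Unit v * G⁻¹ * replicateCol Unit v)]
  congr 1
  rw [add_apply, one_apply_eq]
  congr 1
  rw [Matrix.mul_assoc, ← replicateCol_mulVec, replicateRow_mul_replicateCol_apply]

/-- Sherman–Morrison, expanded in the quadratic form. Half the increment is the exponent of
`updateFactor` with `s = v ⬝ᵥ (G⁻¹ *ᵥ S)` and `u = v ⬝ᵥ (G⁻¹ *ᵥ v)`; the case `ε = 0` shows that the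
inverse form decreases as the Gram matrix grows. -/
theorem Matrix.PosDef.inv_add_vecMulVec_dotProduct {G : Matrix n n ℝ} (hG : G.PosDef)
    (v S : n → ℝ) (ε : ℝ) :
    (S + ε • v) ⬝ᵥ ((G + vecMulVec v v)⁻¹ *ᵥ (S + ε • v)) =
      S ⬝ᵥ (G⁻¹ *ᵥ S) + (2 * (v ⬝ᵥ (G⁻¹ *ᵥ S)) * ε + (v ⬝ᵥ (G⁻¹ *ᵥ v)) * ε ^ 2
        - (v ⬝ᵥ (G⁻¹ *ᵥ S)) ^ 2) / (1 + v ⬝ᵥ (G⁻¹ *ᵥ v)) := by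
  have hu := hG.inv_dotProduct_self_nonneg v
  rw [hG.inv_add_vecMulVec_mulVec]
  simp only [mulVec_add, mulVec_smul, dotProduct_add, add_dotProduct, dotProduct_sub,
    smul_dotProduct, dotProduct_smul, smul_eq_mul, hG.inv_dotProduct_comm S v]
  field_simp
  ring

theorem Matrix.PosDef.inv_dotProduct_sq_le {G : Matrix n n ℝ} (hG : G.PosDef) (x y : n → ℝ) :
    (x ⬝ᵥ (G⁻¹ *ᵥ y)) ^ 2 ≤ (x ⬝ᵥ (G⁻¹ *ᵥ x)) * (y ⬝ᵥ (G⁻¹ *ᵥ y)) := by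
  have h := LinearMap.BilinForm.apply_mul_apply_le_of_forall_zero_le
    (Matrix.toLinearMap₂' ℝ (G⁻¹)) (fun z => by
      simpa [Matrix.toLinearMap₂'_apply'] using hG.inv_dotProduct_self_nonneg z) x y
  simp only [Matrix.toLinearMap₂'_apply'] at h
  rw [hG.inv_dotProduct_comm y x] at h
  rwa [sq]

theorem Matrix.PosDef.abs_inv_dotProduct_le {G : Matrix n n ℝ} (hG : G.PosDef) (x y : n → ℝ) :
    |x ⬝ᵥ (G⁻¹ *ᵥ y)| ≤ √(x ⬝ᵥ (G⁻¹ *ᵥ x)) * √(y ⬝ᵥ (G⁻¹ *ᵥ y)) := by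
  rw [← Real.sqrt_mul (hG.inv_dotProduct_self_nonneg x)]
  exact Real.abs_le_sqrt (hG.inv_dotProduct_sq_le x y)

/-- The eigenvalues are nonnegative, so each is at most the trace. The sharper bound by their mean
is not needed, as only the logarithm of the determinant matters. -/
theorem Matrix.PosSemidef.det_le_trace_pow {G : Matrix n n ℝ} (hG : G.PosSemidef) :
    G.det ≤ G.trace ^ Fintype.card n := by
  rw [hG.isHermitian.det_eq_prod_eigenvalues, hG.isHermitian.trace_eq_sum_eigenvalues]
  simp only [RCLike.ofReal_real_eq_id, id_eq]
  rw [← Finset.card_univ, ← Finset.prod_const]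
  exact Finset.prod_le_prod (fun i _ => hG.eigenvalues_nonneg i) fun i hi =>
    Finset.single_le_sum (f := hG.isHermitian.eigenvalues)
      (fun j _ => hG.eigenvalues_nonneg j) hi

/-- The regularized Gram matrix `I + ∑_{t < k} v_t v_tᵀ`. -/
noncomputable def ridgeGram (v : ℕ → n → ℝ) (k : ℕ) : Matrix n n ℝ :=
  1 + ∑ t ∈ Finset.range k, vecMulVec (v t) (v t)

theorem ridgeGram_zero (v : ℕ → n → ℝ) : ridgeGram v 0 = 1 := by simp [ridgeGram]

theorem ridgeGram_succ (v : ℕ → n → ℝ) (k : ℕ) :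
    ridgeGram v (k + 1) = ridgeGram v k + vecMulVec (v k) (v k) := by
  simp [ridgeGram, Finset.sum_range_succ, add_assoc]

theorem posDef_ridgeGram (v : ℕ → n → ℝ) (k : ℕ) : (ridgeGram v k).PosDef := by
  induction k with
  | zero => rw [ridgeGram_zero]; exact PosDef.one
  | succ k ih => rw [ridgeGram_succ]; exact ih.add_vecMulVec _

theorem ridgeGram_inv_dotProduct_le (v : ℕ → n → ℝ) (k : ℕ) (x : n → ℝ) :
    x ⬝ᵥ ((ridgeGram v k)⁻¹ *ᵥ x) ≤ x ⬝ᵥ x := by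
  induction k with
  | zero => simp [ridgeGram_zero]
  | succ k ih =>
    have h := (posDef_ridgeGram v k).inv_add_vecMulVec_dotProduct (v k) x 0
    simp only [zero_smul, add_zero, mul_zero, ne_eq, OfNat.ofNat_ne_zero, not_false_eq_true,
      zero_pow, zero_sub] at h
    rw [ridgeGram_succ, h]
    have hu := (posDef_ridgeGram v k).inv_dotProduct_self_nonneg (v k)
    have : -(v k ⬝ᵥ ((ridgeGram v k)⁻¹ *ᵥ x)) ^ 2 /
        (1 + v k ⬝ᵥ ((ridgeGram v k)⁻¹ *ᵥ v k)) ≤ 0 :=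
      div_nonpos_of_nonpos_of_nonneg (by nlinarith [sq_nonneg (v k ⬝ᵥ ((ridgeGram v k)⁻¹ *ᵥ x))])
        (by linarith)
    linarith

theorem one_le_det_ridgeGram (v : ℕ → n → ℝ) (k : ℕ) : 1 ≤ (ridgeGram v k).det := by
  induction k with
  | zero => simp [ridgeGram_zero]
  | succ k ih =>
    have hu := (posDef_ridgeGram v k).inv_dotProduct_self_nonneg (v k)
    rw [ridgeGram_succ, (posDef_ridgeGram v k).det_add_vecMulVec]
    nlinarith

theorem trace_ridgeGram (v : ℕ → n → ℝ) (k : ℕ) :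
    (ridgeGram v k).trace = Fintype.card n + ∑ t ∈ Finset.range k, v t ⬝ᵥ v t := by
  simp [ridgeGram, trace_sum, trace_vecMulVec]

theorem log_det_ridgeGram_le (v : ℕ → n → ℝ) (k : ℕ) {B : ℝ}
    (hB : ∀ t < k, v t ⬝ᵥ v t ≤ B) :
    Real.log (ridgeGram v k).det ≤ Fintype.card n * Real.log (Fintype.card n + k * B) := by
  have h1 := one_le_det_ridgeGram v k
  have h2 := (posDef_ridgeGram v k).posSemidef.det_le_trace_pow
  have h3 : (ridgeGram v k).trace ≤ Fintype.card n + k * B := by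
    rw [trace_ridgeGram]
    gcongr
    calc _ ≤ ∑ t ∈ Finset.range k, B :=
          Finset.sum_le_sum fun t ht => hB t (Finset.mem_range.1 ht)
      _ = k * B := by simp
  have h4 : 0 ≤ (ridgeGram v k).trace := (posDef_ridgeGram v k).posSemidef.trace_nonneg
  rw [← Real.log_pow]
  exact Real.log_le_log (by linarith) (h2.trans (pow_le_pow_left₀ h4 h3 _))

/-- From `1 - 1 / t ≤ log t` at `t = 1 + min 1 u`, where `1 / t ≥ 1 / 2`. -/
theorem min_one_le_two_mul_log_one_add {u : ℝ} (hu : 0 ≤ u) :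
    min 1 u ≤ 2 * Real.log (1 + u) := by
  have h1 : (1 + min 1 u)⁻¹ * min 1 u ≤ Real.log (1 + min 1 u) := by
    have hm : 0 ≤ min 1 u := le_min zero_le_one hu
    have := Real.one_sub_inv_le_log_of_pos (x := 1 + min 1 u) (by linarith)
    have h2 : 1 - (1 + min 1 u)⁻¹ = (1 + min 1 u)⁻¹ * min 1 u := by field_simp; ring
    linarith
  have hm : 0 ≤ min 1 u := le_min zero_le_one hu
  have hm1 : min 1 u ≤ 1 := min_le_left _ _
  have h2 : (1 / 2 : ℝ) ≤ (1 + min 1 u)⁻¹ := by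
    rw [one_div]; exact inv_anti₀ (by linarith) (by linarith)
  have h3 : Real.log (1 + min 1 u) ≤ Real.log (1 + u) :=
    Real.log_le_log (by linarith) (by linarith [min_le_right 1 u])
  nlinarith

/-- The elliptical potential lemma. -/
theorem sum_min_one_inv_dotProduct_le (v : ℕ → n → ℝ) (K : ℕ) :
    ∑ k ∈ Finset.range K, min 1 (v k ⬝ᵥ ((ridgeGram v k)⁻¹ *ᵥ v k)) ≤
      2 * Real.log (ridgeGram v K).det := by
  induction K with
  | zero => simp [ridgeGram_zero]
  | succ K ih =>
    have hu := (posDef_ridgeGram v K).inv_dotProduct_self_nonneg (v K)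
    have h1 := one_le_det_ridgeGram v K
    -- The determinant is multiplied by `1 + u`, so its logarithm grows by `log (1 + u)`, which is
    -- at least half of the new summand.
    rw [Finset.sum_range_succ, ridgeGram_succ, (posDef_ridgeGram v K).det_add_vecMulVec,
      Real.log_mul (by linarith) (by linarith)]
    linarith [min_one_le_two_mul_log_one_add hu]

/-- The prediction error of ridge regression with responses `y_t = ⟨v_t, θ⟩ + c ε_t`. -/
theorem abs_ridge_sub_le (v : ℕ → n → ℝ) (k : ℕ) (θ : n → ℝ) (y ε : ℕ → ℝ) (c : ℝ) (hc : 0 ≤ c)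
    (hy : ∀ t < k, y t = v t ⬝ᵥ θ + c * ε t) (x : n → ℝ) :
    |x ⬝ᵥ ((ridgeGram v k)⁻¹ *ᵥ ∑ t ∈ Finset.range k, y t • v t) - x ⬝ᵥ θ| ≤
      √(x ⬝ᵥ ((ridgeGram v k)⁻¹ *ᵥ x)) *
        (c * √((∑ t ∈ Finset.range k, ε t • v t) ⬝ᵥ
          ((ridgeGram v k)⁻¹ *ᵥ ∑ t ∈ Finset.range k, ε t • v t)) + √(θ ⬝ᵥ θ)) := by
  have hG := posDef_ridgeGram v k
  have hdet : IsUnit (ridgeGram v k).det := (isUnit_iff_isUnit_det _).1 hG.isUnit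
  set S := ∑ t ∈ Finset.range k, ε t • v t
  -- As `∑ v_t v_tᵀ` is the Gram matrix minus `1`, the noiseless part of the responses returns `θ`
  -- up to the bias of the regularization. The error is `c xᵀG⁻¹S - xᵀG⁻¹θ`, and Cauchy–Schwarz for
  -- the form `G⁻¹` bounds both terms.
  have h1 : ∑ t ∈ Finset.range k, y t • v t = ridgeGram v k *ᵥ θ - θ + c • S := by
    have h2 : ridgeGram v k *ᵥ θ = θ + ∑ t ∈ Finset.range k, (v t ⬝ᵥ θ) • v t := by
      rw [ridgeGram, add_mulVec, one_mulVec, sum_mulVec]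
      congr 1
      refine Finset.sum_congr rfl fun t _ => ?_
      rw [vecMulVec_mulVec]; ext i; simp [mul_comm]
    rw [h2, add_sub_cancel_left, Finset.smul_sum, ← Finset.sum_add_distrib]
    refine Finset.sum_congr rfl fun t ht => ?_
    rw [hy t (Finset.mem_range.1 ht), add_smul, mul_smul]
  rw [h1, mulVec_add, mulVec_sub, mulVec_mulVec, nonsing_inv_mul _ hdet, one_mulVec, mulVec_smul,
    dotProduct_add, dotProduct_sub, dotProduct_smul, smul_eq_mul]
  have hS := hG.abs_inv_dotProduct_le x S
  have hθ := hG.abs_inv_dotProduct_le x θ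
  have hθ' : √(θ ⬝ᵥ ((ridgeGram v k)⁻¹ *ᵥ θ)) ≤ √(θ ⬝ᵥ θ) :=
    Real.sqrt_le_sqrt (ridgeGram_inv_dotProduct_le v k θ)
  have hx := Real.sqrt_nonneg (x ⬝ᵥ ((ridgeGram v k)⁻¹ *ᵥ x))
  calc _ = |c * (x ⬝ᵥ ((ridgeGram v k)⁻¹ *ᵥ S)) - x ⬝ᵥ ((ridgeGram v k)⁻¹ *ᵥ θ)| := by
        congr 1; ring
    _ ≤ |c * (x ⬝ᵥ ((ridgeGram v k)⁻¹ *ᵥ S))| + |x ⬝ᵥ ((ridgeGram v k)⁻¹ *ᵥ θ)| := abs_sub _ _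
    _ ≤ _ := by
        rw [abs_mul, abs_of_nonneg hc, mul_add]
        have := mul_le_mul_of_nonneg_left hS hc
        have := mul_le_mul_of_nonneg_left hθ' hx
        linarith

end RidgeGram

/-! ### Self-normalized concentration of martingales -/

section Concentration

/-- A convex function on `[-1, 1]` lies below its chord. -/
theorem ConvexOn.le_chord {f : ℝ → ℝ} (hf : ConvexOn ℝ Set.univ f) {x : ℝ} (hx : |x| ≤ 1) :
    f x ≤ (f 1 + f (-1)) / 2 + (f 1 - f (-1)) / 2 * x := by
  obtain ⟨h1, h2⟩ := abs_le.1 hx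
  have h := hf.2 (Set.mem_univ 1) (Set.mem_univ (-1)) 
    (show 0 ≤ (1 + x) / 2 by linarith) (show 0 ≤ (1 - x) / 2 by linarith) (by ring)
  simp only [smul_eq_mul] at h
  rw [show (1 + x) / 2 * 1 + (1 - x) / 2 * -1 = x by ring] at h
  linarith

/-- The exponential factor by which `exp (q / 2)` grows under a rank-one update, where `q` is
the squared self-normalized length. -/
noncomputable def updateFactor (s u x : ℝ) : ℝ :=
  Real.exp ((2 * s * x + u * x ^ 2 - s ^ 2) / (1 + u) / 2) / √(1 + u)

theorem updateFactor_nonneg (s u x : ℝ) : 0 ≤ updateFactor s u x := by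
  unfold updateFactor; positivity

/-- Completing the square, the numerator is `(1 + u) x² - (s - x)² ≤ 1 + u`. This crude bound serves
boundedness, hence integrability. -/
theorem updateFactor_le {s u x : ℝ} (hu : 0 ≤ u) (hx : |x| ≤ 1) :
    updateFactor s u x ≤ Real.exp (1 / 2) := by
  have hx2 : x ^ 2 ≤ 1 := by rw [← sq_abs]; exact pow_le_one₀ (abs_nonneg x) hx
  have h1 : (1 : ℝ) ≤ √(1 + u) := Real.one_le_sqrt.2 (by linarith)
  have h2 : (2 * s * x + u * x ^ 2 - s ^ 2) / (1 + u) / 2 ≤ 1 / 2 := by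
    have : (2 * s * x + u * x ^ 2 - s ^ 2) / (1 + u) ≤ 1 := by
      rw [div_le_one (by linarith)]
      nlinarith [sq_nonneg (s - x)]
    linarith
  exact (div_le_self (Real.exp_pos _).le h1).trans (Real.exp_le_exp.2 h2)

theorem convexOn_updateFactor {s u : ℝ} (hu : 0 ≤ u) :
    ConvexOn ℝ Set.univ (updateFactor s u) := by
  have h1 : ConvexOn ℝ Set.univ fun x : ℝ => (2 * s * x + u * x ^ 2 - s ^ 2) / (1 + u) / 2 := by
    have hsq : ConvexOn ℝ Set.univ fun x : ℝ => x ^ 2 := Even.convexOn_pow (by decide)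
    refine ⟨convex_univ, fun x hx y hy a b ha hb hab => ?_⟩
    have h := hsq.2 hx hy ha hb hab
    simp only [smul_eq_mul] at h ⊢
    have hb' : b = 1 - a := by linarith
    rw [← mul_div_assoc, ← mul_div_assoc, ← mul_div_assoc, ← mul_div_assoc, ← add_div, ← add_div]
    gcongr
    have := mul_le_mul_of_nonneg_left h hu
    subst hb'
    nlinarith
  have h2 : ConvexOn ℝ Set.univ fun x : ℝ =>
      Real.exp ((2 * s * x + u * x ^ 2 - s ^ 2) / (1 + u) / 2) := by
    refine ⟨convex_univ, fun x hx y hy a b ha hb hab => ?_⟩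
    exact (Real.exp_le_exp.2 (h1.2 hx hy ha hb hab)).trans
      (convexOn_exp.2 (Set.mem_univ _) (Set.mem_univ _) ha hb hab)
  refine ⟨convex_univ, fun x hx y hy a b ha hb hab => ?_⟩
  have h := h2.2 hx hy ha hb hab
  unfold updateFactor
  simp only [smul_eq_mul] at h ⊢
  rw [← mul_div_assoc, ← mul_div_assoc, ← add_div]
  gcongr

/-- Averaging the signs turns the linear term into `cosh (s / (1 + u)) ≤ exp (s² / (2 (1 + u)²))`.
Twice the total exponent is then `u / (1 + u) - u s² / (1 + u)² ≤ 1 - 1 / (1 + u) ≤ log (1 + u)`,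
which the denominator `√(1 + u)` absorbs. -/
theorem updateFactor_one_add_neg_one_le {s u : ℝ} (hu : 0 ≤ u) :
    (updateFactor s u 1 + updateFactor s u (-1)) / 2 ≤ 1 := by
  have h0 : 0 < 1 + u := by linarith
  have hs : 0 < √(1 + u) := Real.sqrt_pos.2 h0
  have e1 : (updateFactor s u 1 + updateFactor s u (-1)) / 2 =
      Real.exp ((u - s ^ 2) / (1 + u) / 2) * Real.cosh (s / (1 + u)) / √(1 + u) := by
    unfold updateFactor
    rw [Real.cosh_eq, show (2 * s * 1 + u * 1 ^ 2 - s ^ 2) / (1 + u) / 2 =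
      (u - s ^ 2) / (1 + u) / 2 + s / (1 + u) by field_simp; ring,
      show (2 * s * (-1) + u * (-1) ^ 2 - s ^ 2) / (1 + u) / 2 =
      (u - s ^ 2) / (1 + u) / 2 + -(s / (1 + u)) by field_simp; ring, Real.exp_add, Real.exp_add]
    field_simp
  rw [e1, div_le_one hs]
  calc _ ≤ Real.exp ((u - s ^ 2) / (1 + u) / 2) * Real.exp ((s / (1 + u)) ^ 2 / 2) := by
        gcongr; exact Real.cosh_le_exp_half_sq _
    _ = Real.exp (((u - s ^ 2) / (1 + u) + (s / (1 + u)) ^ 2) / 2) := by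
        rw [← Real.exp_add]; congr 1; ring
    _ ≤ Real.exp (Real.log (1 + u) / 2) := by
        gcongr
        have h1 := Real.one_sub_inv_le_log_of_pos h0
        have h2 : (u - s ^ 2) / (1 + u) + (s / (1 + u)) ^ 2 ≤ 1 - (1 + u)⁻¹ := by
          have : 1 - (1 + u)⁻¹ - ((u - s ^ 2) / (1 + u) + (s / (1 + u)) ^ 2) =
              u * s ^ 2 / (1 + u) ^ 2 := by field_simp; ring
          have : 0 ≤ u * s ^ 2 / (1 + u) ^ 2 := by positivity
          linarith
        linarith
    _ = √(1 + u) := by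
        rw [← Real.log_sqrt h0.le, Real.exp_log hs]

variable {Ω : Type*} {m mΩ : MeasurableSpace Ω} {Pr : Measure Ω} [IsProbabilityMeasure Pr]

theorem integral_mul_eq_zero_of_condExp_eq_zero (hm : m ≤ mΩ) {Y D : Ω → ℝ}
    (hY : Measurable[m] Y) {B : ℝ} (hB : ∀ ω, |Y ω| ≤ B) (hD : Integrable D Pr)
    (h : Pr[D | m] =ᵐ[Pr] 0) : ∫ ω, Y ω * D ω ∂Pr = 0 := by
  have hint : Integrable (Y * D) Pr :=
    hD.bdd_mul (hY.mono hm le_rfl).aestronglyMeasurable (Filter.Eventually.of_forall hB)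
  have h1 := condExp_mul_of_stronglyMeasurable_left (μ := Pr) hY.stronglyMeasurable hint hD
  have h2 : Pr[Y * D | m] =ᵐ[Pr] 0 := by
    filter_upwards [h1, h] with ω h1 h
    rw [h1, Pi.mul_apply, h]; simp
  calc ∫ ω, Y ω * D ω ∂Pr = ∫ ω, (Pr[Y * D | m]) ω ∂Pr := (integral_condExp hm).symm
    _ = 0 := by rw [integral_congr_ae h2]; simp

theorem measurable_updateFactor {s u x : Ω → ℝ} (hs : Measurable[m] s) (hu : Measurable[m] u)
    (hx : Measurable[m] x) : Measurable[m] fun ω => updateFactor (s ω) (u ω) (x ω) := by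
  unfold updateFactor; fun_prop

/-- The supermartingale step. The chord over `[-1, 1]` bounds the convex function `updateFactor` by
an affine function of `D`. Its slope is `m`-measurable and bounded, so the linear term integrates to
zero; its constant term is at most `1`. -/
theorem integral_mul_updateFactor_le (hm : m ≤ mΩ) {Z s u D : Ω → ℝ} (hZ : Measurable[m] Z)
    (hZ0 : ∀ ω, 0 ≤ Z ω) {B : ℝ} (hZB : ∀ ω, Z ω ≤ B) (hs : Measurable[m] s)
    (hu : Measurable[m] u) (hu0 : ∀ ω, 0 ≤ u ω) (hD : Measurable D) (hD1 : ∀ ω, |D ω| ≤ 1)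
    (h : Pr[D | m] =ᵐ[Pr] 0) :
    ∫ ω, Z ω * updateFactor (s ω) (u ω) (D ω) ∂Pr ≤ ∫ ω, Z ω ∂Pr := by
  have hDi : Integrable D Pr :=
    Integrable.of_bound hD.aestronglyMeasurable 1 (Filter.Eventually.of_forall hD1)
  have hB0 : ∀ ω : Ω, 0 ≤ B := fun ω => (hZ0 ω).trans (hZB ω)
  set Y : Ω → ℝ := fun ω => Z ω *
    ((updateFactor (s ω) (u ω) 1 - updateFactor (s ω) (u ω) (-1)) / 2)
  have hYm : Measurable[m] Y :=
    hZ.mul (((measurable_updateFactor hs hu measurable_const).sub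
      (measurable_updateFactor hs hu measurable_const)).div_const 2)
  have hYB : ∀ ω, |Y ω| ≤ B * Real.exp (1 / 2) := fun ω => by
    simp only [Y]
    rw [abs_mul, abs_of_nonneg (hZ0 ω)]
    refine mul_le_mul (hZB ω) ?_ (abs_nonneg _) (hB0 ω)
    have h1 := updateFactor_le (s := s ω) (x := 1) (hu0 ω) (by simp)
    have h2 := updateFactor_le (s := s ω) (x := -1) (hu0 ω) (by simp)
    have h3 := updateFactor_nonneg (s ω) (u ω) 1
    have h4 := updateFactor_nonneg (s ω) (u ω) (-1)
    rw [abs_le]; constructor <;> linarith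
  have hYD := integral_mul_eq_zero_of_condExp_eq_zero hm hYm hYB hDi h
  have hZi : Integrable Z Pr := Integrable.of_bound (hZ.mono hm le_rfl).aestronglyMeasurable B
    (Filter.Eventually.of_forall fun ω => by
      rw [Real.norm_eq_abs, abs_of_nonneg (hZ0 ω)]; exact hZB ω)
  have hYDi : Integrable (fun ω => Y ω * D ω) Pr :=
    hDi.bdd_mul (hYm.mono hm le_rfl).aestronglyMeasurable (Filter.Eventually.of_forall hYB)
  calc _ ≤ ∫ ω, (Z ω + Y ω * D ω) ∂Pr := by
        refine integral_mono_of_nonneg (Filter.Eventually.of_forall fun ω => ?_)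
          (hZi.add hYDi) (Filter.Eventually.of_forall fun ω => ?_)
        · exact mul_nonneg (hZ0 ω) (updateFactor_nonneg _ _ _)
        · have h1 := (convexOn_updateFactor (s := s ω) (hu0 ω)).le_chord (hD1 ω)
          have h2 := updateFactor_one_add_neg_one_le (s := s ω) (hu0 ω)
          have h3 := mul_le_mul_of_nonneg_left (h1.trans (add_le_add_left h2 _)) (hZ0 ω)
          calc _ ≤ _ := h3
            _ = _ := by simp only [Y]; ring
    _ = ∫ ω, Z ω ∂Pr := by rw [integral_add hZi hYDi, hYD, add_zero]

/-- Self-normalized concentration for bounded martingale differences `D`: here `q` plays the role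
of the squared self-normalized length and `p` that of the determinant of the Gram matrix. -/
theorem measure_self_normalized_le {𝓕 : ℕ → MeasurableSpace Ω} {K : ℕ} (h𝓕 : ∀ k < K, 𝓕 k ≤ mΩ)
    {s u D q p : ℕ → Ω → ℝ}
    (hs : ∀ k < K, Measurable[𝓕 k] (s k)) (hu : ∀ k < K, Measurable[𝓕 k] (u k))
    (hq : ∀ k < K, Measurable[𝓕 k] (q k)) (hp : ∀ k < K, Measurable[𝓕 k] (p k))
    (hu0 : ∀ k < K, ∀ ω, 0 ≤ u k ω) (hD : ∀ k < K, Measurable (D k))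
    (hD1 : ∀ k < K, ∀ ω, |D k ω| ≤ 1) (hD0 : ∀ k < K, Pr[D k | 𝓕 k] =ᵐ[Pr] 0)
    (hq0 : ∀ ω, q 0 ω = 0) (hp0 : ∀ ω, p 0 ω = 1)
    (hqs : ∀ k < K, ∀ ω, q (k + 1) ω =
      q k ω + (2 * s k ω * D k ω + u k ω * D k ω ^ 2 - s k ω ^ 2) / (1 + u k ω))
    (hps : ∀ k < K, ∀ ω, p (k + 1) ω = p k ω * (1 + u k ω)) {δ : ℝ} (hδ : 0 < δ) :
    Pr {ω | ¬ q K ω ≤ Real.log (p K ω) + 2 * Real.log (1 / δ)} ≤ ENNReal.ofReal δ := by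
  -- For vectors this is the closed form of the average, over a standard Gaussian `l`, of `exp (⟨l,
  -- S_k⟩ - ∑ ⟨l, v_t⟩² / 2)` with `S_k = ∑ D_t v_t`. Each step multiplies it by `updateFactor`, and
  -- Markov's inequality at level `1 / δ` is the claim.
  set Z : ℕ → Ω → ℝ := fun k ω => Real.exp (q k ω / 2) / √(p k ω) with hZdef
  have hZ0 : ∀ k ω, 0 ≤ Z k ω := fun k ω => by simp only [Z]; positivity
  have hp1 : ∀ k ≤ K, ∀ ω, 1 ≤ p k ω := fun k hk ω => by
    induction k with
    | zero => rw [hp0]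
    | succ k ih =>
      rw [hps k hk]
      have := ih (Nat.le_of_succ_le hk)
      have := hu0 k hk ω
      nlinarith
  have hZs : ∀ k < K, ∀ ω, Z (k + 1) ω = Z k ω * updateFactor (s k ω) (u k ω) (D k ω) :=
    fun k hk ω => by
      simp only [Z, updateFactor]
      rw [hqs k hk, hps k hk, Real.sqrt_mul (by linarith [hp1 k hk.le ω]), add_div, Real.exp_add]
      rw [div_mul_div_comm]
  have hZB : ∀ k ≤ K, ∀ ω, Z k ω ≤ Real.exp (1 / 2) ^ k := fun k hk ω => by
    induction k with
    | zero => simp [Z, hq0, hp0]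
    | succ k ih =>
      rw [hZs k hk, pow_succ]
      exact mul_le_mul (ih (Nat.le_of_succ_le hk)) (updateFactor_le (hu0 k hk ω) (hD1 k hk ω))
        (updateFactor_nonneg _ _ _) (by positivity)
  have hZm : ∀ k < K, Measurable[𝓕 k] (Z k) := fun k hk => by
    have := hq k hk
    have := hp k hk
    simp only [Z]
    fun_prop
  have hZmΩ : ∀ k ≤ K, Measurable (Z k) := fun k hk => by
    induction k with
    | zero => simp only [Z, hq0, hp0]; exact measurable_const
    | succ k ih =>
      have h1 := (hs k hk).mono (h𝓕 k hk) le_rfl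
      have h2 := (hu k hk).mono (h𝓕 k hk) le_rfl
      have : Z (k + 1) = fun ω => Z k ω * updateFactor (s k ω) (u k ω) (D k ω) :=
        funext (hZs k hk)
      rw [this]
      exact (ih (Nat.le_of_succ_le hk)).mul (measurable_updateFactor h1 h2 (hD k hk))
  have hint : ∀ k ≤ K, ∫ ω, Z k ω ∂Pr ≤ 1 := fun k hk => by
    induction k with
    | zero => simp [Z, hq0, hp0]
    | succ k ih =>
      have : Z (k + 1) = fun ω => Z k ω * updateFactor (s k ω) (u k ω) (D k ω) :=
        funext (hZs k hk)
      rw [this]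
      exact (integral_mul_updateFactor_le (h𝓕 k hk) (hZm k hk) (hZ0 k)
        (hZB k (Nat.le_of_succ_le hk)) (hs k hk)
        (hu k hk) (hu0 k hk) (hD k hk) (hD1 k hk) (hD0 k hk)).trans (ih (Nat.le_of_succ_le hk))
  have hZi : Integrable (Z K) Pr := Integrable.of_bound (hZmΩ K le_rfl).aestronglyMeasurable
    (Real.exp (1 / 2) ^ K) (Filter.Eventually.of_forall fun ω => by
      rw [Real.norm_eq_abs, abs_of_nonneg (hZ0 K ω)]; exact hZB K le_rfl ω)
  have hmarkov := mul_meas_ge_le_integral_of_nonneg (Filter.Eventually.of_forall (hZ0 K)) hZi (1 / δ)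
  have hsub : {ω | ¬ q K ω ≤ Real.log (p K ω) + 2 * Real.log (1 / δ)} ⊆ {ω | 1 / δ ≤ Z K ω} := by
    intro ω hω
    simp only [Set.mem_ofPred_eq, not_le, Z] at hω ⊢
    have hp' : 0 < p K ω := by linarith [hp1 K le_rfl ω]
    rw [le_div_iff₀ (Real.sqrt_pos.2 hp')]
    have h1 : (1 / δ) * √(p K ω) = Real.exp (Real.log (1 / δ) + Real.log (p K ω) / 2) := by
      rw [Real.exp_add, Real.exp_log (by positivity), ← Real.log_sqrt hp'.le,
        Real.exp_log (Real.sqrt_pos.2 hp')]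
    rw [h1]
    exact Real.exp_le_exp.2 (by linarith)
  have hreal : Pr.real {ω | 1 / δ ≤ Z K ω} ≤ δ := by
    have := hmarkov.trans (hint K le_rfl)
    rw [one_div, inv_mul_le_iff₀ hδ] at this
    simpa [one_div] using this
  calc _ ≤ Pr {ω | 1 / δ ≤ Z K ω} := measure_mono hsub
    _ = ENNReal.ofReal (Pr.real {ω | 1 / δ ≤ Z K ω}) := by
        rw [ofReal_measureReal]
    _ ≤ _ := ENNReal.ofReal_le_ofReal hreal

/-- Self-normalized concentration for vector-valued martingales `∑ D_t v_t`. -/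
theorem measure_ridge_noise_le {d : ℕ} {𝓕 : ℕ → MeasurableSpace Ω} {K : ℕ}
    (h𝓕 : ∀ k < K, 𝓕 k ≤ mΩ) {v : Ω → ℕ → Fin d → ℝ} {D : ℕ → Ω → ℝ}
    (hu : ∀ k < K, Measurable[𝓕 k] fun ω => v ω k ⬝ᵥ ((ridgeGram (v ω) k)⁻¹ *ᵥ v ω k))
    (hs : ∀ k < K, Measurable[𝓕 k] fun ω =>
      v ω k ⬝ᵥ ((ridgeGram (v ω) k)⁻¹ *ᵥ ∑ t ∈ Finset.range k, D t ω • v ω t))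
    (hq : ∀ k < K, Measurable[𝓕 k] fun ω => (∑ t ∈ Finset.range k, D t ω • v ω t) ⬝ᵥ
      ((ridgeGram (v ω) k)⁻¹ *ᵥ ∑ t ∈ Finset.range k, D t ω • v ω t))
    (hp : ∀ k < K, Measurable[𝓕 k] fun ω => (ridgeGram (v ω) k).det)
    (hD : ∀ k < K, Measurable (D k))
    (hD1 : ∀ k < K, ∀ ω, |D k ω| ≤ 1) (hD0 : ∀ k < K, Pr[D k | 𝓕 k] =ᵐ[Pr] 0)
    {δ : ℝ} (hδ : 0 < δ) :
    Pr {ω | ¬ (∑ t ∈ Finset.range K, D t ω • v ω t) ⬝ᵥ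
        ((ridgeGram (v ω) K)⁻¹ *ᵥ ∑ t ∈ Finset.range K, D t ω • v ω t) ≤
      Real.log (ridgeGram (v ω) K).det + 2 * Real.log (1 / δ)} ≤ ENNReal.ofReal δ := by
  refine measure_self_normalized_le
    (q := fun k ω => (∑ t ∈ Finset.range k, D t ω • v ω t) ⬝ᵥ
        ((ridgeGram (v ω) k)⁻¹ *ᵥ ∑ t ∈ Finset.range k, D t ω • v ω t))
    (p := fun k ω => (ridgeGram (v ω) k).det) h𝓕 hs hu hq hp ?_ hD hD1 hD0 ?_ ?_ ?_ ?_ hδ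
  · exact fun k _ ω => (posDef_ridgeGram _ _).inv_dotProduct_self_nonneg _
  · simp
  · simp [ridgeGram_zero]
  · intro k _ ω
    rw [Finset.sum_range_succ, ridgeGram_succ,
      (posDef_ridgeGram (v ω) k).inv_add_vecMulVec_dotProduct]
  · intro k _ ω
    rw [ridgeGram_succ, (posDef_ridgeGram (v ω) k).det_add_vecMulVec]

/-- A deviation inequality for sums of bounded martingale differences. -/
theorem measure_sum_martingale_difference_le {𝓕 : ℕ → MeasurableSpace Ω} {K : ℕ}
    (h𝓕 : ∀ k < K, 𝓕 k ≤ mΩ) {D : ℕ → Ω → ℝ}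
    (hDm : ∀ k < K, ∀ t < k, Measurable[𝓕 k] (D t)) (hD : ∀ k < K, Measurable (D k))
    (hD1 : ∀ k < K, ∀ ω, |D k ω| ≤ 1) (hD0 : ∀ k < K, Pr[D k | 𝓕 k] =ᵐ[Pr] 0)
    {δ : ℝ} (hδ : 0 < δ) :
    Pr {ω | ¬ (∑ t ∈ Finset.range K, D t ω) ^ 2 / (1 + K) ≤
      Real.log (1 + K) + 2 * Real.log (1 / δ)} ≤ ENNReal.ofReal δ := by
  have hS : ∀ k < K, Measurable[𝓕 k] fun ω => ∑ t ∈ Finset.range k, D t ω := fun k hk =>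
    Finset.measurable_fun_sum _ fun t ht => hDm k hk t (Finset.mem_range.1 ht)
  -- The scalar case with all feature vectors equal to `1`: the Gram matrix after `k` terms is `1 +
  -- k`.
  refine measure_self_normalized_le (D := D)
    (q := fun k ω => (∑ t ∈ Finset.range k, D t ω) ^ 2 / (1 + k))
    (p := fun k ω => 1 + k) (u := fun k ω => 1 / (1 + k))
    (s := fun k ω => (∑ t ∈ Finset.range k, D t ω) / (1 + k)) h𝓕 ?_ ?_ ?_ ?_ ?_ hD hD1 hD0
    ?_ ?_ ?_ ?_ hδ
  · exact fun k hk => (hS k hk).div_const _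
  · exact fun k hk => measurable_const
  · exact fun k hk => ((hS k hk).pow_const 2).div_const _
  · exact fun k hk => measurable_const
  · intro k _ ω; positivity
  · simp
  · simp
  · intro k _ ω
    rw [Finset.sum_range_succ]
    push_cast
    field_simp
    ring
  · intro k _ ω
    push_cast
    field_simp
    ring

end Concentration

/-! ### Exponential weights on a finite action set -/

section ExponentialWeights

variable {A : Type*} [Fintype A]

theorem abs_sum_policy_mul_le {p : A → ℝ} (hp : p ∈ stdSimplex ℝ A) {f : A → ℝ} {B : ℝ}
    (hB : ∀ a, |f a| ≤ B) : |∑ a, p a * f a| ≤ B := by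
  calc _ ≤ ∑ a, |p a * f a| := Finset.abs_sum_le_sum_abs _ _
    _ ≤ ∑ a, p a * B := Finset.sum_le_sum fun a _ => by
        rw [abs_mul, abs_of_nonneg (hp.1 a)]
        exact mul_le_mul_of_nonneg_left (hB a) (hp.1 a)
    _ = B := by rw [← Finset.sum_mul, hp.2, one_mul]

/-- Hoeffding's lemma for a distribution on a finite set. -/
theorem log_sum_mul_exp_le {p q : A → ℝ} (hp : p ∈ stdSimplex ℝ A) {α B : ℝ} (hB : 0 < B)
    (hq : ∀ a, q a ∈ Set.Icc 0 B) :
    Real.log (∑ a, p a * Real.exp (α * q a)) ≤ α * ∑ a, q a * p a + (α * B) ^ 2 / 2 := by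
  have hp1 : ∑ a, p a = 1 := hp.2
  have hp0 : ∀ a, 0 ≤ p a := hp.1
  set c := ∑ a, q a * p a with hc
  have hc0 : 0 ≤ c := Finset.sum_nonneg fun a _ => mul_nonneg (hq a).1 (hp0 a)
  have hcB : c ≤ B := by
    calc c ≤ ∑ a, B * p a :=
          Finset.sum_le_sum fun a _ => mul_le_mul_of_nonneg_right (hq a).2 (hp0 a)
      _ = B := by rw [← Finset.mul_sum, hp1, mul_one]
  have hconv : ConvexOn ℝ Set.univ fun x : ℝ => Real.exp (α * B * x) := by
    refine ⟨convex_univ, fun x _ y _ a b ha hb hab => ?_⟩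
    have := convexOn_exp.2 (Set.mem_univ (α * B * x)) (Set.mem_univ (α * B * y)) ha hb hab
    simp only [smul_eq_mul] at this ⊢
    rwa [show α * B * (a * x + b * y) = a * (α * B * x) + b * (α * B * y) by ring]
  -- The points `(q a - c) / B` lie in `[-1, 1]` and have mean zero under `p`, so the `sinh` term of
  -- the chord disappears on averaging.
  have hterm : ∀ a, Real.exp (α * q a) ≤ Real.exp (α * c) * (Real.cosh (α * B) +
      Real.sinh (α * B) * ((q a - c) / B)) := fun a => by
    have hx : |(q a - c) / B| ≤ 1 := by
      rw [abs_div, abs_of_pos hB, div_le_one hB, abs_le]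
      constructor <;> linarith [(hq a).1, (hq a).2]
    have h := hconv.le_chord hx
    rw [show α * q a = α * c + α * B * ((q a - c) / B) by field_simp; ring, Real.exp_add,
      Real.cosh_eq, Real.sinh_eq]
    simp only [mul_one, mul_neg] at h
    gcongr
  have hsum : ∑ a, p a * Real.exp (α * q a) ≤ Real.exp (α * c) * Real.cosh (α * B) := by
    calc _ ≤ ∑ a, p a * (Real.exp (α * c) * (Real.cosh (α * B) +
          Real.sinh (α * B) * ((q a - c) / B))) :=
          Finset.sum_le_sum fun a _ => mul_le_mul_of_nonneg_left (hterm a) (hp0 a)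
      _ = Real.exp (α * c) * (Real.cosh (α * B) * ∑ a, p a + Real.sinh (α * B) / B *
            (∑ a, q a * p a - c * ∑ a, p a)) := by
          simp only [Finset.mul_sum, ← Finset.sum_sub_distrib, ← Finset.sum_add_distrib]
          refine Finset.sum_congr rfl fun a _ => ?_
          ring
      _ = _ := by rw [hp1, ← hc]; ring
  have hpos : 0 < ∑ a, p a * Real.exp (α * q a) := by
    obtain ⟨a, ha⟩ : ∃ a, p a ≠ 0 := by
      by_contra! h
      simp [h] at hp1
    exact Finset.sum_pos' (fun b _ => mul_nonneg (hp0 b) (Real.exp_pos _).le)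
      ⟨a, Finset.mem_univ a, mul_pos (lt_of_le_of_ne (hp0 a) ha.symm) (Real.exp_pos _)⟩
  calc _ ≤ Real.log (Real.exp (α * c) * Real.exp ((α * B) ^ 2 / 2)) :=
        Real.log_le_log hpos (hsum.trans (by gcongr; exact Real.cosh_le_exp_half_sq _))
    _ = _ := by rw [← Real.exp_add, Real.log_exp]

variable [Nonempty A]

theorem exp_weights_pos_and_sum {p q : ℕ → A → ℝ} {α : ℝ}
    (hp0 : ∀ a, p 0 a = 1 / (Fintype.card A : ℝ))
    (hps : ∀ k a, p (k + 1) a =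
      p k a * Real.exp (α * q k a) / ∑ b, p k b * Real.exp (α * q k b)) (k : ℕ) :
    (∀ a, 0 < p k a) ∧ ∑ a, p k a = 1 := by
  have hcard : (0 : ℝ) < Fintype.card A := by exact_mod_cast Fintype.card_pos
  induction k with
  | zero => refine ⟨fun a => by rw [hp0]; positivity, by simp [hp0, hcard.ne']⟩
  | succ k ih =>
    have hpos : 0 < ∑ b, p k b * Real.exp (α * q k b) :=
      Finset.sum_pos (fun b _ => mul_pos (ih.1 b) (Real.exp_pos _)) Finset.univ_nonempty
    refine ⟨fun a => ?_, ?_⟩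
    · rw [hps]; exact div_pos (mul_pos (ih.1 a) (Real.exp_pos _)) hpos
    · simp only [hps]; rw [← Finset.sum_div, div_self hpos.ne']

/-- The regret bound of the exponential weights algorithm. -/
theorem sum_exp_weights_le {p q : ℕ → A → ℝ} {α B : ℝ} (hα : 0 < α) (hB : 0 < B)
    (hp0 : ∀ a, p 0 a = 1 / (Fintype.card A : ℝ))
    (hps : ∀ k a, p (k + 1) a =
      p k a * Real.exp (α * q k a) / ∑ b, p k b * Real.exp (α * q k b)) {K : ℕ}
    (hq : ∀ k < K, ∀ a, q k a ∈ Set.Icc 0 B) {p' : A → ℝ} (hp' : p' ∈ stdSimplex ℝ A) :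
    ∑ k ∈ Finset.range K, ∑ a, q k a * (p' a - p k a) ≤
      Real.log (Fintype.card A) / α + α * B ^ 2 * K / 2 := by
  have hprop := exp_weights_pos_and_sum hp0 hps
  have hcard : (0 : ℝ) < Fintype.card A := by exact_mod_cast Fintype.card_pos
  -- In each round `log p_k(a)` grows by `α q_k(a)` minus the logarithm of the normalizing sum,
  -- which Hoeffding's lemma bounds; it starts at `-log |A|`. Then `p_K(a) ≤ 1` gives the regret
  -- against a single action, and `p'` is a mixture of actions.
  have hlog : ∀ a, ∀ k ≤ K, α * ∑ j ∈ Finset.range k, (q j a - ∑ b, q j b * p j b) ≤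
      Real.log (p k a) + Real.log (Fintype.card A) + k * ((α * B) ^ 2 / 2) := by
    intro a k hk
    induction k with
    | zero => simp [hp0]
    | succ k ih =>
      have hk' : k < K := hk
      have hpos : 0 < ∑ b, p k b * Real.exp (α * q k b) :=
        Finset.sum_pos (fun b _ => mul_pos ((hprop k).1 b) (Real.exp_pos _)) Finset.univ_nonempty
      have h1 := log_sum_mul_exp_le (α := α)
        (show p k ∈ stdSimplex ℝ A from ⟨fun b => ((hprop k).1 b).le, (hprop k).2⟩) hB (hq k hk')
      have h2 := ih hk'.le
      rw [Finset.sum_range_succ, hps, Real.log_div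
        (mul_pos ((hprop k).1 a) (Real.exp_pos _)).ne' hpos.ne',
        Real.log_mul ((hprop k).1 a).ne' (Real.exp_pos _).ne', Real.log_exp]
      push_cast
      linarith
  have hle : ∀ a, ∑ j ∈ Finset.range K, (q j a - ∑ b, q j b * p j b) ≤
      Real.log (Fintype.card A) / α + α * B ^ 2 * K / 2 := fun a => by
    have h1 := hlog a K le_rfl
    have h2 : Real.log (p K a) ≤ 0 := by
      refine Real.log_nonpos ((hprop K).1 a).le ?_
      rw [← (hprop K).2]
      exact Finset.single_le_sum (f := p K) (fun b _ => ((hprop K).1 b).le) (Finset.mem_univ a)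
    have h3 : α * ∑ j ∈ Finset.range K, (q j a - ∑ b, q j b * p j b) ≤
        α * (Real.log (Fintype.card A) / α + α * B ^ 2 * K / 2) := by
      rw [mul_add, mul_div_cancel₀ _ hα.ne']
      nlinarith
    exact le_of_mul_le_mul_left h3 hα
  calc _ = ∑ a, p' a * ∑ j ∈ Finset.range K, (q j a - ∑ b, q j b * p j b) := by
        have h : ∀ k, ∑ a, q k a * (p' a - p k a) = ∑ a, p' a * (q k a - ∑ b, q k b * p k b) :=
          fun k => by
            simp only [mul_sub, Finset.sum_sub_distrib, ← Finset.sum_mul, hp'.2, one_mul]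
            congr 1
            exact Finset.sum_congr rfl fun a _ => mul_comm _ _
        rw [Finset.sum_congr rfl fun k _ => h k, Finset.sum_comm]
        exact Finset.sum_congr rfl fun a _ => (Finset.mul_sum _ _ _).symm
    _ ≤ ∑ a, p' a * (Real.log (Fintype.card A) / α + α * B ^ 2 * K / 2) :=
        Finset.sum_le_sum fun a _ => mul_le_mul_of_nonneg_left (hle a) (hp'.1 a)
    _ = _ := by rw [← Finset.sum_mul, hp'.2, one_mul]

end ExponentialWeights

/-! ### Trajectory laws and the performance difference lemma -/

section Trajectory

theorem integrable_of_measurable_of_bound {Ω : Type*} {mΩ : MeasurableSpace Ω} {μ : Measure Ω}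
    [IsFiniteMeasure μ] {f : Ω → ℝ} (hf : Measurable f) {B : ℝ} (hB : ∀ ω, |f ω| ≤ B) :
    Integrable f μ :=
  Integrable.of_bound hf.aestronglyMeasurable B (Filter.Eventually.of_forall hB)

theorem abs_integral_le_of_abs_le {Ω : Type*} {mΩ : MeasurableSpace Ω} {μ : Measure Ω}
    [IsProbabilityMeasure μ] {f : Ω → ℝ} {B : ℝ} (hB : ∀ ω, |f ω| ≤ B) : |∫ ω, f ω ∂μ| ≤ B := by
  simpa using norm_integral_le_of_norm_le_const (μ := μ) (f := f)
    (Filter.Eventually.of_forall hB)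

theorem integral_bind_kernel {α β : Type*} {mα : MeasurableSpace α} {mβ : MeasurableSpace β}
    {μ : Measure α} [SFinite μ] {κ : Kernel α β} [IsSFiniteKernel κ] {f : β → ℝ}
    (hf : Integrable f (μ.bind κ)) : ∫ y, f y ∂(μ.bind κ) = ∫ x, ∫ y, f y ∂(κ x) ∂μ := by
  have h : (κ ∘ₖ Kernel.const Unit μ) () = μ.bind κ := by rw [Kernel.comp_apply, Kernel.const_apply]
  rw [← h] at hf ⊢
  rw [Kernel.integral_comp hf, Kernel.const_apply]

variable {S A : Type*} [mS : MeasurableSpace S] [Fintype A] [MeasurableSpace A]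

theorem bind_actionLaw [MeasurableSingletonClass A] {β : Type*} [MeasurableSpace β] (p : A → ℝ)
    (f : A → Measure β) : (actionLaw p).bind f = ∑ a, ENNReal.ofReal (p a) • f a := by
  ext s hs
  rw [Measure.bind_apply hs (Measurable.of_discrete (f := f)).aemeasurable, actionLaw,
    lintegral_finsetSum_measure]
  simp [lintegral_smul_measure]

theorem measurable_snoc_prod {n : ℕ} (a : A) :
    Measurable fun p : ((Fin n → S × A) × S) × S =>
      ((Fin.snoc p.1.1 (p.1.2, a) : Fin (n + 1) → S × A), p.2) := by
  refine Measurable.prodMk ?_ measurable_snd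
  refine measurable_pi_lambda _ fun i => ?_
  induction i using Fin.lastCases with
  | last => simp only [Fin.snoc_last]; fun_prop
  | cast i => simp only [Fin.snoc_castSucc]; fun_prop

/-- One step of the trajectory as a kernel. -/
noncomputable def trajKernel (P : Kernel (S × A) S) [IsMarkovKernel P] (p : S → A → ℝ)
    (hp : ∀ a, Measurable fun x => p x a) (n : ℕ) :
    Kernel ((Fin n → S × A) × S) ((Fin (n + 1) → S × A) × S) where
  toFun τ := ∑ a, ENNReal.ofReal (p τ.2 a) •
    (P (τ.2, a)).map fun x' => (Fin.snoc τ.1 (τ.2, a), x')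
  measurable' := by
    refine Measure.measurable_of_measurable_coe _ fun s hs => ?_
    simp only [Measure.coe_finsetSum, Finset.sum_apply, Measure.smul_apply, smul_eq_mul]
    refine Finset.measurable_fun_sum _ fun a _ => Measurable.mul ?_ ?_
    · exact ((hp a).comp measurable_snd).ennreal_ofReal
    · have h := measurable_snoc_prod (S := S) (n := n) a
      have h1 : ∀ τ : (Fin n → S × A) × S, (P (τ.2, a)).map
          (fun x' => ((Fin.snoc τ.1 (τ.2, a) : Fin (n + 1) → S × A), x')) s =
          (P.comap (fun τ : (Fin n → S × A) × S => (τ.2, a)) (by fun_prop)) τ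
            (Prod.mk τ ⁻¹' ((fun p : ((Fin n → S × A) × S) × S =>
              ((Fin.snoc p.1.1 (p.1.2, a) : Fin (n + 1) → S × A), p.2)) ⁻¹' s)) := fun τ => by
        rw [Measure.map_apply measurable_prodMk_left hs]; rfl
      simp only [h1]
      exact Kernel.measurable_kernel_prodMk_left (h hs)

variable [MeasurableSingletonClass A] {P : ℕ → Kernel (S × A) S} [∀ h, IsMarkovKernel (P h)]
  {π : ℕ → S → A → ℝ} {x₁ : S} {H : ℕ}

/-- A finite sum over the actions replaces the inner `bind`, so that one step is a measurable kernel
and integrals against the outer `bind` can be iterated. -/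
theorem trajLaw_succ {n : ℕ} (hπ : ∀ a, Measurable fun x => π n x a) :
    trajLaw P π x₁ (n + 1) = (trajLaw P π x₁ n).bind (trajKernel (P n) (π n) hπ n) := by
  rw [trajLaw]
  congr 1
  funext τ
  rw [bind_actionLaw]
  rfl

theorem isMarkovKernel_trajKernel {p : S → A → ℝ} (hp : ∀ a, Measurable fun x => p x a)
    (hp1 : ∀ x, p x ∈ stdSimplex ℝ A) (h n : ℕ) : IsMarkovKernel (trajKernel (P h) p hp n) := by
  refine ⟨fun τ => ⟨?_⟩⟩
  change (∑ a, ENNReal.ofReal (p τ.2 a) •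
    (P h (τ.2, a)).map fun x' => ((Fin.snoc τ.1 (τ.2, a) : Fin (n + 1) → S × A), x')) _ = 1
  have h1 : ∀ a, ((P h (τ.2, a)).map
      fun x' => ((Fin.snoc τ.1 (τ.2, a) : Fin (n + 1) → S × A), x')) Set.univ = 1 := fun a => by
    rw [Measure.map_apply measurable_prodMk_left MeasurableSet.univ]
    simp
  simp only [Measure.coe_finsetSum, Finset.sum_apply, Measure.smul_apply, smul_eq_mul]
  rw [Finset.sum_congr rfl fun a _ => by rw [h1 a, mul_one]]
  rw [← ENNReal.ofReal_sum_of_nonneg fun a _ => (hp1 τ.2).1 a, (hp1 τ.2).2, ENNReal.ofReal_one]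

theorem isProbabilityMeasure_trajLaw (hπ : π ∈ policies S A H) {n : ℕ} (hn : n ≤ H) :
    IsProbabilityMeasure (trajLaw P π x₁ n) := by
  induction n with
  | zero => rw [trajLaw]; infer_instance
  | succ n ih =>
    have := ih (Nat.le_of_succ_le hn)
    have := isMarkovKernel_trajKernel (P := P) (hπ n hn).2 (hπ n hn).1 n n
    rw [trajLaw_succ (hπ n hn).2]
    infer_instance

theorem integral_trajLaw_succ (hπ : π ∈ policies S A H) {n : ℕ} (hn : n < H)
    {F : (Fin (n + 1) → S × A) × S → ℝ} (hF : Measurable F) {B : ℝ} (hB : ∀ τ, |F τ| ≤ B) :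
    ∫ τ, F τ ∂(trajLaw P π x₁ (n + 1)) =
      ∫ τ, ∑ a, π n τ.2 a * ∫ x', F (Fin.snoc τ.1 (τ.2, a), x') ∂(P n (τ.2, a))
        ∂(trajLaw P π x₁ n) := by
  have := isProbabilityMeasure_trajLaw (P := P) (x₁ := x₁) hπ hn.le
  have := isProbabilityMeasure_trajLaw (P := P) (x₁ := x₁) hπ hn
  have := isMarkovKernel_trajKernel (P := P) (hπ n hn).2 (hπ n hn).1 n n
  have hi := integrable_of_measurable_of_bound (μ := trajLaw P π x₁ (n + 1)) hF hB
  rw [trajLaw_succ (hπ n hn).2] at hi ⊢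
  rw [integral_bind_kernel hi]
  refine integral_congr_ae (Filter.Eventually.of_forall fun τ => ?_)
  change ∫ y, F y ∂(∑ a, ENNReal.ofReal (π n τ.2 a) •
    (P n (τ.2, a)).map fun x' => ((Fin.snoc τ.1 (τ.2, a) : Fin (n + 1) → S × A), x')) = _
  have hm : ∀ a, Measurable fun x' : S => ((Fin.snoc τ.1 (τ.2, a) : Fin (n + 1) → S × A), x') :=
    fun a => measurable_prodMk_left
  rw [integral_finsetSum_measure fun a _ => by
    refine Integrable.smul_measure ?_ ENNReal.ofReal_ne_top
    have := Measure.isProbabilityMeasure_map (μ := P n (τ.2, a)) (hm a).aemeasurable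
    exact integrable_of_measurable_of_bound hF hB]
  refine Finset.sum_congr rfl fun a _ => ?_
  rw [integral_smul_measure, ENNReal.toReal_ofReal ((hπ n hn).1 τ.2 |>.1 a), smul_eq_mul,
    integral_map (hm a).aemeasurable hF.aestronglyMeasurable]

theorem trajLaw_congr {π' : ℕ → S → A → ℝ} {n : ℕ} (h : ∀ i < n, π i = π' i) :
    trajLaw P π x₁ n = trajLaw P π' x₁ n := by
  induction n with
  | zero => rfl
  | succ n ih => rw [trajLaw, trajLaw, ih fun i hi => h i (by omega), h n (by omega)]

theorem value_mem_Icc (hπ : π ∈ policies S A H) {r : ℕ → S → A → ℝ}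
    (hr : ∀ h < H, ∀ x a, r h x a ∈ Set.Icc (0 : ℝ) 1) :
    value H P x₁ π r ∈ Set.Icc (0 : ℝ) H := by
  have := isProbabilityMeasure_trajLaw (P := P) (x₁ := x₁) hπ le_rfl
  have h1 : ∀ τ : (Fin H → S × A) × S, 0 ≤ ∑ h : Fin H, r h (τ.1 h).1 (τ.1 h).2 := fun τ =>
    Finset.sum_nonneg fun h _ => (hr h h.2 _ _).1
  refine ⟨integral_nonneg h1, ?_⟩
  refine (le_abs_self _).trans (abs_integral_le_of_abs_le fun τ => ?_)
  rw [abs_of_nonneg (h1 τ)]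
  calc _ ≤ ∑ h : Fin H, (1 : ℝ) := Finset.sum_le_sum fun h _ => (hr h h.2 _ _).2
    _ = H := by simp

theorem measurable_integral_kernel {h : ℕ} {v : S → ℝ} (hv : Measurable v) (a : A) :
    Measurable fun x => ∫ x', v x' ∂(P h (x, a)) := by
  have h1 : StronglyMeasurable fun p : S × A => ∫ x', v x' ∂(P h p) :=
    StronglyMeasurable.integral_kernel_prod_right' (κ := P h)
      (f := fun p : (S × A) × S => v p.2) (hv.comp measurable_snd).stronglyMeasurable
  exact h1.measurable.comp (by fun_prop)

/-- The performance difference lemma: the value of a policy minus an arbitrary candidate `v`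
for the value function is the expected sum of the Bellman errors of `v`. -/
theorem value_sub_eq_sum (hπ : π ∈ policies S A H) {r : ℕ → S → A → ℝ}
    (hr : ∀ h < H, ∀ x a, r h x a ∈ Set.Icc (0 : ℝ) 1)
    (hrm : ∀ h < H, ∀ a, Measurable fun x => r h x a) {v : ℕ → S → ℝ}
    (hvm : ∀ h ≤ H, Measurable (v h)) {B : ℝ} (hvB : ∀ h ≤ H, ∀ x, |v h x| ≤ B)
    (hvH : ∀ x, v H x = 0) :
    value H P x₁ π r - v 0 x₁ = ∑ h ∈ Finset.range H,
      ∫ τ, (∑ a, π h τ.2 a * (r h τ.2 a + ∫ x', v (h + 1) x' ∂(P h (τ.2, a))) - v h τ.2)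
        ∂(trajLaw P π x₁ h) := by
  -- Induction on the number of steps played: the first `n` rewards are completed by `v n` at the
  -- state reached. One more step changes the expectation by the Bellman error at step `n`, and at
  -- `n = H` the candidate vanishes.
  have key : ∀ n ≤ H, ∫ τ, (∑ h : Fin n, r h (τ.1 h).1 (τ.1 h).2 + v n τ.2)
      ∂(trajLaw P π x₁ n) - v 0 x₁ = ∑ h ∈ Finset.range n,
      ∫ τ, (∑ a, π h τ.2 a * (r h τ.2 a + ∫ x', v (h + 1) x' ∂(P h (τ.2, a))) - v h τ.2)
        ∂(trajLaw P π x₁ h) := by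
    intro n hn
    have hrj : ∀ m ≤ H, ∀ h : Fin m, Measurable fun p : S × A => r h p.1 p.2 := fun m hm h =>
      measurable_from_prod_countable_left fun a => hrm h (h.2.trans_le hm) a
    have hFm : ∀ m ≤ H, Measurable fun τ : (Fin m → S × A) × S =>
        ∑ h : Fin m, r h (τ.1 h).1 (τ.1 h).2 := fun m hm =>
      Finset.measurable_fun_sum _ fun h _ =>
        (hrj m hm h).comp ((measurable_pi_apply h).comp measurable_fst)
    have hFB : ∀ m ≤ H, ∀ τ : (Fin m → S × A) × S,
        |∑ h : Fin m, r h (τ.1 h).1 (τ.1 h).2| ≤ m := fun m hm τ => by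
      calc _ ≤ ∑ h : Fin m, |r h (τ.1 h).1 (τ.1 h).2| := Finset.abs_sum_le_sum_abs _ _
        _ ≤ ∑ h : Fin m, (1 : ℝ) := Finset.sum_le_sum fun h _ => by
            have := hr h (h.2.trans_le hm) (τ.1 h).1 (τ.1 h).2
            rw [abs_of_nonneg this.1]; exact this.2
        _ = m := by simp
    have hGB : ∀ m ≤ H, ∀ τ : (Fin m → S × A) × S,
        |∑ h : Fin m, r h (τ.1 h).1 (τ.1 h).2 + v m τ.2| ≤ m + B := fun m hm τ =>
      (abs_add_le _ _).trans (add_le_add (hFB m hm τ) (hvB m hm τ.2))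
    induction n with
    | zero =>
      rw [trajLaw, integral_dirac'
        (fun τ : (Fin 0 → S × A) × S => ∑ h : Fin 0, r h (τ.1 h).1 (τ.1 h).2 + v 0 τ.2) _
        ((hFm 0 hn).add ((hvm 0 hn).comp measurable_snd)).stronglyMeasurable]
      simp
    | succ n ih =>
      have hn' : n < H := hn
      have hprob := isProbabilityMeasure_trajLaw (P := P) (x₁ := x₁) hπ hn'.le
      rw [Finset.sum_range_succ, ← ih hn'.le, integral_trajLaw_succ hπ hn'
        (F := fun τ => ∑ h : Fin (n + 1), r h (τ.1 h).1 (τ.1 h).2 + v (n + 1) τ.2)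
        ((hFm (n + 1) hn).add ((hvm (n + 1) hn).comp measurable_snd)) (hGB (n + 1) hn)]
      have e1 : ∀ τ : (Fin n → S × A) × S, ∑ a, π n τ.2 a * ∫ x',
          (∑ h : Fin (n + 1), r h ((Fin.snoc τ.1 (τ.2, a) : Fin (n + 1) → S × A) h).1
            ((Fin.snoc τ.1 (τ.2, a) : Fin (n + 1) → S × A) h).2 + v (n + 1) x') ∂(P n (τ.2, a)) =
          (∑ h : Fin n, r h (τ.1 h).1 (τ.1 h).2 + v n τ.2) +
          (∑ a, π n τ.2 a * (r n τ.2 a + ∫ x', v (n + 1) x' ∂(P n (τ.2, a))) - v n τ.2) := by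
        intro τ
        have e2 : ∀ a, ∫ x', (∑ h : Fin (n + 1),
            r h ((Fin.snoc τ.1 (τ.2, a) : Fin (n + 1) → S × A) h).1
            ((Fin.snoc τ.1 (τ.2, a) : Fin (n + 1) → S × A) h).2 + v (n + 1) x') ∂(P n (τ.2, a)) =
            ∑ h : Fin n, r h (τ.1 h).1 (τ.1 h).2 +
              (r n τ.2 a + ∫ x', v (n + 1) x' ∂(P n (τ.2, a))) := fun a => by
          rw [integral_add (integrable_const _)
            (integrable_of_measurable_of_bound (hvm (n + 1) hn) (hvB (n + 1) hn)),
            Fin.sum_univ_castSucc]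
          simp [add_assoc]
        simp only [e2, mul_add (π n τ.2 _), Finset.sum_add_distrib, ← Finset.sum_mul,
          ((hπ n hn').1 τ.2).2]
        ring
      simp only [e1]
      have hPB : ∀ x a, |r n x a + ∫ x', v (n + 1) x' ∂(P n (x, a))| ≤ 1 + B := fun x a => by
        have := hr n hn' x a
        refine (abs_add_le _ _).trans (add_le_add ?_ (abs_integral_le_of_abs_le (hvB (n + 1) hn)))
        rw [abs_of_nonneg this.1]; exact this.2
      have hPm : Measurable fun x => ∑ a, π n x a *
          (r n x a + ∫ x', v (n + 1) x' ∂(P n (x, a))) - v n x :=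
        (Finset.measurable_fun_sum _ fun a _ => ((hπ n hn').2 a).mul ((hrm n hn' a).add
          (measurable_integral_kernel (hvm (n + 1) hn) a))).sub (hvm n hn'.le)
      rw [integral_add]
      · ring
      · exact integrable_of_measurable_of_bound
          ((hFm n hn'.le).add ((hvm n hn'.le).comp measurable_snd)) (hGB n hn'.le)
      · refine integrable_of_measurable_of_bound (B := (1 + B) + B) (hPm.comp measurable_snd)
          fun τ => ?_
        exact (abs_sub _ _).trans (add_le_add
          (abs_sum_policy_mul_le ((hπ n hn').1 τ.2) (hPB τ.2)) (hvB n hn'.le τ.2))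
  have := key H le_rfl
  simp only [hvH, add_zero] at this
  exact this

end Trajectory

/-! ### Consequences of the linear MDP assumption -/

section LinearMDP

variable {S A : Type*} [mS : MeasurableSpace S] [Fintype A] [MeasurableSpace A] {d H : ℕ}
  {ν : Measure S} {P : ℕ → Kernel (S × A) S} {ψ : S → A → S → EuclideanSpace ℝ (Fin d)}

/-- In a linear MDP the transition operators are linear in the features. -/
theorem IsLinearMDP.exists_integral_eq (hM : IsLinearMDP H ν P ψ) {h : ℕ} (hh : h < H) :
    ∃ θ : Fin d → ℝ, θ ⬝ᵥ θ ≤ d ∧ ∀ x a (V : S → ℝ), Measurable V →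
      (∀ x', V x' ∈ Set.Icc (0 : ℝ) H) →
      ∫ x', V x' ∂(P h (x, a)) = (feature ν ψ V x a).ofLp ⬝ᵥ θ := by
  obtain ⟨θ, hθ, hP⟩ := hM.linear h hh
  refine ⟨θ.ofLp, ?_, fun x a V hV hV' => ?_⟩
  · have h1 : θ.ofLp ⬝ᵥ θ.ofLp = ‖θ‖ ^ 2 := by
      rw [← real_inner_self_eq_norm_sq, EuclideanSpace.inner_eq_star_dotProduct, star_trivial]
    rw [h1]
    calc ‖θ‖ ^ 2 ≤ √d ^ 2 := by gcongr
      _ = (d : ℝ) := Real.sq_sqrt (Nat.cast_nonneg d)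
  · obtain ⟨hpos, hP⟩ := hP x a
    have hψ : Measurable (ψ x a) :=
      hM.measurable.comp (measurable_const.prodMk (measurable_const.prodMk measurable_id))
    have hm : Measurable fun x' => inner ℝ (ψ x a x') θ := hψ.inner_const
    have h1 : ∫ x', V x' ∂(P h (x, a)) = ∫ x', inner ℝ (ψ x a x') θ * V x' ∂ν := by
      rw [hP]
      have := integral_withDensity_eq_integral_smul (μ := ν) hm.real_toNNReal V
      refine Eq.trans ?_ (this.trans (integral_congr_ae (Filter.Eventually.of_forall fun x' => ?_)))
      · rfl
      · simp only [NNReal.smul_def, Real.coe_toNNReal _ (hpos x'), smul_eq_mul]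
    have hint : Integrable (fun x' => V x' • ψ x a x') ν :=
      (hM.integrable x a).bdd_smul (H : ℝ) hV.aestronglyMeasurable
        (Filter.Eventually.of_forall fun x' => by
          rw [Real.norm_eq_abs, abs_of_nonneg (hV' x').1]; exact (hV' x').2)
    have h2 : inner ℝ θ (feature ν ψ V x a) = ∫ x', inner ℝ θ (V x' • ψ x a x') ∂ν :=
      (integral_inner hint θ).symm
    rw [h1]
    rw [EuclideanSpace.inner_eq_star_dotProduct, star_trivial] at h2
    rw [h2]
    refine integral_congr_ae (Filter.Eventually.of_forall fun x' => ?_)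
    simp only [real_inner_smul_right, real_inner_comm θ, mul_comm]

theorem IsLinearMDP.feature_dotProduct_self_le (hM : IsLinearMDP H ν P ψ) (x : S) (a : A)
    {V : S → ℝ} (hV : Measurable V) (hV' : ∀ x', V x' ∈ Set.Icc (0 : ℝ) H) :
    (feature ν ψ V x a).ofLp ⬝ᵥ (feature ν ψ V x a).ofLp ≤ d * H ^ 2 := by
  have h := hM.bounded x a V hV hV'
  have h1 : (feature ν ψ V x a).ofLp ⬝ᵥ (feature ν ψ V x a).ofLp = ‖feature ν ψ V x a‖ ^ 2 := by
    rw [← real_inner_self_eq_norm_sq, EuclideanSpace.inner_eq_star_dotProduct, star_trivial]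
  rw [h1]
  calc ‖feature ν ψ V x a‖ ^ 2 ≤ (√d * H) ^ 2 := by gcongr; exact h
    _ = (d : ℝ) * H ^ 2 := by rw [mul_pow, Real.sq_sqrt (Nat.cast_nonneg d)]

/-- With `d = 0` all features vanish, and the constant `1`, admissible because `H ≥ 1`, would have
integral zero under a probability measure. -/
theorem IsLinearMDP.dim_pos [∀ h, IsMarkovKernel (P h)] [Nonempty S] [Nonempty A]
    (hM : IsLinearMDP H ν P ψ) (hH : 0 < H) : 0 < d := by
  obtain ⟨θ, _, hP⟩ := hM.exists_integral_eq hH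
  obtain ⟨x⟩ := ‹Nonempty S›
  obtain ⟨a⟩ := ‹Nonempty A›
  rcases Nat.eq_zero_or_pos d with rfl | hd
  · have h1 := hP x a (fun _ => 1) measurable_const fun _ =>
      ⟨zero_le_one, by exact_mod_cast hH⟩
    simp [dotProduct] at h1
  · exact hd

end LinearMDP

/-! ### OPPO along a fixed transcript; optimism -/

section Transcript

variable {S A : Type*} [mS : MeasurableSpace S] [Fintype A] {d : ℕ}

/-- The estimated value function at step `h` of episode `k` of OPPO with `λ = 1`. -/
noncomputable def oppoV (H : ℕ) (ν : Measure S) (ψ : S → A → S → EuclideanSpace ℝ (Fin d))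
    (α β : ℝ) (x : ℕ → ℕ → S) (a : ℕ → ℕ → A) (r : ℕ → ℕ → S → A → ℝ) (k h : ℕ) : S → ℝ :=
  estV H ν ψ 1 β (oppoState H ν ψ α 1 β x a r k).past (r k) (oppoPolicy H ν ψ α 1 β x a r k) h

/-- The estimated `Q`-function at step `h` of episode `k` of OPPO with `λ = 1`. -/
noncomputable def oppoQ (H : ℕ) (ν : Measure S) (ψ : S → A → S → EuclideanSpace ℝ (Fin d))
    (α β : ℝ) (x : ℕ → ℕ → S) (a : ℕ → ℕ → A) (r : ℕ → ℕ → S → A → ℝ) (k h : ℕ) : S → A → ℝ :=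
  estQ H ν ψ 1 β (oppoState H ν ψ α 1 β x a r k).past (r k) h (oppoV H ν ψ α β x a r k (h + 1))

/-- The feature vector of a state-action pair at step `h` of episode `k` of OPPO with `λ = 1`. -/
noncomputable def oppoFeature (H : ℕ) (ν : Measure S) (ψ : S → A → S → EuclideanSpace ℝ (Fin d))
    (α β : ℝ) (x : ℕ → ℕ → S) (a : ℕ → ℕ → A) (r : ℕ → ℕ → S → A → ℝ) (k h : ℕ) (y : S) (b : A) :
    Fin d → ℝ :=
  (feature ν ψ (oppoV H ν ψ α β x a r k (h + 1)) y b).ofLp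

/-- The feature vector observed at step `h` of episode `k` of OPPO with `λ = 1`. -/
noncomputable def oppoObs (H : ℕ) (ν : Measure S) (ψ : S → A → S → EuclideanSpace ℝ (Fin d))
    (α β : ℝ) (x : ℕ → ℕ → S) (a : ℕ → ℕ → A) (r : ℕ → ℕ → S → A → ℝ) (h k : ℕ) : Fin d → ℝ :=
  oppoFeature H ν ψ α β x a r k h (x k h) (a k h)

variable (H : ℕ) (ν : Measure S) (ψ : S → A → S → EuclideanSpace ℝ (Fin d))
    (α β : ℝ) (x : ℕ → ℕ → S) (a : ℕ → ℕ → A) (r : ℕ → ℕ → S → A → ℝ)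

theorem oppoV_last (k : ℕ) (y : S) : oppoV H ν ψ α β x a r k H y = 0 := by
  simp [oppoV, estV, estVToGo]

theorem oppoV_eq (k : ℕ) {h : ℕ} (hh : h < H) (y : S) : oppoV H ν ψ α β x a r k h y =
    ∑ b, oppoQ H ν ψ α β x a r k h y b * oppoPolicy H ν ψ α 1 β x a r k h y b := by
  obtain ⟨n, rfl⟩ : ∃ n, H = h + (n + 1) := ⟨H - h - 1, by omega⟩
  have e1 : h + (n + 1) - h = n + 1 := by omega
  have e2 : h + (n + 1) - (n + 1) = h := by omega
  have e3 : h + (n + 1) - (h + 1) = n := by omega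
  simp only [oppoQ, oppoV, estV, e1, e3, estVToGo, e2]

theorem oppoPolicy_zero (h : ℕ) (y : S) [Nonempty A] (b : A) :
    oppoPolicy H ν ψ α 1 β x a r 0 h y b = 1 / (Fintype.card A : ℝ) := by
  have hcard : (Fintype.card A : ℝ) ≠ 0 := by exact_mod_cast Fintype.card_ne_zero
  simp [oppoPolicy, oppoState, improve, hcard]

theorem oppoPolicy_succ (k h : ℕ) (y : S) (b : A) :
    oppoPolicy H ν ψ α 1 β x a r (k + 1) h y b = oppoPolicy H ν ψ α 1 β x a r k h y b *
      Real.exp (α * oppoQ H ν ψ α β x a r k h y b) / ∑ c, oppoPolicy H ν ψ α 1 β x a r k h y c *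
      Real.exp (α * oppoQ H ν ψ α β x a r k h y c) := rfl

theorem oppoPolicy_mem_stdSimplex [Nonempty A] (k h : ℕ) (y : S) :
    oppoPolicy H ν ψ α 1 β x a r k h y ∈ stdSimplex ℝ A := by
  have := exp_weights_pos_and_sum (p := fun k => oppoPolicy H ν ψ α 1 β x a r k h y)
    (q := fun k => oppoQ H ν ψ α β x a r k h y) (oppoPolicy_zero H ν ψ α β x a r h y)
    (fun k b => oppoPolicy_succ H ν ψ α β x a r k h y b) k
  exact ⟨fun b => (this.1 b).le, this.2⟩

/-- Translates the recursive memory of OPPO into sequences indexed by episodes, to which the results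
on `ridgeGram` apply. -/
theorem gram_oppoState (k h : ℕ) : gram 1 (oppoState H ν ψ α 1 β x a r k).past h =
    ridgeGram (oppoObs H ν ψ α β x a r h) k := by
  induction k with
  | zero => simp [_root_.gram, oppoState, ridgeGram_zero]
  | succ k ih =>
    rw [ridgeGram_succ, ← ih]
    simp only [_root_.gram, oppoState, List.map_append, List.sum_append, List.map_cons, List.map_nil,
      List.sum_cons, List.sum_nil, add_zero]
    rw [add_right_comm]
    rfl

theorem weight_oppoState (k h : ℕ) : weight 1 (oppoState H ν ψ α 1 β x a r k).past h =
    (ridgeGram (oppoObs H ν ψ α β x a r h) k)⁻¹ *ᵥ ∑ t ∈ Finset.range k,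
      oppoV H ν ψ α β x a r t (h + 1) (x t (h + 1)) • oppoObs H ν ψ α β x a r h t := by
  rw [weight, gram_oppoState]
  congr 1
  induction k with
  | zero => simp [oppoState]
  | succ k ih =>
    rw [Finset.sum_range_succ, ← ih]
    simp only [oppoState, List.map_append, List.sum_append, List.map_cons, List.map_nil,
      List.sum_cons, List.sum_nil, add_zero]
    rfl

theorem oppoQ_eq (k h : ℕ) (y : S) (b : A) : oppoQ H ν ψ α β x a r k h y b =
    max (min (r k h y b + oppoFeature H ν ψ α β x a r k h y b ⬝ᵥ
      ((ridgeGram (oppoObs H ν ψ α β x a r h) k)⁻¹ *ᵥ ∑ t ∈ Finset.range k,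
        oppoV H ν ψ α β x a r t (h + 1) (x t (h + 1)) • oppoObs H ν ψ α β x a r h t)
      + β * √(oppoFeature H ν ψ α β x a r k h y b ⬝ᵥ
        ((ridgeGram (oppoObs H ν ψ α β x a r h) k)⁻¹ *ᵥ oppoFeature H ν ψ α β x a r k h y b)))
      ((H : ℝ) - h)) 0 := by
  rw [oppoQ, estQ, bonus, gram_oppoState, weight_oppoState]
  rfl

theorem oppoQ_mem (k : ℕ) {h : ℕ} (hh : h < H) (y : S) (b : A) :
    oppoQ H ν ψ α β x a r k h y b ∈ Set.Icc (0 : ℝ) (H - h) := by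
  have h1 : (h : ℝ) ≤ H := by exact_mod_cast hh.le
  rw [oppoQ_eq]
  exact ⟨le_max_right _ _, max_le (min_le_right _ _) (by linarith)⟩

theorem oppoV_mem [Nonempty A] (k : ℕ) {h : ℕ} (hh : h ≤ H) (y : S) :
    oppoV H ν ψ α β x a r k h y ∈ Set.Icc (0 : ℝ) (H - h) := by
  rcases hh.eq_or_lt with rfl | hh
  · simp [oppoV_last]
  · rw [oppoV_eq _ _ _ _ _ _ _ _ _ hh]
    have hp := oppoPolicy_mem_stdSimplex H ν ψ α β x a r k h y
    refine ⟨Finset.sum_nonneg fun b _ => mul_nonneg (oppoQ_mem H ν ψ α β x a r k hh y b).1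
      (hp.1 b), ?_⟩
    calc _ ≤ ∑ b, ((H : ℝ) - h) * oppoPolicy H ν ψ α 1 β x a r k h y b :=
          Finset.sum_le_sum fun b _ =>
            mul_le_mul_of_nonneg_right (oppoQ_mem H ν ψ α β x a r k hh y b).2 (hp.1 b)
      _ = _ := by rw [← Finset.mul_sum, hp.2, mul_one]

theorem oppoV_mem_Icc [Nonempty A] (k : ℕ) {h : ℕ} (hh : h ≤ H) (y : S) :
    oppoV H ν ψ α β x a r k h y ∈ Set.Icc (0 : ℝ) H := by
  have h1 := oppoV_mem H ν ψ α β x a r k hh y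
  exact ⟨h1.1, h1.2.trans (by linarith [(Nat.cast_nonneg h : (0 : ℝ) ≤ h)])⟩

variable {H ν ψ α β x a r} [MeasurableSpace A]

/-- On the event that the ridge regression is accurate, the estimated `Q`-function is optimistic,
and it is not larger than the truth by more than twice the bonus. -/
theorem oppoQ_bounds [Nonempty A] {P : ℕ → Kernel (S × A) S} [∀ h, IsMarkovKernel (P h)]
    {k h : ℕ} (hh : h < H)
    (hVm : ∀ t ≤ k, Measurable (oppoV H ν ψ α β x a r t (h + 1)))
    {θ : Fin d → ℝ} (hθd : θ ⬝ᵥ θ ≤ d) (hθ : ∀ y b (V : S → ℝ), Measurable V →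
      (∀ x', V x' ∈ Set.Icc (0 : ℝ) H) →
      ∫ x', V x' ∂(P h (y, b)) = (feature ν ψ V y b).ofLp ⬝ᵥ θ)
    (hr : ∀ y b, r k h y b ∈ Set.Icc (0 : ℝ) 1) {ε : ℕ → ℝ}
    (hε : ∀ t < k, oppoV H ν ψ α β x a r t (h + 1) (x t (h + 1)) =
      ∫ x', oppoV H ν ψ α β x a r t (h + 1) x' ∂(P h (x t h, a t h)) + H * ε t)
    (hβ : H * √((∑ t ∈ Finset.range k, ε t • oppoObs H ν ψ α β x a r h t) ⬝ᵥ
      ((ridgeGram (oppoObs H ν ψ α β x a r h) k)⁻¹ *ᵥ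
        ∑ t ∈ Finset.range k, ε t • oppoObs H ν ψ α β x a r h t)) + √d ≤ β) (y : S) (b : A) :
    r k h y b + ∫ x', oppoV H ν ψ α β x a r k (h + 1) x' ∂(P h (y, b)) ≤
        oppoQ H ν ψ α β x a r k h y b ∧
      oppoQ H ν ψ α β x a r k h y b ≤
        r k h y b + ∫ x', oppoV H ν ψ α β x a r k (h + 1) x' ∂(P h (y, b)) +
        2 * (β * √(oppoFeature H ν ψ α β x a r k h y b ⬝ᵥ
        ((ridgeGram (oppoObs H ν ψ α β x a r h) k)⁻¹ *ᵥ
          oppoFeature H ν ψ α β x a r k h y b))) := by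
  have hPV : ∀ t ≤ k, ∀ y b, ∫ x', oppoV H ν ψ α β x a r t (h + 1) x' ∂(P h (y, b)) =
      oppoFeature H ν ψ α β x a r t h y b ⬝ᵥ θ := fun t ht y b =>
    hθ y b _ (hVm t ht) (oppoV_mem_Icc H ν ψ α β x a r t hh)
  have herr := abs_ridge_sub_le (oppoObs H ν ψ α β x a r h) k θ
    (fun t => oppoV H ν ψ α β x a r t (h + 1) (x t (h + 1))) ε H (Nat.cast_nonneg H)
    (fun t ht => by rw [hε t ht, hPV t ht.le]; rfl) (oppoFeature H ν ψ α β x a r k h y b)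
  have hθ' : √(θ ⬝ᵥ θ) ≤ √d := Real.sqrt_le_sqrt hθd
  set g := √(oppoFeature H ν ψ α β x a r k h y b ⬝ᵥ
    ((ridgeGram (oppoObs H ν ψ α β x a r h) k)⁻¹ *ᵥ oppoFeature H ν ψ α β x a r k h y b)) with hg
  have hg0 : 0 ≤ g := Real.sqrt_nonneg _
  have herr' := abs_le.1 (herr.trans (mul_le_mul_of_nonneg_left
    ((add_le_add_right hθ' _).trans hβ) hg0))
  have hPV0 : ∫ x', oppoV H ν ψ α β x a r k (h + 1) x' ∂(P h (y, b)) ∈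
      Set.Icc (0 : ℝ) (H - (h + 1)) := by
    have h2 := fun x' => oppoV_mem H ν ψ α β x a r k (h := h + 1) hh x'
    push_cast at h2
    refine ⟨integral_nonneg fun x' => (h2 x').1, (le_abs_self _).trans
      (abs_integral_le_of_abs_le fun x' => ?_)⟩
    rw [abs_of_nonneg (h2 x').1]; exact (h2 x').2
  have hr' := hr y b
  rw [hPV k le_rfl] at hPV0 ⊢
  rw [oppoQ_eq, ← hg]
  obtain ⟨e1, e2⟩ := herr'
  constructor
  -- The truncation from above preserves optimism, since the reward is at most `1` and the integral
  -- at most `H - h - 1`.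
  · refine le_max_of_le_left (le_min ?_ ?_)
    · nlinarith
    · linarith [hr'.2, hPV0.2]
  -- The truncation at `0` preserves the upper bound, whose right-hand side is nonnegative.
  · refine max_le ((min_le_left _ _).trans ?_) ?_
    · nlinarith
    · have : 0 ≤ g * β := by linarith
      have := hr'.1; have := hPV0.1; nlinarith

end Transcript

/-! ### Measurability of ridge regression -/

section RidgeMeasurability

variable {Ω : Type*} {mΩ : MeasurableSpace Ω} {n : Type*} [Fintype n] [DecidableEq n]

theorem measurable_matrix_det {G : Ω → Matrix n n ℝ} (hG : ∀ i j, Measurable fun ω => G ω i j) :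
    Measurable fun ω => (G ω).det := by
  simp only [det_apply]
  exact Finset.measurable_fun_sum _ fun σ _ =>
    (Finset.measurable_fun_prod _ fun i _ => hG _ _).const_smul _

theorem measurable_matrix_inv {G : Ω → Matrix n n ℝ} (hG : ∀ i j, Measurable fun ω => G ω i j)
    (i j : n) : Measurable fun ω => (G ω)⁻¹ i j := by
  simp only [inv_def, Ring.inverse_eq_inv', Matrix.smul_apply, smul_eq_mul, adjugate_apply]
  refine (measurable_matrix_det hG).inv.mul (measurable_matrix_det fun k l => ?_)
  simp only [updateRow_apply]
  split_ifs
  · exact measurable_const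
  · exact hG k l

theorem measurable_dotProduct_inv_mulVec {G : Ω → Matrix n n ℝ}
    (hG : ∀ i j, Measurable fun ω => G ω i j) {y z : Ω → n → ℝ} (hy : Measurable y)
    (hz : Measurable z) : Measurable fun ω => y ω ⬝ᵥ ((G ω)⁻¹ *ᵥ z ω) := by
  simp only [dotProduct, mulVec]
  exact Finset.measurable_fun_sum _ fun i _ => ((measurable_pi_apply i).comp hy).mul
    (Finset.measurable_fun_sum _ fun j _ =>
      (measurable_matrix_inv hG i j).mul ((measurable_pi_apply j).comp hz))

theorem measurable_ridgeGram {v : Ω → ℕ → n → ℝ} {k : ℕ}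
    (hv : ∀ t < k, Measurable fun ω => v ω t) (i j : n) :
    Measurable fun ω => ridgeGram (v ω) k i j := by
  simp only [ridgeGram, Matrix.add_apply, Matrix.sum_apply, vecMulVec_apply]
  exact measurable_const.add (Finset.measurable_fun_sum _ fun t ht =>
    ((measurable_pi_apply i).comp (hv t (Finset.mem_range.1 ht))).mul
      ((measurable_pi_apply j).comp (hv t (Finset.mem_range.1 ht))))

theorem measurable_sum_smul {v : Ω → ℕ → n → ℝ} {c : ℕ → Ω → ℝ} {k : ℕ}
    (hv : ∀ t < k, Measurable fun ω => v ω t) (hc : ∀ t < k, Measurable (c t)) :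
    Measurable fun ω => ∑ t ∈ Finset.range k, c t ω • v ω t :=
  Finset.measurable_fun_sum _ fun t ht =>
    (hc t (Finset.mem_range.1 ht)).smul (hv t (Finset.mem_range.1 ht))

end RidgeMeasurability

/-! ### Random functions on the state space -/

section JointMeasurability

variable {Ω S A : Type*} [mS : MeasurableSpace S] [Fintype A] [MeasurableSpace A]
  [MeasurableSingletonClass A]

/-- A random function on `S` that is jointly measurable when `Ω` carries the `σ`-algebra `m`. -/
def JointlyMeasurable (m : MeasurableSpace Ω) {E : Type*} [MeasurableSpace E] (f : Ω → S → E) :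
    Prop :=
  Measurable[m.prod mS] fun p : Ω × S => f p.1 p.2

variable {m m' : MeasurableSpace Ω} {E : Type*} [MeasurableSpace E]

theorem JointlyMeasurable.mono {f : Ω → S → E} (hf : JointlyMeasurable m f) (h : m ≤ m') :
    JointlyMeasurable m' f :=
  Measurable.mono hf (sup_le_sup (MeasurableSpace.comap_mono h) le_rfl) le_rfl

theorem JointlyMeasurable.section {f : Ω → S → E} (hf : JointlyMeasurable m f) (ω : Ω) :
    Measurable (f ω) :=
  Measurable.comp (g := fun p : Ω × S => f p.1 p.2) hf measurable_prodMk_left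

theorem JointlyMeasurable.comp {f : Ω → S → E} (hf : JointlyMeasurable m f) {X : Ω → S}
    (hX : Measurable[m] X) : Measurable[m] fun ω => f ω (X ω) :=
  Measurable.comp hf (measurable_id.prodMk hX)

theorem JointlyMeasurable.comp_action {f : Ω → S → A → E}
    (hf : ∀ b, JointlyMeasurable m fun ω y => f ω y b) {X : Ω → S} (hX : Measurable[m] X)
    {Y : Ω → A} (hY : Measurable[m] Y) : Measurable[m] fun ω => f ω (X ω) (Y ω) :=
  (measurable_from_prod_countable_left (f := fun q : (Ω × S) × A => f q.1.1 q.1.2 q.2) hf).comp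
    ((measurable_id.prodMk hX).prodMk hY)

theorem JointlyMeasurable.integral_kernel {f : Ω → S → ℝ} (hf : JointlyMeasurable m f)
    (P : Kernel (S × A) S) [IsSFiniteKernel P] (b : A) :
    JointlyMeasurable m fun ω y => ∫ x', f ω x' ∂(P (y, b)) := by
  have h1 : StronglyMeasurable fun p : Ω × S =>
      ∫ x', f p.1 x' ∂(P.comap (fun p : Ω × S => (p.2, b)) (by fun_prop) p) :=
    StronglyMeasurable.integral_kernel_prod_right' (f := fun q : (Ω × S) × S => f q.1.1 q.2)
      (Measurable.stronglyMeasurable (Measurable.comp hf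
        ((measurable_fst.comp measurable_fst).prodMk measurable_snd)))
  exact h1.measurable

theorem JointlyMeasurable.feature {d : ℕ} {ν : Measure S} [SFinite ν]
    {ψ : S → A → S → EuclideanSpace ℝ (Fin d)}
    (hψ : Measurable fun p : S × A × S => ψ p.1 p.2.1 p.2.2) {f : Ω → S → ℝ}
    (hf : JointlyMeasurable m f) (b : A) :
    JointlyMeasurable m fun ω y => (feature ν ψ (f ω) y b).ofLp := by
  have h1 : StronglyMeasurable fun p : Ω × S => ∫ x', f p.1 x' • ψ p.2 b x' ∂ν := by
    refine StronglyMeasurable.integral_prod_right'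
      (f := fun q : (Ω × S) × S => f q.1.1 q.2 • ψ q.1.2 b q.2) (Measurable.stronglyMeasurable ?_)
    refine Measurable.smul (Measurable.comp hf
      ((measurable_fst.comp measurable_fst).prodMk measurable_snd)) ?_
    exact hψ.comp (f := fun q : (Ω × S) × S => (q.1.2, b, q.2))
      ((measurable_snd.comp measurable_fst).prodMk (measurable_const.prodMk measurable_snd))
  exact (PiLp.continuous_ofLp 2 _).measurable.comp h1.measurable

end JointMeasurability

/-! ### Value functions by backward recursion -/

section PolicyValue

variable {S A : Type*} [mS : MeasurableSpace S] [Fintype A] [MeasurableSpace A]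

/-- The value function of the policy `π` with `n` steps to go. -/
noncomputable def policyVToGo (H : ℕ) (P : ℕ → Kernel (S × A) S) (π r : ℕ → S → A → ℝ) :
    ℕ → S → ℝ
  | 0 => fun _ => 0
  | n + 1 => fun x => ∑ a, π (H - (n + 1)) x a * (r (H - (n + 1)) x a +
      ∫ x', policyVToGo H P π r n x' ∂(P (H - (n + 1)) (x, a)))

/-- The value function of the policy `π` at step `h`. -/
noncomputable def policyV (H : ℕ) (P : ℕ → Kernel (S × A) S) (π r : ℕ → S → A → ℝ) (h : ℕ) :
    S → ℝ :=
  policyVToGo H P π r (H - h)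

variable {H : ℕ} {P : ℕ → Kernel (S × A) S} {π r : ℕ → S → A → ℝ}

theorem policyV_last (x : S) : policyV H P π r H x = 0 := by simp [policyV, policyVToGo]

theorem policyV_eq {h : ℕ} (hh : h < H) (x : S) : policyV H P π r h x =
    ∑ a, π h x a * (r h x a + ∫ x', policyV H P π r (h + 1) x' ∂(P h (x, a))) := by
  obtain ⟨n, rfl⟩ : ∃ n, H = h + (n + 1) := ⟨H - h - 1, by omega⟩
  have e1 : h + (n + 1) - h = n + 1 := by omega
  have e2 : h + (n + 1) - (n + 1) = h := by omega
  have e3 : h + (n + 1) - (h + 1) = n := by omega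
  simp only [policyV, e1, e3, policyVToGo, e2]

theorem integral_mem_Icc_of_mem_Icc {μ : Measure S} [IsProbabilityMeasure μ] {f : S → ℝ} {B : ℝ}
    (hf : ∀ x, f x ∈ Set.Icc 0 B) : ∫ x, f x ∂μ ∈ Set.Icc 0 B :=
  ⟨integral_nonneg fun x => (hf x).1, (le_abs_self _).trans
    (abs_integral_le_of_abs_le fun x => by rw [abs_of_nonneg (hf x).1]; exact (hf x).2)⟩

theorem policyV_mem [∀ h, IsMarkovKernel (P h)] (hπ : ∀ h < H, ∀ x, π h x ∈ stdSimplex ℝ A)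
    (hr : ∀ h < H, ∀ x a, r h x a ∈ Set.Icc (0 : ℝ) 1) {h : ℕ} (hh : h ≤ H) (x : S) :
    policyV H P π r h x ∈ Set.Icc (0 : ℝ) (H - h) := by
  induction hh using Nat.decreasingInduction generalizing x with
  | self => simp [policyV_last]
  | of_succ h hh ih =>
    rw [policyV_eq hh]
    have h1 : ∀ a, r h x a + ∫ x', policyV H P π r (h + 1) x' ∂(P h (x, a)) ∈
        Set.Icc (0 : ℝ) (H - h) := fun a => by
      have h2 := integral_mem_Icc_of_mem_Icc (μ := P h (x, a)) ih
      have h3 := hr h hh x a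
      push_cast at h2
      exact ⟨add_nonneg h3.1 h2.1, by linarith [h3.2, h2.2]⟩
    refine ⟨Finset.sum_nonneg fun a _ => mul_nonneg ((hπ h hh x).1 a) (h1 a).1, ?_⟩
    calc _ ≤ ∑ a, π h x a * ((H : ℝ) - h) :=
          Finset.sum_le_sum fun a _ => mul_le_mul_of_nonneg_left (h1 a).2 ((hπ h hh x).1 a)
      _ = _ := by rw [← Finset.sum_mul, (hπ h hh x).2, one_mul]

theorem jointlyMeasurable_policyV [MeasurableSingletonClass A] [∀ h, IsMarkovKernel (P h)]
    {Ω : Type*} {m : MeasurableSpace Ω} {π r : Ω → ℕ → S → A → ℝ}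
    (hπ : ∀ h < H, ∀ a, JointlyMeasurable m fun ω x => π ω h x a)
    (hr : ∀ h < H, ∀ a, JointlyMeasurable m fun ω x => r ω h x a) {h : ℕ} (hh : h ≤ H) :
    JointlyMeasurable m fun ω => policyV H P (π ω) (r ω) h := by
  induction hh using Nat.decreasingInduction with
  | self =>
    unfold JointlyMeasurable
    simp only [policyV_last]
    exact measurable_const
  | of_succ h hh ih =>
    unfold JointlyMeasurable
    simp only [policyV_eq (P := P) hh]
    exact Finset.measurable_fun_sum _ fun a _ =>
      (hπ h hh a).mul ((hr h hh a).add (ih.integral_kernel (P h) a))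

/-- The performance difference lemma with the true value function as candidate: its Bellman errors
vanish. -/
theorem value_eq_policyV [MeasurableSingletonClass A] [∀ h, IsMarkovKernel (P h)] {x₁ : S}
    (hπ : π ∈ policies S A H) (hr : ∀ h < H, ∀ x a, r h x a ∈ Set.Icc (0 : ℝ) 1)
    (hrm : ∀ h < H, ∀ a, Measurable fun x => r h x a) :
    value H P x₁ π r = policyV H P π r 0 x₁ := by
  have hm : ∀ h ≤ H, Measurable (policyV H P π r h) := fun h hh =>
    -- Fixed policies and rewards are random ones over a one-point space.
    (jointlyMeasurable_policyV (m := ⊥) (π := fun _ : Unit => π) (r := fun _ : Unit => r)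
      (fun h hh a => ((hπ h hh).2 a).comp measurable_snd)
      (fun h hh a => (hrm h hh a).comp measurable_snd) hh).section ()
  have hb : ∀ h ≤ H, ∀ x, |policyV H P π r h x| ≤ H := fun h hh x => by
    have h1 := policyV_mem (P := P) (r := r) (fun h hh => (hπ h hh).1) hr hh x
    rw [abs_of_nonneg h1.1]
    linarith [h1.2, (Nat.cast_nonneg h : (0 : ℝ) ≤ h)]
  have h1 := value_sub_eq_sum (P := P) (v := policyV H P π r) (x₁ := x₁) hπ hr hrm hm hb policyV_last
  rw [Finset.sum_eq_zero fun h hh => ?_] at h1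
  · linarith
  · simp only [policyV_eq (Finset.mem_range.1 hh), sub_self, integral_zero]

end PolicyValue

/-! ### Predictability of the quantities computed by OPPO -/

section OPPOMeasurability

variable {Ω S A : Type*} {mΩ : MeasurableSpace Ω} [mS : MeasurableSpace S] [Fintype A] [Nonempty A]
  [MeasurableSpace A] [MeasurableSingletonClass A] {d H K : ℕ} {ν : Measure S} [SFinite ν]
  {ψ : S → A → S → EuclideanSpace ℝ (Fin d)} {α β : ℝ} {x : Ω → ℕ → ℕ → S} {a : Ω → ℕ → ℕ → A}
  {r : Ω → ℕ → ℕ → S → A → ℝ} {𝓖 : Filtration ℕ mΩ}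

theorem measurable_oppoObs (hψ : Measurable fun p : S × A × S => ψ p.1 p.2.1 p.2.2)
    (hx : ∀ k < K, ∀ h < H, Measurable[𝓖 (2 * (k * H + h))] fun ω => x ω k h)
    (ha : ∀ k < K, ∀ h < H, Measurable[𝓖 (2 * (k * H + h) + 1)] fun ω => a ω k h)
    {k : ℕ} (hk : k < K) (hV : ∀ h ≤ H, JointlyMeasurable (𝓖 (2 * (k * H))) fun ω =>
      oppoV H ν ψ α β (x ω) (a ω) (r ω) k h) {h : ℕ} (hh : h < H) :
    Measurable[𝓖 (2 * (k * H + h) + 1)] fun ω =>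
      oppoObs H ν ψ α β (x ω) (a ω) (r ω) h k :=
  JointlyMeasurable.comp_action
    (f := fun ω y b => oppoFeature H ν ψ α β (x ω) (a ω) (r ω) k h y b)
    (fun b => ((hV (h + 1) hh).feature hψ b).mono (𝓖.mono (by omega)))
    ((hx k hk h hh).mono (𝓖.mono (by omega)) le_rfl) (ha k hk h hh)

/-- Everything computed in episode `k` depends on the earlier episodes and on the rewards of episode
`k`, which are fixed at index `2 * (k * H)`. Strong induction provides the policy, from episode `k -
1`, and the regression data, from all earlier episodes; inside the episode the value functions are
built backwards. This predictability is what makes the noise terms martingale differences. -/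
theorem jointlyMeasurable_oppo (hψ : Measurable fun p : S × A × S => ψ p.1 p.2.1 p.2.2)
    (hx : ∀ k < K, ∀ h < H, Measurable[𝓖 (2 * (k * H + h))] fun ω => x ω k h)
    (ha : ∀ k < K, ∀ h < H, Measurable[𝓖 (2 * (k * H + h) + 1)] fun ω => a ω k h)
    (hr : ∀ k < K, ∀ h < H, ∀ b, JointlyMeasurable (𝓖 (2 * (k * H))) fun ω y => r ω k h y b)
    {k : ℕ} (hk : k < K) :
    (∀ h < H, ∀ b, JointlyMeasurable (𝓖 (2 * (k * H))) fun ω y =>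
      oppoPolicy H ν ψ α 1 β (x ω) (a ω) (r ω) k h y b) ∧
    (∀ h ≤ H, JointlyMeasurable (𝓖 (2 * (k * H))) fun ω =>
      oppoV H ν ψ α β (x ω) (a ω) (r ω) k h) ∧
    (∀ h < H, ∀ b, JointlyMeasurable (𝓖 (2 * (k * H))) fun ω y =>
      oppoQ H ν ψ α β (x ω) (a ω) (r ω) k h y b) := by
  induction k using Nat.strong_induction_on with
  | _ k ih =>
  have hle : ∀ t < k, ∀ h < H, 2 * (t * H + h) + 1 ≤ 2 * (k * H) ∧
      2 * (t * H + h + 1) ≤ 2 * (k * H) := fun t ht h hh => by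
    have : (t + 1) * H ≤ k * H := Nat.mul_le_mul_right H ht
    rw [add_mul, one_mul] at this
    omega
  have hpol : ∀ h < H, ∀ b, JointlyMeasurable (𝓖 (2 * (k * H))) fun ω y =>
      oppoPolicy H ν ψ α 1 β (x ω) (a ω) (r ω) k h y b := by
    intro h hh b
    rcases k with _ | j
    · unfold JointlyMeasurable
      simp only [oppoPolicy_zero]
      exact measurable_const
    · have hmono : 𝓖 (2 * (j * H)) ≤ 𝓖 (2 * ((j + 1) * H)) := 𝓖.mono (by gcongr; omega)
      obtain ⟨h1, -, h2⟩ := ih j (Nat.lt_succ_self j) ((Nat.lt_succ_self j).trans hk)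
      have h3 : ∀ c, Measurable[(𝓖 (2 * ((j + 1) * H))).prod mS] fun p : Ω × S =>
          oppoPolicy H ν ψ α 1 β (x p.1) (a p.1) (r p.1) j h p.2 c *
            Real.exp (α * oppoQ H ν ψ α β (x p.1) (a p.1) (r p.1) j h p.2 c) := fun c =>
        Measurable.mul ((h1 h hh c).mono hmono)
          (Real.measurable_exp.comp (Measurable.const_mul ((h2 h hh c).mono hmono) α))
      unfold JointlyMeasurable
      simp only [oppoPolicy_succ]
      exact (h3 b).div (Finset.measurable_fun_sum _ fun c _ => h3 c)
  have hobs : ∀ h < H, ∀ t < k, Measurable[(𝓖 (2 * (k * H))).prod mS] fun p : Ω × S =>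
      oppoObs H ν ψ α β (x p.1) (a p.1) (r p.1) h t := fun h hh t ht =>
    ((measurable_oppoObs hψ hx ha (ht.trans hk) (ih t ht (ht.trans hk)).2.1 hh).mono
      (𝓖.mono (hle t ht h hh).1) le_rfl).comp measurable_fst
  have htarget : ∀ h < H, ∀ t < k, Measurable[(𝓖 (2 * (k * H))).prod mS] fun p : Ω × S =>
      oppoV H ν ψ α β (x p.1) (a p.1) (r p.1) t (h + 1) (x p.1 t (h + 1)) := fun h hh t ht => by
    -- The interaction says nothing about a state at step `H`; the value function vanishes there, so
    -- that state is irrelevant.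
    rcases Nat.lt_or_ge (h + 1) H with hh' | hh'
    · have h1 := (ih t ht (ht.trans hk)).2.1 (h + 1) hh
      have h2 : 2 * (t * H) ≤ 2 * (k * H) := by gcongr
      refine Measurable.comp (g := fun ω =>
        oppoV H ν ψ α β (x ω) (a ω) (r ω) t (h + 1) (x ω t (h + 1))) ?_ measurable_fst
      exact (h1.mono (𝓖.mono h2)).comp ((hx t (ht.trans hk) (h + 1) hh').mono
        (𝓖.mono (hle t ht h hh).2) le_rfl)
    · have : h + 1 = H := by omega
      simp only [this, oppoV_last]
      exact measurable_const
  have hQ : ∀ h < H, JointlyMeasurable (𝓖 (2 * (k * H))) (fun ω =>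
      oppoV H ν ψ α β (x ω) (a ω) (r ω) k (h + 1)) → ∀ b, JointlyMeasurable (𝓖 (2 * (k * H)))
      fun ω y => oppoQ H ν ψ α β (x ω) (a ω) (r ω) k h y b := by
    intro h hh hV b
    have hφ := hV.feature (ν := ν) hψ b
    have hG := measurable_ridgeGram
      (v := fun p : Ω × S => oppoObs H ν ψ α β (x p.1) (a p.1) (r p.1) h) (hobs h hh)
    unfold JointlyMeasurable
    simp only [oppoQ_eq]
    refine Measurable.max (Measurable.min (Measurable.add (Measurable.add (hr k hk h hh b) ?_)
      (Measurable.const_mul (Measurable.sqrt ?_) β)) measurable_const) measurable_const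
    · exact measurable_dotProduct_inv_mulVec hG hφ
        (measurable_sum_smul (v := fun p : Ω × S => oppoObs H ν ψ α β (x p.1) (a p.1) (r p.1) h)
          (c := fun t p => oppoV H ν ψ α β (x p.1) (a p.1) (r p.1) t (h + 1) (x p.1 t (h + 1)))
          (hobs h hh) (htarget h hh))
    · exact measurable_dotProduct_inv_mulVec hG hφ hφ
  have hV : ∀ h ≤ H, JointlyMeasurable (𝓖 (2 * (k * H))) fun ω =>
      oppoV H ν ψ α β (x ω) (a ω) (r ω) k h := by
    intro h hh
    induction hh using Nat.decreasingInduction with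
    | self =>
      unfold JointlyMeasurable
      simp only [oppoV_last]
      exact measurable_const
    | of_succ h hh ihV =>
      unfold JointlyMeasurable
      simp only [oppoV_eq _ _ _ _ _ _ _ _ _ hh]
      exact Finset.measurable_fun_sum _ fun b _ => (hQ h hh ihV b).mul (hpol h hh b)
  exact ⟨hpol, hV, fun h hh => hQ h hh (hV (h + 1) hh)⟩

end OPPOMeasurability

/-! ### Conditional expectations from conditional laws -/

section Conditioning

/-- The law of `(g, X)` and the composition product agree on rectangles, hence everywhere. The map
`g` will be the identity from the full `σ`-algebra to `m`, so that `κ` needs to be measurable only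
for `m`. -/
theorem integral_comp_prodMk_eq {Ω Ω' S : Type*} [MeasurableSpace Ω] [MeasurableSpace Ω']
    [MeasurableSpace S] {Pr : Measure Ω} [IsFiniteMeasure Pr] {g : Ω → Ω'} (hg : Measurable g)
    {X : Ω → S} (hX : Measurable X) {κ : Kernel Ω' S} [IsMarkovKernel κ]
    (h : ∀ t B, MeasurableSet t → MeasurableSet B →
      Pr (g ⁻¹' t ∩ X ⁻¹' B) = ∫⁻ ω in g ⁻¹' t, κ (g ω) B ∂Pr)
    {f : Ω' × S → ℝ} (hf : Measurable f) {B : ℝ} (hB : ∀ p, |f p| ≤ B) :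
    ∫ ω, f (g ω, X ω) ∂Pr = ∫ ω, ∫ y, f (g ω, y) ∂(κ (g ω)) ∂Pr := by
  have hgX : Measurable fun ω => (g ω, X ω) := hg.prodMk hX
  have heq : Pr.map (fun ω => (g ω, X ω)) = (Pr.map g) ⊗ₘ κ := by
    refine Measure.ext_prod fun {t s} ht hs => ?_
    rw [Measure.map_apply hgX (ht.prod hs), Measure.compProd_apply_prod ht hs,
      setLIntegral_map ht (Kernel.measurable_coe κ hs) hg, ← h t s ht hs]
    rfl
  have hi : Integrable f ((Pr.map g) ⊗ₘ κ) := integrable_of_measurable_of_bound hf hB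
  rw [← integral_map hgX.aemeasurable hf.aestronglyMeasurable, heq, Measure.integral_compProd hi,
    integral_map hg.aemeasurable]
  exact hf.stronglyMeasurable.integral_kernel_prod_right'.aestronglyMeasurable

variable {Ω S A : Type*} {m mΩ : MeasurableSpace Ω} [mS : MeasurableSpace S] {Pr : Measure Ω}
  [IsProbabilityMeasure Pr]

theorem lintegral_kernel_of_condExp (hm : m ≤ mΩ) {X : Ω → S} (hX : Measurable X)
    {κ : @Kernel Ω S m mS} [@IsMarkovKernel Ω S m mS κ] {B : Set S} (hB : MeasurableSet B)
    (h : Pr⟦X ⁻¹' B | m⟧ =ᵐ[Pr] fun ω => (κ ω).real B) {t : Set Ω} (ht : MeasurableSet[m] t) :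
    Pr (t ∩ X ⁻¹' B) = ∫⁻ ω in t, κ ω B ∂Pr := by
  have hκm : Measurable fun ω => κ ω B := (Kernel.measurable_coe κ hB).mono hm le_rfl
  have h1 : ∫ ω in t, (Pr⟦X ⁻¹' B | m⟧) ω ∂Pr = ∫ ω in t, (X ⁻¹' B).indicator (fun _ => (1 : ℝ)) ω ∂Pr :=
    setIntegral_condExp hm ((integrable_const 1).indicator (hX hB)) ht
  rw [setIntegral_congr_ae (hm t ht) (h.mono fun ω h _ => h), integral_indicator (hX hB),
    Measure.restrict_restrict (hX hB)] at h1
  have h2 : ∫ ω in t, (κ ω).real B ∂Pr = (∫⁻ ω in t, κ ω B ∂Pr).toReal := by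
    refine integral_toReal hκm.aemeasurable (Filter.Eventually.of_forall fun ω => ?_)
    exact measure_lt_top _ _
  have h3 : ∫⁻ ω in t, κ ω B ∂Pr ≠ ⊤ := by
    refine ne_top_of_le_ne_top (b := ∫⁻ ω in t, 1 ∂Pr) (by simp) (lintegral_mono fun ω => ?_)
    exact prob_le_one
  rw [h2] at h1
  simp only [integral_const, MeasurableSet.univ, measureReal_restrict_apply, Set.univ_inter,
    smul_eq_mul, mul_one] at h1
  rw [Set.inter_comm, ← ENNReal.toReal_eq_toReal_iff' (measure_ne_top _ _) h3, h1]
  rfl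

/-- Conditional expectation of `f ω (X ω)` when the conditional law of `X` is known. -/
theorem condExp_comp_of_condLaw (hm : m ≤ mΩ) {X : Ω → S} (hX : Measurable X)
    {κ : @Kernel Ω S m mS} [@IsMarkovKernel Ω S m mS κ]
    (h : ∀ B, MeasurableSet B → Pr⟦X ⁻¹' B | m⟧ =ᵐ[Pr] fun ω => (κ ω).real B)
    {f : Ω → S → ℝ} (hf : JointlyMeasurable m f) {B : ℝ} (hB : ∀ ω y, |f ω y| ≤ B) :
    Pr[fun ω => f ω (X ω) | m] =ᵐ[Pr] fun ω => ∫ y, f ω y ∂(κ ω) := by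
  have hint : Measurable[m] fun ω => ∫ y, f ω y ∂(κ ω) :=
    StronglyMeasurable.measurable (@StronglyMeasurable.integral_kernel_prod_right' Ω S m mS κ ℝ _ _ _
      (fun p => f p.1 p.2) (Measurable.stronglyMeasurable hf))
  have hintB : ∀ ω, |∫ y, f ω y ∂(κ ω)| ≤ B := fun ω => abs_integral_le_of_abs_le (hB ω)
  have hfm : Measurable fun ω => f ω (X ω) := (hf.mono hm).comp hX
  refine (ae_eq_condExp_of_forall_setIntegral_eq hm
    (integrable_of_measurable_of_bound hfm fun ω => hB ω _)
    (fun t _ _ => (integrable_of_measurable_of_bound (hint.mono hm le_rfl) hintB).integrableOn)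
    (fun t ht _ => ?_) hint.stronglyMeasurable.aestronglyMeasurable).symm
  have hF : Measurable[m.prod mS] fun p : Ω × S => (Prod.fst ⁻¹' t).indicator
      (fun p => f p.1 p.2) p := Measurable.indicator hf (measurable_fst ht)
  -- The indicator of `t` is absorbed into the integrand, because the identity of laws concerns
  -- integrals over all of `Ω`.
  have h1 := @integral_comp_prodMk_eq Ω Ω S mΩ m mS Pr _ id (measurable_id'' hm) X hX κ _
    (fun t s ht hs => lintegral_kernel_of_condExp hm hX hs (h s hs) ht) _ hF |B| (fun p => by
      by_cases hp : p ∈ Prod.fst ⁻¹' t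
      · rw [Set.indicator_of_mem hp]; exact (hB _ _).trans (le_abs_self B)
      · rw [Set.indicator_of_notMem hp]; simp)
  rw [← integral_indicator (hm t ht), ← integral_indicator (hm t ht)]
  refine Eq.trans ?_ (h1.symm.trans ?_)
  · refine integral_congr_ae (Filter.Eventually.of_forall fun ω => ?_)
    by_cases hω : ω ∈ t
    · simp [Set.indicator, hω]
    · simp [Set.indicator, hω]
  · refine integral_congr_ae (Filter.Eventually.of_forall fun ω => ?_)
    by_cases hω : ω ∈ t
    · simp [Set.indicator, hω]
    · simp [Set.indicator, hω]

theorem condExp_sub_comp_of_condLaw (hm : m ≤ mΩ) {X : Ω → S} (hX : Measurable X)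
    {κ : @Kernel Ω S m mS} [@IsMarkovKernel Ω S m mS κ]
    (h : ∀ B, MeasurableSet B → Pr⟦X ⁻¹' B | m⟧ =ᵐ[Pr] fun ω => (κ ω).real B)
    {f : Ω → S → ℝ} (hf : JointlyMeasurable m f) {B : ℝ} (hB : ∀ ω y, |f ω y| ≤ B) :
    Measurable (fun ω => f ω (X ω) - ∫ y, f ω y ∂(κ ω)) ∧
      Pr[fun ω => f ω (X ω) - ∫ y, f ω y ∂(κ ω) | m] =ᵐ[Pr] 0 := by
  have hint : Measurable[m] fun ω => ∫ y, f ω y ∂(κ ω) :=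
    StronglyMeasurable.measurable (@StronglyMeasurable.integral_kernel_prod_right' Ω S m mS κ ℝ _ _ _
      (fun p => f p.1 p.2) (Measurable.stronglyMeasurable hf))
  have hinti := integrable_of_measurable_of_bound (μ := Pr) (hint.mono hm le_rfl)
    fun ω => abs_integral_le_of_abs_le (hB ω)
  have hfm : Measurable fun ω => f ω (X ω) := (hf.mono hm).comp hX
  refine ⟨hfm.sub (hint.mono hm le_rfl), ?_⟩
  have h1 := condExp_sub (integrable_of_measurable_of_bound (μ := Pr) hfm fun ω => hB ω _) hinti m
  have h2 := condExp_comp_of_condLaw (Pr := Pr) hm hX h hf hB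
  rw [condExp_of_stronglyMeasurable hm hint.stronglyMeasurable hinti] at h1
  filter_upwards [h1, h2] with ω h1 h2
  rw [Pi.sub_apply, h2, sub_self] at h1
  exact h1

/-- The centered version of `f (Y ω) ω` when the conditional law of `Y` on a finite set is known. -/
theorem condExp_sub_sum_of_condLaw [Fintype A] [MeasurableSpace A] [MeasurableSingletonClass A]
    (hm : m ≤ mΩ) {Y : Ω → A} (hY : Measurable Y) {p : A → Ω → ℝ}
    (h : ∀ a, Pr⟦Y ⁻¹' {a} | m⟧ =ᵐ[Pr] p a) {f : Ω → A → ℝ}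
    (hf : ∀ a, Measurable[m] fun ω => f ω a) {B : ℝ} (hB : ∀ ω a, |f ω a| ≤ B)
    (hp : ∀ a, Measurable[m] (p a)) (hp1 : ∀ ω, (fun a => p a ω) ∈ stdSimplex ℝ A) :
    Measurable (fun ω => f ω (Y ω) - ∑ a, p a ω * f ω a) ∧
      Pr[fun ω => f ω (Y ω) - ∑ a, p a ω * f ω a | m] =ᵐ[Pr] 0 := by
  classical
  have hsum : Measurable[m] fun ω => ∑ a, p a ω * f ω a :=
    Finset.measurable_fun_sum _ fun a _ => (hp a).mul (hf a)
  have hsumi := integrable_of_measurable_of_bound (μ := Pr) (hsum.mono hm le_rfl)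
    fun ω => abs_sum_policy_mul_le (hp1 ω) (hB ω)
  have hind : ∀ a, Measurable ((Y ⁻¹' {a}).indicator fun _ => (1 : ℝ)) := fun a =>
    measurable_const.indicator (hY (measurableSet_singleton a))
  have hindi : ∀ a, Integrable ((Y ⁻¹' {a}).indicator fun _ => (1 : ℝ)) Pr := fun a =>
    (integrable_const 1).indicator (hY (measurableSet_singleton a))
  have hmuli : ∀ a, Integrable ((fun ω => f ω a) * (Y ⁻¹' {a}).indicator fun _ => (1 : ℝ)) Pr :=
    fun a => (hindi a).bdd_mul ((hf a).mono hm le_rfl).aestronglyMeasurable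
      (Filter.Eventually.of_forall fun ω => hB ω a)
  -- Splitting over the values of `Y` leaves the `m`-measurable factors `f ω a`, which come out of
  -- the conditional expectation.
  have heq : (fun ω => f ω (Y ω)) =
      ∑ a, (fun ω => f ω a) * (Y ⁻¹' {a}).indicator fun _ => (1 : ℝ) := by
    funext ω
    simp [Finset.sum_apply, Set.indicator_apply]
  have hfm : Measurable fun ω => f ω (Y ω) := by
    rw [heq]
    have h' : Measurable fun ω => ∑ a, f ω a * (Y ⁻¹' {a}).indicator (fun _ => (1 : ℝ)) ω :=
      Finset.measurable_fun_sum _ fun a _ => ((hf a).mono hm le_rfl).mul (hind a)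
    convert h' using 1
    funext ω
    simp [Finset.sum_apply]
  refine ⟨hfm.sub (hsum.mono hm le_rfl), ?_⟩
  have h1 := condExp_sub (integrable_of_measurable_of_bound (μ := Pr) hfm fun ω => hB ω _) hsumi m
  have h2 : Pr[fun ω => f ω (Y ω) | m] =ᵐ[Pr] fun ω => ∑ a, p a ω * f ω a := by
    rw [heq]
    have h3 := condExp_finsetSum (s := Finset.univ) (fun a _ => hmuli a) m
    have h4 : ∀ᵐ ω ∂Pr, ∀ a, (Pr[(fun ω => f ω a) * (Y ⁻¹' {a}).indicator fun _ => (1 : ℝ) | m]) ω =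
        f ω a * p a ω := by
      rw [ae_all_iff]
      intro a
      filter_upwards [condExp_mul_of_stronglyMeasurable_left (hf a).stronglyMeasurable
        (hmuli a) (hindi a), h a] with ω h5 h6
      rw [h5, Pi.mul_apply, h6]
    filter_upwards [h3, h4] with ω h3 h4
    rw [h3, Finset.sum_apply]
    exact Finset.sum_congr rfl fun a _ => by rw [h4 a, mul_comm]
  rw [condExp_of_stronglyMeasurable hm hsum.stronglyMeasurable hsumi] at h1
  filter_upwards [h1, h2] with ω h1 h2
  rw [Pi.sub_apply, h2, sub_self] at h1
  exact h1

end Conditioning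

/-! ### Noise terms and the regret decomposition -/

section Noise

variable {S A : Type*} [mS : MeasurableSpace S] [Fintype A] [MeasurableSpace A] {d : ℕ}
  (H : ℕ) (ν : Measure S) (P : ℕ → Kernel (S × A) S) (ψ : S → A → S → EuclideanSpace ℝ (Fin d))
  (α β : ℝ) (x : ℕ → ℕ → S) (a : ℕ → ℕ → A) (r : ℕ → ℕ → S → A → ℝ)

/-- The normalized noise of the regression targets of OPPO. -/
noncomputable def valueNoise (h k : ℕ) : ℝ :=
  oppoV H ν ψ α β x a r k (h + 1) (x k (h + 1)) / H -
    ∫ y, oppoV H ν ψ α β x a r k (h + 1) y / H ∂(P h (x k h, a k h))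

/-- The value function of the policy that OPPO executes in episode `k`. -/
noncomputable def oppoPolicyV (k h : ℕ) : S → ℝ :=
  policyV H P (oppoPolicy H ν ψ α 1 β x a r k) (r k) h

/-- The normalized difference of the estimated and the true `Q`-function. -/
noncomputable def gapQ (k h : ℕ) (y : S) (b : A) : ℝ :=
  (oppoQ H ν ψ α β x a r k h y b -
    (r k h y b + ∫ y', oppoPolicyV H ν P ψ α β x a r k (h + 1) y' ∂(P h (y, b)))) / (2 * H)

/-- The normalized difference of the estimated and the true value function. -/
noncomputable def gapV (k h : ℕ) (y : S) : ℝ :=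
  (oppoV H ν ψ α β x a r k h y - oppoPolicyV H ν P ψ α β x a r k h y) / (2 * H)

/-- The normalized deviation that is due to the random choice of the action. -/
noncomputable def actionNoise (h k : ℕ) : ℝ :=
  gapQ H ν P ψ α β x a r k h (x k h) (a k h) -
    ∑ b, oppoPolicy H ν ψ α 1 β x a r k h (x k h) b * gapQ H ν P ψ α β x a r k h (x k h) b

/-- The normalized deviation that is due to the random transition. -/
noncomputable def transNoise (h k : ℕ) : ℝ :=
  gapV H ν P ψ α β x a r k (h + 1) (x k (h + 1)) -
    ∫ y, gapV H ν P ψ α β x a r k (h + 1) y ∂(P h (x k h, a k h))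

/-- The event on which the regression noise and the martingale terms are under control. -/
def GoodEvent (K : ℕ) (δ : ℝ) : Prop :=
  ∀ h < H, (∀ k < K, (∑ t ∈ Finset.range k,
      valueNoise H ν P ψ α β x a r h t • oppoObs H ν ψ α β x a r h t) ⬝ᵥ
      ((ridgeGram (oppoObs H ν ψ α β x a r h) k)⁻¹ *ᵥ ∑ t ∈ Finset.range k,
        valueNoise H ν P ψ α β x a r h t • oppoObs H ν ψ α β x a r h t) ≤
      Real.log (ridgeGram (oppoObs H ν ψ α β x a r h) k).det + 2 * Real.log (1 / δ)) ∧
    (∑ k ∈ Finset.range K, actionNoise H ν P ψ α β x a r h k) ^ 2 / (1 + K) ≤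
      Real.log (1 + K) + 2 * Real.log (1 / δ) ∧
    (∑ k ∈ Finset.range K, transNoise H ν P ψ α β x a r h k) ^ 2 / (1 + K) ≤
      Real.log (1 + K) + 2 * Real.log (1 / δ)

variable [Nonempty A]

/-- Both value functions lie in `[0, H]`, so division by `2 H` leaves at most `1 / 2`. The noise
terms are differences of two such quantities and thus bounded by `1`, as the concentration
inequalities require. -/
theorem abs_gapV_le [∀ h, IsMarkovKernel (P h)] {k : ℕ}
    (hr : ∀ h < H, ∀ y b, r k h y b ∈ Set.Icc (0 : ℝ) 1) {h : ℕ} (hh : h ≤ H) (y : S) :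
    |gapV H ν P ψ α β x a r k h y| ≤ 1 / 2 := by
  have h1 := oppoV_mem_Icc H ν ψ α β x a r k hh y
  have h2 : oppoPolicyV H ν P ψ α β x a r k h y ∈ _ := policyV_mem (P := P)
    (fun h _ y => oppoPolicy_mem_stdSimplex H ν ψ α β x a r k h y) hr hh y
  have h3 : (0 : ℝ) ≤ h := Nat.cast_nonneg h
  rcases Nat.eq_zero_or_pos H with rfl | hH
  · simp [gapV]
  · have hH' : (0 : ℝ) < 2 * H := by positivity
    rw [gapV, abs_div, abs_of_pos hH', div_le_iff₀ hH', abs_le]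
    constructor <;> linarith [h1.1, h1.2, h2.1, h2.2]

theorem abs_gapQ_le [∀ h, IsMarkovKernel (P h)] {k : ℕ}
    (hr : ∀ h < H, ∀ y b, r k h y b ∈ Set.Icc (0 : ℝ) 1) {h : ℕ} (hh : h < H) (y : S) (b : A) :
    |gapQ H ν P ψ α β x a r k h y b| ≤ 1 / 2 := by
  have h1 := oppoQ_mem H ν ψ α β x a r k hh y b
  have h2 : _ ∈ _ := integral_mem_Icc_of_mem_Icc (μ := P h (y, b)) (policyV_mem (P := P)
    (fun h _ y => oppoPolicy_mem_stdSimplex H ν ψ α β x a r k h y) hr (h := h + 1) hh)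
  have h3 : (0 : ℝ) ≤ h := Nat.cast_nonneg h
  have h4 := hr h hh y b
  have hH' : (0 : ℝ) < 2 * H := by
    have : (0 : ℝ) < H := by exact_mod_cast Nat.zero_lt_of_lt hh
    positivity
  push_cast at h2
  rw [gapQ, abs_div, abs_of_pos hH', div_le_iff₀ hH', abs_le]
  unfold oppoPolicyV
  constructor <;> linarith [h1.1, h1.2, h2.1, h2.2, h4.1, h4.2]

theorem abs_sub_integral_le {μ : Measure S} [IsProbabilityMeasure μ] {f : S → ℝ} {B : ℝ}
    (hf : ∀ y, f y ∈ Set.Icc 0 B) (y : S) : |f y - ∫ y', f y' ∂μ| ≤ B := by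
  have h1 := integral_mem_Icc_of_mem_Icc (μ := μ) hf
  have h2 := hf y
  rw [abs_le]; constructor <;> linarith [h1.1, h1.2, h2.1, h2.2]

theorem abs_valueNoise_le [∀ h, IsMarkovKernel (P h)] {h : ℕ} (hh : h < H) (k : ℕ) :
    |valueNoise H ν P ψ α β x a r h k| ≤ 1 := by
  have hH' : (0 : ℝ) < H := by exact_mod_cast Nat.zero_lt_of_lt hh
  refine abs_sub_integral_le (f := fun y => oppoV H ν ψ α β x a r k (h + 1) y / H) (fun y => ?_) _
  have h1 := oppoV_mem_Icc H ν ψ α β x a r k (h := h + 1) hh y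
  exact ⟨div_nonneg h1.1 hH'.le, (div_le_one hH').2 h1.2⟩

theorem abs_transNoise_le [∀ h, IsMarkovKernel (P h)] {k : ℕ}
    (hr : ∀ h < H, ∀ y b, r k h y b ∈ Set.Icc (0 : ℝ) 1) {h : ℕ} (hh : h < H) :
    |transNoise H ν P ψ α β x a r h k| ≤ 1 := by
  refine (abs_sub _ _).trans ?_
  have h1 := abs_gapV_le H ν P ψ α β x a r hr (h := h + 1) hh (x k (h + 1))
  have h2 := abs_integral_le_of_abs_le (μ := P h (x k h, a k h))
    (abs_gapV_le H ν P ψ α β x a r hr (h := h + 1) hh)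
  linarith

theorem abs_actionNoise_le [∀ h, IsMarkovKernel (P h)] {k : ℕ}
    (hr : ∀ h < H, ∀ y b, r k h y b ∈ Set.Icc (0 : ℝ) 1) {h : ℕ} (hh : h < H) :
    |actionNoise H ν P ψ α β x a r h k| ≤ 1 := by
  refine (abs_sub _ _).trans ?_
  have h1 := abs_gapQ_le H ν P ψ α β x a r hr hh (x k h) (a k h)
  have h2 := abs_sum_policy_mul_le (oppoPolicy_mem_stdSimplex H ν ψ α β x a r k h (x k h))
    (abs_gapQ_le H ν P ψ α β x a r hr hh (x k h))
  linarith

/-- Decomposition of the gap between the estimated and the true value of the executed policy. -/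
theorem oppoV_sub_policyV_eq [∀ h, IsMarkovKernel (P h)] (hH : 0 < H) {k : ℕ}
    (hr : ∀ h < H, ∀ y b, r k h y b ∈ Set.Icc (0 : ℝ) 1)
    (hV : ∀ h ≤ H, Measurable (oppoV H ν ψ α β x a r k h))
    (hW : ∀ h ≤ H, Measurable (oppoPolicyV H ν P ψ α β x a r k h)) :
    oppoV H ν ψ α β x a r k 0 (x k 0) - oppoPolicyV H ν P ψ α β x a r k 0 (x k 0) =
      ∑ h ∈ Finset.range H, (oppoQ H ν ψ α β x a r k h (x k h) (a k h) - (r k h (x k h) (a k h) +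
        ∫ y, oppoV H ν ψ α β x a r k (h + 1) y ∂(P h (x k h, a k h)))) -
      2 * H * ∑ h ∈ Finset.range H, (actionNoise H ν P ψ α β x a r h k +
        transNoise H ν P ψ α β x a r h k) := by
  have hH' : (0 : ℝ) < H := by exact_mod_cast hH
  set Δ : ℕ → ℝ := fun h =>
    oppoV H ν ψ α β x a r k h (x k h) - oppoPolicyV H ν P ψ α β x a r k h (x k h) with hΔ
  have hstep : ∀ h < H, Δ h - Δ (h + 1) = (oppoQ H ν ψ α β x a r k h (x k h) (a k h) -
      (r k h (x k h) (a k h) + ∫ y, oppoV H ν ψ α β x a r k (h + 1) y ∂(P h (x k h, a k h)))) -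
      2 * H * (actionNoise H ν P ψ α β x a r h k + transNoise H ν P ψ α β x a r h k) := by
    intro h hh
    -- Both value functions average their `Q`-functions over the same executed policy, so the mean
    -- of `gapQ` is the gap of the values at the visited state.
    have e1 : ∑ b, oppoPolicy H ν ψ α 1 β x a r k h (x k h) b *
        gapQ H ν P ψ α β x a r k h (x k h) b = Δ h / (2 * H) := by
      simp only [hΔ, oppoV_eq H ν ψ α β x a r k hh]
      rw [oppoPolicyV, policyV_eq hh, ← Finset.sum_sub_distrib, Finset.sum_div]
      refine Finset.sum_congr rfl fun b _ => ?_
      rw [gapQ, oppoPolicyV]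
      ring
    have e2 : ∫ y, gapV H ν P ψ α β x a r k (h + 1) y ∂(P h (x k h, a k h)) =
        (∫ y, oppoV H ν ψ α β x a r k (h + 1) y ∂(P h (x k h, a k h)) -
          ∫ y, oppoPolicyV H ν P ψ α β x a r k (h + 1) y ∂(P h (x k h, a k h))) / (2 * H) := by
      simp only [gapV]
      rw [integral_div, integral_sub]
      · refine integrable_of_measurable_of_bound (hV (h + 1) hh) (B := H) fun y => ?_
        have h1 := oppoV_mem_Icc H ν ψ α β x a r k (h := h + 1) hh y
        rw [abs_of_nonneg h1.1]; exact h1.2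
      · refine integrable_of_measurable_of_bound (hW (h + 1) hh) (B := H - (h + 1 : ℕ)) fun y => ?_
        have h1 := policyV_mem (P := P) (fun h _ y =>
          oppoPolicy_mem_stdSimplex H ν ψ α β x a r k h y) hr (h := h + 1) hh y
        rw [oppoPolicyV, abs_of_nonneg h1.1]; exact h1.2
    rw [actionNoise, transNoise, e1, e2, gapQ, gapV]
    simp only [hΔ]
    field_simp
    ring
  have htel := Finset.sum_range_sub' Δ H
  have hΔH : Δ H = 0 := by simp [hΔ, oppoV_last, oppoPolicyV, policyV_last]
  rw [hΔH, sub_zero] at htel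
  change Δ 0 = _
  rw [← htel, Finset.sum_congr rfl fun h hh => hstep h (Finset.mem_range.1 hh),
    Finset.sum_sub_distrib, Finset.mul_sum]

/-- The bound on the regret of policy optimization against optimistic estimates. -/
theorem sum_value_sub_oppoV_le [MeasurableSingletonClass A] [∀ h, IsMarkovKernel (P h)] {x₁ : S}
    {K : ℕ} (hH : 0 < H) (hα : 0 < α) (hr : ∀ k < K, ∀ h < H, ∀ y b, r k h y b ∈ Set.Icc (0 : ℝ) 1)
    (hrm : ∀ k < K, ∀ h < H, ∀ b, Measurable fun y => r k h y b)
    (hπ : ∀ k < K, oppoPolicy H ν ψ α 1 β x a r k ∈ policies S A H)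
    (hV : ∀ k < K, ∀ h ≤ H, Measurable (oppoV H ν ψ α β x a r k h))
    (hQ : ∀ k < K, ∀ h < H, ∀ b, Measurable fun y => oppoQ H ν ψ α β x a r k h y b)
    (hopt : ∀ k < K, ∀ h < H, ∀ y b, r k h y b +
      ∫ y', oppoV H ν ψ α β x a r k (h + 1) y' ∂(P h (y, b)) ≤ oppoQ H ν ψ α β x a r k h y b)
    {π' : ℕ → S → A → ℝ} (hπ' : π' ∈ policies S A H) :
    ∑ k ∈ Finset.range K, (value H P x₁ π' (r k) - oppoV H ν ψ α β x a r k 0 x₁) ≤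
      H * (Real.log (Fintype.card A) / α + α * H ^ 2 * K / 2) := by
  have hH' : (0 : ℝ) < H := by exact_mod_cast hH
  have hVB : ∀ k, ∀ h ≤ H, ∀ y, |oppoV H ν ψ α β x a r k h y| ≤ H := fun k h hh y => by
    have h1 := oppoV_mem_Icc H ν ψ α β x a r k hh y
    rw [abs_of_nonneg h1.1]; exact h1.2
  have hQB : ∀ k, ∀ h < H, ∀ y b, oppoQ H ν ψ α β x a r k h y b ∈ Set.Icc (0 : ℝ) H :=
    fun k h hh y b => by
      have h1 := oppoQ_mem H ν ψ α β x a r k hh y b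
      exact ⟨h1.1, h1.2.trans (by linarith [(Nat.cast_nonneg h : (0 : ℝ) ≤ h)])⟩
  set adv : ℕ → ℕ → S → ℝ := fun k h y => ∑ b, oppoQ H ν ψ α β x a r k h y b *
    (π' h y b - oppoPolicy H ν ψ α 1 β x a r k h y b) with hadv
  have hadvm : ∀ k < K, ∀ h < H, Measurable (adv k h) := fun k hk h hh =>
    Finset.measurable_fun_sum _ fun b _ =>
      (hQ k hk h hh b).mul (((hπ' h hh).2 b).sub ((hπ k hk h hh).2 b))
  have hadvB : ∀ k < K, ∀ h < H, ∀ y, |adv k h y| ≤ H + H := fun k hk h hh y => by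
    have h1 := abs_sum_policy_mul_le ((hπ' h hh).1 y) (f := oppoQ H ν ψ α β x a r k h y)
      (B := H) fun b => by rw [abs_of_nonneg (hQB k h hh y b).1]; exact (hQB k h hh y b).2
    have h2 := abs_sum_policy_mul_le ((hπ k hk h hh).1 y) (f := oppoQ H ν ψ α β x a r k h y)
      (B := H) fun b => by rw [abs_of_nonneg (hQB k h hh y b).1]; exact (hQB k h hh y b).2
    have h3 : adv k h y = ∑ b, π' h y b * oppoQ H ν ψ α β x a r k h y b -
        ∑ b, oppoPolicy H ν ψ α 1 β x a r k h y b * oppoQ H ν ψ α β x a r k h y b := by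
      rw [← Finset.sum_sub_distrib]
      exact Finset.sum_congr rfl fun b _ => by ring
    rw [h3]
    exact (abs_sub _ _).trans (add_le_add h1 h2)
  have hprob : ∀ h < H, IsProbabilityMeasure (trajLaw P π' x₁ h) := fun h hh =>
    isProbabilityMeasure_trajLaw hπ' hh.le
  have hk : ∀ k < K, value H P x₁ π' (r k) - oppoV H ν ψ α β x a r k 0 x₁ ≤
      ∑ h ∈ Finset.range H, ∫ τ, adv k h τ.2 ∂(trajLaw P π' x₁ h) := by
    intro k hk
    rw [value_sub_eq_sum (P := P) hπ' (hr k hk) (hrm k hk) (hV k hk) (hVB k)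
      (oppoV_last H ν ψ α β x a r k)]
    refine Finset.sum_le_sum fun h hh => ?_
    have hh' := Finset.mem_range.1 hh
    have := hprob h hh'
    have hPVm : Measurable fun y => ∑ b, π' h y b *
        (r k h y b + ∫ y', oppoV H ν ψ α β x a r k (h + 1) y' ∂(P h (y, b))) -
        oppoV H ν ψ α β x a r k h y :=
      (Finset.measurable_fun_sum _ fun b _ => ((hπ' h hh').2 b).mul ((hrm k hk h hh' b).add
        (measurable_integral_kernel (hV k hk (h + 1) hh') b))).sub (hV k hk h hh'.le)
    have hPVB : ∀ y, |∑ b, π' h y b *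
        (r k h y b + ∫ y', oppoV H ν ψ α β x a r k (h + 1) y' ∂(P h (y, b))) -
        oppoV H ν ψ α β x a r k h y| ≤ (1 + H) + H := fun y => by
      refine (abs_sub _ _).trans (add_le_add (abs_sum_policy_mul_le ((hπ' h hh').1 y) fun b => ?_)
        (hVB k h hh'.le y))
      have h1 := hr k hk h hh' y b
      refine (abs_add_le _ _).trans
        (add_le_add ?_ (abs_integral_le_of_abs_le (hVB k (h + 1) hh')))
      rw [abs_of_nonneg h1.1]; exact h1.2
    refine integral_mono
      (integrable_of_measurable_of_bound (hPVm.comp measurable_snd) fun τ => hPVB τ.2)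
      (integrable_of_measurable_of_bound ((hadvm k hk h hh').comp measurable_snd)
        fun τ => hadvB k hk h hh' τ.2) fun τ => ?_
    simp only [hadv]
    rw [oppoV_eq H ν ψ α β x a r k hh', ← Finset.sum_sub_distrib]
    refine Finset.sum_le_sum fun b _ => ?_
    -- Optimism replaces the Bellman backup of the estimate by its `Q`-function under the weights of
    -- `π'`.
    have h1 := mul_le_mul_of_nonneg_left (hopt k hk h hh' τ.2 b) (((hπ' h hh').1 τ.2).1 b)
    linarith
  calc _ ≤ ∑ k ∈ Finset.range K, ∑ h ∈ Finset.range H, ∫ τ, adv k h τ.2 ∂(trajLaw P π' x₁ h) :=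
        Finset.sum_le_sum fun k hk' => hk k (Finset.mem_range.1 hk')
    -- The trajectory law of `π'` is the same in all episodes. The sum over `k` therefore moves
    -- inside the integral, where exponential weights are applied at each state separately.
    _ = ∑ h ∈ Finset.range H, ∫ τ, ∑ k ∈ Finset.range K, adv k h τ.2 ∂(trajLaw P π' x₁ h) := by
        rw [Finset.sum_comm]
        refine Finset.sum_congr rfl fun h hh => ?_
        have hh' := Finset.mem_range.1 hh
        have := hprob h hh'
        rw [integral_finsetSum]
        intro k hk'
        have hk'' := Finset.mem_range.1 hk'
        exact integrable_of_measurable_of_bound ((hadvm k hk'' h hh').comp measurable_snd)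
          fun τ => hadvB k hk'' h hh' τ.2
    _ ≤ ∑ h ∈ Finset.range H, (Real.log (Fintype.card A) / α + α * H ^ 2 * K / 2) := by
        refine Finset.sum_le_sum fun h hh => ?_
        have hh' := Finset.mem_range.1 hh
        have := hprob h hh'
        have hle : ∀ y, ∑ k ∈ Finset.range K, adv k h y ≤
            Real.log (Fintype.card A) / α + α * H ^ 2 * K / 2 := fun y =>
          sum_exp_weights_le (p := fun k => oppoPolicy H ν ψ α 1 β x a r k h y)
            (q := fun k => oppoQ H ν ψ α β x a r k h y) hα hH'
            (oppoPolicy_zero H ν ψ α β x a r h y)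
            (fun k b => oppoPolicy_succ H ν ψ α β x a r k h y b)
            (fun k _ b => hQB k h hh' y b) ((hπ' h hh').1 y)
        calc _ ≤ ∫ τ, (Real.log (Fintype.card A) / α + α * H ^ 2 * K / 2)
              ∂(trajLaw P π' x₁ h) := by
              refine integral_mono (integrable_finsetSum _ fun k hk' => ?_)
                (integrable_const _) fun τ => hle τ.2
              have hk'' := Finset.mem_range.1 hk'
              exact integrable_of_measurable_of_bound ((hadvm k hk'' h hh').comp measurable_snd)
                fun τ => hadvB k hk'' h hh' τ.2
          _ = _ := by simp
    _ = _ := by rw [Finset.sum_const, Finset.card_range, nsmul_eq_mul]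

end Noise

/-! ### Probability of the good event -/

section GoodEventProbability

variable {Ω S A : Type*} {mΩ : MeasurableSpace Ω} [mS : MeasurableSpace S] [Fintype A] [Nonempty A]
  [MeasurableSpace A] [MeasurableSingletonClass A] {d H K : ℕ} {ν : Measure S} [SFinite ν]
  {ψ : S → A → S → EuclideanSpace ℝ (Fin d)} {α β : ℝ} {x : Ω → ℕ → ℕ → S} {a : Ω → ℕ → ℕ → A}
  {r : Ω → ℕ → ℕ → S → A → ℝ} {𝓖 : Filtration ℕ mΩ} {Pr : Measure Ω} [IsProbabilityMeasure Pr]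
  {P : ℕ → Kernel (S × A) S} [∀ h, IsMarkovKernel (P h)] {x₁ : S} {π : ℕ → Ω → ℕ → S → A → ℝ}

/-- Common to both transition noises: `f` is known when the episode begins, and the subtracted
integral is its mean under the conditional law of the next state. After the last step no next state
is specified, hence the requirement that `f` vanish there. -/
theorem measurable_transition_noise (hI : IsInteraction Pr 𝓖 H K P x₁ (fun k h ω => x ω k h)
      (fun k h ω => a ω k h) (fun k h ω => r ω k h) π)
    {k h : ℕ} (hk : k < K) (hh : h < H) {f : Ω → S → ℝ}
    (hf : JointlyMeasurable (𝓖 (2 * (k * H))) f) {B : ℝ} (hB : ∀ ω y, |f ω y| ≤ B)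
    (h0 : h + 1 = H → ∀ ω y, f ω y = 0) :
    Measurable[𝓖 (2 * (k * H + h + 1))]
      (fun ω => f ω (x ω k (h + 1)) - ∫ y, f ω y ∂(P h (x ω k h, a ω k h))) ∧
    Pr[fun ω => f ω (x ω k (h + 1)) - ∫ y, f ω y ∂(P h (x ω k h, a ω k h)) |
      𝓖 (2 * (k * H + h) + 1)] =ᵐ[Pr] 0 := by
  rcases Nat.lt_or_ge (h + 1) H with hh' | hh'
  · have hX : Measurable[𝓖 (2 * (k * H + h) + 1)] fun ω => x ω k h :=
      (hI.state_measurable k hk h hh).mono (𝓖.mono (by omega)) le_rfl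
    have hXA : Measurable[𝓖 (2 * (k * H + h) + 1)] fun ω => (x ω k h, a ω k h) :=
      hX.prodMk (hI.action_measurable k hk h hh)
    have hX' := hI.state_measurable k hk (h + 1) hh'
    have hf' : JointlyMeasurable (𝓖 (2 * (k * H + h) + 1)) f := hf.mono (𝓖.mono (by omega))
    refine ⟨Measurable.sub ((hf.mono (𝓖.mono (by omega))).comp hX') ?_, ?_⟩
    · exact (JointlyMeasurable.comp_action (f := fun ω y b => ∫ y', f ω y' ∂(P h (y, b)))
        (fun b => hf'.integral_kernel (P h) b) hX (hI.action_measurable k hk h hh)).mono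
        (𝓖.mono (by omega)) le_rfl
    · exact (@condExp_sub_comp_of_condLaw Ω S (𝓖 (2 * (k * H + h) + 1)) mΩ mS Pr _ (𝓖.le _)
        (fun ω => x ω k (h + 1)) (hX'.mono (𝓖.le _) le_rfl)
        (@Kernel.comap (S × A) S _ mS Ω (𝓖 (2 * (k * H + h) + 1)) (P h) _ hXA)
        (@Kernel.IsMarkovKernel.comap (S × A) S _ mS Ω (𝓖 (2 * (k * H + h) + 1)) _ (P h) _ hXA)
        (hI.next_state_law k hk h hh') f hf' B hB).2
  · have h1 : h + 1 = H := by omega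
    simp only [h0 h1, integral_zero, sub_zero]
    exact ⟨measurable_const, by rw [condExp_const (𝓖.le _)]; rfl⟩

section

variable (hψ : Measurable fun p : S × A × S => ψ p.1 p.2.1 p.2.2)
  (hI : IsInteraction Pr 𝓖 H K P x₁ (fun k h ω => x ω k h) (fun k h ω => a ω k h)
    (fun k h ω => r ω k h) fun k ω => oppoPolicy H ν ψ α 1 β (x ω) (a ω) (r ω) k)

include hψ hI

theorem jointlyMeasurable_oppoPolicyV {k h : ℕ} (hk : k < K) (hh : h ≤ H) :
    JointlyMeasurable (𝓖 (2 * (k * H))) fun ω =>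
      oppoPolicyV H ν P ψ α β (x ω) (a ω) (r ω) k h :=
  jointlyMeasurable_policyV (r := fun ω => r ω k) (jointlyMeasurable_oppo hψ
    hI.state_measurable hI.action_measurable hI.reward_measurable hk).1 (hI.reward_measurable k hk) hh

theorem jointlyMeasurable_gapV {k h : ℕ} (hk : k < K) (hh : h ≤ H) :
    JointlyMeasurable (𝓖 (2 * (k * H))) fun ω =>
      gapV H ν P ψ α β (x ω) (a ω) (r ω) k h :=
  Measurable.div_const (Measurable.sub ((jointlyMeasurable_oppo hψ hI.state_measurable
    hI.action_measurable hI.reward_measurable hk).2.1 h hh)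
    (jointlyMeasurable_oppoPolicyV hψ hI hk hh)) _

theorem jointlyMeasurable_gapQ {k h : ℕ} (hk : k < K) (hh : h < H) (b : A) :
    JointlyMeasurable (𝓖 (2 * (k * H))) fun ω y =>
      gapQ H ν P ψ α β (x ω) (a ω) (r ω) k h y b :=
  Measurable.div_const (Measurable.sub ((jointlyMeasurable_oppo hψ hI.state_measurable
    hI.action_measurable hI.reward_measurable hk).2.2 h hh b)
    (Measurable.add (hI.reward_measurable k hk h hh b)
      ((jointlyMeasurable_oppoPolicyV hψ hI hk hh).integral_kernel (P h) b))) _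

theorem measurable_valueNoise {k h : ℕ} (hk : k < K) (hh : h < H) :
    Measurable[𝓖 (2 * (k * H + h + 1))]
      (fun ω => valueNoise H ν P ψ α β (x ω) (a ω) (r ω) h k) ∧
    Pr[fun ω => valueNoise H ν P ψ α β (x ω) (a ω) (r ω) h k |
      𝓖 (2 * (k * H + h) + 1)] =ᵐ[Pr] 0 := by
  have hH' : (0 : ℝ) < H := by exact_mod_cast Nat.zero_lt_of_lt hh
  refine measurable_transition_noise hI hk hh (B := 1)
    (f := fun ω y => oppoV H ν ψ α β (x ω) (a ω) (r ω) k (h + 1) y / H)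
    (Measurable.div_const ((jointlyMeasurable_oppo hψ hI.state_measurable
      hI.action_measurable hI.reward_measurable hk).2.1 (h + 1) hh) _) (fun ω y => ?_)
    fun h1 ω y => by rw [h1, oppoV_last, zero_div]
  have h1 := oppoV_mem_Icc H ν ψ α β (x ω) (a ω) (r ω) k (h := h + 1) hh y
  rw [abs_of_nonneg (div_nonneg h1.1 hH'.le)]
  exact (div_le_one hH').2 h1.2

theorem measurable_transNoise {k h : ℕ} (hk : k < K) (hh : h < H) :
    Measurable[𝓖 (2 * (k * H + h + 1))]
      (fun ω => transNoise H ν P ψ α β (x ω) (a ω) (r ω) h k) ∧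
    Pr[fun ω => transNoise H ν P ψ α β (x ω) (a ω) (r ω) h k |
      𝓖 (2 * (k * H + h) + 1)] =ᵐ[Pr] 0 :=
  measurable_transition_noise hI hk hh (jointlyMeasurable_gapV hψ hI hk hh)
    (fun ω y => abs_gapV_le H ν P ψ α β (x ω) (a ω) (r ω)
      (fun h hh => hI.reward_mem k hk h hh ω) hh y)
    fun h1 ω y => by rw [gapV, h1, oppoV_last, oppoPolicyV, policyV_last, sub_zero, zero_div]

/-- The conditioning is one index earlier than for the transitions: the state is known, the action
is not. -/
theorem measurable_actionNoise {k h : ℕ} (hk : k < K) (hh : h < H) :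
    Measurable[𝓖 (2 * (k * H + h) + 1)]
      (fun ω => actionNoise H ν P ψ α β (x ω) (a ω) (r ω) h k) ∧
    Pr[fun ω => actionNoise H ν P ψ α β (x ω) (a ω) (r ω) h k |
      𝓖 (2 * (k * H + h))] =ᵐ[Pr] 0 := by
  have hX := hI.state_measurable k hk h hh
  have hX' : Measurable[𝓖 (2 * (k * H + h) + 1)] fun ω => x ω k h :=
    hX.mono (𝓖.mono (by omega)) le_rfl
  have hY := hI.action_measurable k hk h hh
  have hQ := jointlyMeasurable_gapQ (ν := ν) (α := α) (β := β) hψ hI hk hh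
  have hp := (jointlyMeasurable_oppo (ν := ν) (α := α) (β := β) hψ
    hI.state_measurable hI.action_measurable hI.reward_measurable hk).1 h hh
  have hf : ∀ b, Measurable[𝓖 (2 * (k * H + h))] fun ω =>
      gapQ H ν P ψ α β (x ω) (a ω) (r ω) k h (x ω k h) b := fun b =>
    ((hQ b).mono (𝓖.mono (by omega))).comp hX
  have hpX : ∀ b, Measurable[𝓖 (2 * (k * H + h))] fun ω =>
      oppoPolicy H ν ψ α 1 β (x ω) (a ω) (r ω) k h (x ω k h) b := fun b =>
    ((hp b).mono (𝓖.mono (by omega))).comp hX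
  refine ⟨Measurable.sub (JointlyMeasurable.comp_action
    (f := fun ω y b => gapQ H ν P ψ α β (x ω) (a ω) (r ω) k h y b)
    (fun b => (hQ b).mono (𝓖.mono (by omega))) hX' hY) ?_, ?_⟩
  · exact Finset.measurable_fun_sum _ fun b _ =>
      ((hpX b).mul (hf b)).mono (𝓖.mono (by omega)) le_rfl
  · exact (condExp_sub_sum_of_condLaw (Pr := Pr) (𝓖.le _) (Y := fun ω => a ω k h)
      (hY.mono (𝓖.le _) le_rfl)
      (p := fun b ω => oppoPolicy H ν ψ α 1 β (x ω) (a ω) (r ω) k h (x ω k h) b)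
      (hI.action_law k hk h hh)
      (f := fun ω b => gapQ H ν P ψ α β (x ω) (a ω) (r ω) k h (x ω k h) b) hf (B := 1 / 2)
      (fun ω b => abs_gapQ_le H ν P ψ α β (x ω) (a ω) (r ω)
        (fun h hh => hI.reward_mem k hk h hh ω) hh _ b) hpX
      (fun ω => oppoPolicy_mem_stdSimplex H ν ψ α β (x ω) (a ω) (r ω) k h (x ω k h))).2

/-- A union bound: each of the `H` steps has `K` regression events and two martingale events.
Treating every `k` separately makes a maximal inequality unnecessary. -/
theorem measure_not_goodEvent_le {δ : ℝ} (hδ : 0 < δ) :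
    Pr {ω | ¬ GoodEvent H ν P ψ α β (x ω) (a ω) (r ω) K δ} ≤
      ENNReal.ofReal (H * (K + 2) * δ) := by
  have hle : ∀ {t k : ℕ}, t < k → ∀ h < H, 2 * (t * H + h + 1) ≤ 2 * (k * H) := by
    intro t k ht h hh
    have : (t + 1) * H ≤ k * H := Nat.mul_le_mul_right H ht
    rw [add_mul, one_mul] at this
    omega
  set E : ℕ → ℕ → Set Ω := fun h k => {ω | ¬ (∑ t ∈ Finset.range k,
      valueNoise H ν P ψ α β (x ω) (a ω) (r ω) h t •
        oppoObs H ν ψ α β (x ω) (a ω) (r ω) h t) ⬝ᵥ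
      ((ridgeGram (oppoObs H ν ψ α β (x ω) (a ω) (r ω) h) k)⁻¹ *ᵥ ∑ t ∈ Finset.range k,
        valueNoise H ν P ψ α β (x ω) (a ω) (r ω) h t •
          oppoObs H ν ψ α β (x ω) (a ω) (r ω) h t) ≤
      Real.log (ridgeGram (oppoObs H ν ψ α β (x ω) (a ω) (r ω) h) k).det +
        2 * Real.log (1 / δ)}
  set E₁ : ℕ → Set Ω := fun h => {ω | ¬ (∑ k ∈ Finset.range K,
      actionNoise H ν P ψ α β (x ω) (a ω) (r ω) h k) ^ 2 / (1 + K) ≤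
      Real.log (1 + K) + 2 * Real.log (1 / δ)}
  set E₂ : ℕ → Set Ω := fun h => {ω | ¬ (∑ k ∈ Finset.range K,
      transNoise H ν P ψ α β (x ω) (a ω) (r ω) h k) ^ 2 / (1 + K) ≤
      Real.log (1 + K) + 2 * Real.log (1 / δ)}
  have hE : ∀ h < H, ∀ k < K, Pr (E h k) ≤ ENNReal.ofReal δ := by
    intro h hh k hk
    have hobs : ∀ j < k, ∀ t ≤ j, Measurable[𝓖 (2 * (j * H + h) + 1)] fun ω =>
        oppoObs H ν ψ α β (x ω) (a ω) (r ω) h t := fun j hj t ht => by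
      have htj : t * H ≤ j * H := Nat.mul_le_mul_right H ht
      exact (measurable_oppoObs hψ hI.state_measurable hI.action_measurable
        ((ht.trans_lt hj).trans hk) (jointlyMeasurable_oppo hψ hI.state_measurable
          hI.action_measurable hI.reward_measurable ((ht.trans_lt hj).trans hk)).2.1 hh).mono
        (𝓖.mono (by omega)) le_rfl
    have hD : ∀ j < k, ∀ t < j, Measurable[𝓖 (2 * (j * H + h) + 1)] fun ω =>
        valueNoise H ν P ψ α β (x ω) (a ω) (r ω) h t := fun j hj t ht =>
      (measurable_valueNoise hψ hI ((ht.trans hj).trans hk) hh).1.mono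
        (𝓖.mono (by have := hle ht h hh; omega)) le_rfl
    have hG : ∀ j < k, ∀ i i', Measurable[𝓖 (2 * (j * H + h) + 1)] fun ω =>
        ridgeGram (oppoObs H ν ψ α β (x ω) (a ω) (r ω) h) j i i' := fun j hj =>
      measurable_ridgeGram (v := fun ω => oppoObs H ν ψ α β (x ω) (a ω) (r ω) h)
        fun t ht => hobs j hj t ht.le
    have hS : ∀ j < k, Measurable[𝓖 (2 * (j * H + h) + 1)] fun ω => ∑ t ∈ Finset.range j,
        valueNoise H ν P ψ α β (x ω) (a ω) (r ω) h t •
          oppoObs H ν ψ α β (x ω) (a ω) (r ω) h t := fun j hj =>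
      measurable_sum_smul (v := fun ω => oppoObs H ν ψ α β (x ω) (a ω) (r ω) h)
        (fun t ht => hobs j hj t ht.le) (hD j hj)
    exact measure_ridge_noise_le (𝓕 := fun j => 𝓖 (2 * (j * H + h) + 1))
      (v := fun ω => oppoObs H ν ψ α β (x ω) (a ω) (r ω) h)
      (D := fun t ω => valueNoise H ν P ψ α β (x ω) (a ω) (r ω) h t) (fun j _ => 𝓖.le _)
      (fun j hj => measurable_dotProduct_inv_mulVec (hG j hj) (hobs j hj j le_rfl)
        (hobs j hj j le_rfl))
      (fun j hj => measurable_dotProduct_inv_mulVec (hG j hj) (hobs j hj j le_rfl) (hS j hj))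
      (fun j hj => measurable_dotProduct_inv_mulVec (hG j hj) (hS j hj) (hS j hj))
      (fun j hj => measurable_matrix_det (hG j hj))
      (fun j hj => (measurable_valueNoise hψ hI (hj.trans hk) hh).1.mono (𝓖.le _) le_rfl)
      (fun j _ ω => abs_valueNoise_le H ν P ψ α β (x ω) (a ω) (r ω) hh j)
      (fun j hj => (measurable_valueNoise hψ hI (hj.trans hk) hh).2) hδ
  have hE₁ : ∀ h < H, Pr (E₁ h) ≤ ENNReal.ofReal δ := fun h hh =>
    measure_sum_martingale_difference_le (𝓕 := fun j => 𝓖 (2 * (j * H + h)))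
      (D := fun k ω => actionNoise H ν P ψ α β (x ω) (a ω) (r ω) h k) (fun j _ => 𝓖.le _)
      (fun k hk t ht => (measurable_actionNoise hψ hI (ht.trans hk) hh).1.mono
        (𝓖.mono (by have := hle ht h hh; omega)) le_rfl)
      (fun k hk => (measurable_actionNoise hψ hI hk hh).1.mono (𝓖.le _) le_rfl)
      (fun k hk ω => abs_actionNoise_le H ν P ψ α β (x ω) (a ω) (r ω)
        (fun h hh => hI.reward_mem k hk h hh ω) hh)
      (fun k hk => (measurable_actionNoise hψ hI hk hh).2) hδ
  have hE₂ : ∀ h < H, Pr (E₂ h) ≤ ENNReal.ofReal δ := fun h hh =>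
    measure_sum_martingale_difference_le (𝓕 := fun j => 𝓖 (2 * (j * H + h) + 1))
      (D := fun k ω => transNoise H ν P ψ α β (x ω) (a ω) (r ω) h k) (fun j _ => 𝓖.le _)
      (fun k hk t ht => (measurable_transNoise hψ hI (ht.trans hk) hh).1.mono
        (𝓖.mono (by have := hle ht h hh; omega)) le_rfl)
      (fun k hk => (measurable_transNoise hψ hI hk hh).1.mono (𝓖.le _) le_rfl)
      (fun k hk ω => abs_transNoise_le H ν P ψ α β (x ω) (a ω) (r ω)
        (fun h hh => hI.reward_mem k hk h hh ω) hh)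
      (fun k hk => (measurable_transNoise hψ hI hk hh).2) hδ
  have hsub : {ω | ¬ GoodEvent H ν P ψ α β (x ω) (a ω) (r ω) K δ} ⊆
      ⋃ h ∈ Finset.range H, ((⋃ k ∈ Finset.range K, E h k) ∪ (E₁ h ∪ E₂ h)) := by
    intro ω hω
    by_contra hcon
    refine hω fun h hh => ?_
    simp only [Set.mem_iUnion, Finset.mem_range, Set.mem_union, not_exists, not_or] at hcon
    obtain ⟨h1, h2, h3⟩ := hcon h hh
    exact ⟨fun k hk => not_not.1 (h1 k hk), not_not.1 h2, not_not.1 h3⟩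
  calc _ ≤ ∑ h ∈ Finset.range H, Pr ((⋃ k ∈ Finset.range K, E h k) ∪ (E₁ h ∪ E₂ h)) :=
        (measure_mono hsub).trans (measure_biUnion_finset_le _ _)
    _ ≤ ∑ h ∈ Finset.range H, ENNReal.ofReal ((K + 2) * δ) := by
        refine Finset.sum_le_sum fun h hh => ?_
        have hh' := Finset.mem_range.1 hh
        have h1 : Pr (⋃ k ∈ Finset.range K, E h k) ≤ ENNReal.ofReal (K * δ) := by
          refine (measure_biUnion_finset_le _ _).trans ((Finset.sum_le_sum fun k hk =>
            hE h hh' k (Finset.mem_range.1 hk)).trans_eq ?_)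
          rw [Finset.sum_const, Finset.card_range, nsmul_eq_mul,
            ENNReal.ofReal_mul (Nat.cast_nonneg K), ENNReal.ofReal_natCast]
        have h2 : Pr (E₁ h ∪ E₂ h) ≤ ENNReal.ofReal δ + ENNReal.ofReal δ :=
          (measure_union_le _ _).trans (add_le_add (hE₁ h hh') (hE₂ h hh'))
        refine (measure_union_le _ _).trans ((add_le_add h1 h2).trans_eq ?_)
        rw [← ENNReal.ofReal_add hδ.le hδ.le, ← ENNReal.ofReal_add (by positivity) (by positivity)]
        congr 1; ring
    _ = _ := by
        rw [Finset.sum_const, Finset.card_range, nsmul_eq_mul, mul_assoc,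
          ENNReal.ofReal_mul (Nat.cast_nonneg H), ENNReal.ofReal_natCast]

end

end GoodEventProbability

/-! ### The regret on the good event -/

section RegretBound

/-- Elementary estimates of the logarithms in the analysis by `L = log (dT / ζ)`. -/
theorem log_estimates {d H K : ℕ} (hd : 0 < d) (hH : 0 < H) (hK : 0 < K)
    (h2 : 2 ≤ (d : ℝ) * (H * K)) {ζ : ℝ} (hζ0 : 0 < ζ) (hζ1 : ζ ≤ 1) :
    1 / 2 ≤ Real.log (d * (H * K) / ζ) ∧
    (∀ k ≤ K, Real.log (d + k * (d * (H : ℝ) ^ 2)) ≤ 3 * Real.log (d * (H * K) / ζ)) ∧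
    Real.log (1 / (ζ / (3 * (H * K)))) ≤ 3 * Real.log (d * (H * K) / ζ) ∧
    Real.log (1 + K) ≤ 2 * Real.log (d * (H * K) / ζ) := by
  have hd' : (1 : ℝ) ≤ d := by exact_mod_cast hd
  have hH' : (1 : ℝ) ≤ H := by exact_mod_cast hH
  have hK' : (1 : ℝ) ≤ K := by exact_mod_cast hK
  set y : ℝ := d * (H * K) / ζ with hy
  have hyle : (d : ℝ) * (H * K) ≤ y := le_div_self (by positivity) hζ0 hζ1
  have hy2 : 2 ≤ y := h2.trans hyle
  have hpow : ∀ n : ℕ, (n : ℝ) * Real.log y = Real.log (y ^ n) := fun n => (Real.log_pow _ _).symm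
  -- The assumption `d T ≥ 2` gives `y ≥ 2`, so numerical factors can be absorbed into powers of
  -- `y`.
  have hy3 : 2 * y ^ 2 ≤ y ^ 3 := by nlinarith [sq_nonneg y]
  have hHK : (1 : ℝ) ≤ H * K := by nlinarith
  have hHKy : (H : ℝ) * K ≤ y := le_trans (by nlinarith) hyle
  have hKy : (K : ℝ) ≤ y := le_trans (by nlinarith) hHKy
  refine ⟨?_, fun k hk => ?_, ?_, ?_⟩
  · have h1 := Real.one_sub_inv_le_log_of_pos (x := y) (by linarith)
    have h3 : y⁻¹ ≤ 1 / 2 := by rw [one_div]; exact inv_anti₀ two_pos hy2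
    linarith
  · rw [show (3 : ℝ) = (3 : ℕ) by norm_num, hpow]
    refine Real.log_le_log (by positivity) (le_trans ?_ hy3)
    have hk' : (k : ℝ) ≤ K := by exact_mod_cast hk
    have h1 : (d : ℝ) + k * (d * (H : ℝ) ^ 2) ≤ 2 * (d * (H * K) * (d * (H * K))) := by
      have h3 : (k : ℝ) * (d * (H : ℝ) ^ 2) ≤ K * (d * (H : ℝ) ^ 2) := by gcongr
      have h4 : (K : ℝ) * (d * (H : ℝ) ^ 2) ≤ d * (H * K) * (d * (H * K)) := by
        have : (K : ℝ) * (d * (H : ℝ) ^ 2) * 1 ≤ K * (d * (H : ℝ) ^ 2) * (d * K) := by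
          gcongr; nlinarith
        nlinarith
      have h5 : (d : ℝ) * 1 ≤ d * (H * K) * (d * (H * K)) := by
        rw [mul_assoc]; gcongr; nlinarith
      linarith
    refine h1.trans ?_
    rw [sq]
    gcongr
  · rw [show (3 : ℝ) * Real.log y = (3 : ℕ) * Real.log y by norm_num, hpow]
    refine Real.log_le_log (by positivity) ?_
    have h1 : 1 / (ζ / (3 * ((H : ℝ) * K))) = 3 * (H * K / ζ) := by field_simp
    have h3 : (H : ℝ) * K / ζ ≤ y := by
      exact div_le_div_of_nonneg_right (by nlinarith) hζ0.le
    rw [h1]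
    nlinarith
  · rw [show (2 : ℝ) * Real.log y = (2 : ℕ) * Real.log y by norm_num, hpow]
    exact Real.log_le_log (by positivity) (by nlinarith)

/-- Cauchy–Schwarz, together with `(min 1 √u)² = min 1 u`. -/
theorem sum_min_one_sqrt_le {u : ℕ → ℝ} (hu : ∀ k, 0 ≤ u k) (K : ℕ) :
    ∑ k ∈ Finset.range K, min 1 √(u k) ≤ √(K * ∑ k ∈ Finset.range K, min 1 (u k)) := by
  refine Real.le_sqrt_of_sq_le ((sq_sum_le_card_mul_sum_sq).trans_eq ?_)
  rw [Finset.card_range]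
  congr 1
  refine Finset.sum_congr rfl fun k _ => ?_
  rcases le_total (u k) 1 with h | h
  · rw [min_eq_right h, min_eq_right (Real.sqrt_le_one.2 h), Real.sq_sqrt (hu k)]
  · rw [min_eq_left h, min_eq_left (Real.one_le_sqrt.2 h), one_pow]

variable {S A : Type*} [mS : MeasurableSpace S] [Fintype A] [Nonempty A] [MeasurableSpace A]
  [MeasurableSingletonClass A] {d H K : ℕ} {ν : Measure S} {P : ℕ → Kernel (S × A) S}
  [∀ h, IsMarkovKernel (P h)] {ψ : S → A → S → EuclideanSpace ℝ (Fin d)} {α β C ζ : ℝ}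
  {x : ℕ → ℕ → S} {a : ℕ → ℕ → A} {r : ℕ → ℕ → S → A → ℝ} {x₁ : S}

/-- Here `y² ≤ (1 + K) · 8 L ≤ 16 K L`. -/
theorem abs_le_of_sq_div_le {y ℓ L : ℝ} (hL : 0 ≤ L) (hK : 0 < K)
    (hℓ : ℓ ≤ 8 * L) (h : y ^ 2 / (1 + K) ≤ ℓ) : |y| ≤ 4 * √(K * L) := by
  have hK' : (1 : ℝ) ≤ K := by exact_mod_cast hK
  rw [div_le_iff₀ (by linarith)] at h
  have h1 : y ^ 2 ≤ (4 * √(K * L)) ^ 2 := by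
    rw [mul_pow, Real.sq_sqrt (by positivity)]
    nlinarith [mul_nonneg hL (sub_nonneg.2 hK')]
  exact abs_le_of_sq_le_sq h1 (by positivity)

/-- On the good event, the regret of OPPO against a fixed policy is bounded. -/
theorem regret_term_le_of_goodEvent (hM : IsLinearMDP H ν P ψ) (hd : 0 < d) (hH : 0 < H)
    (hK : 0 < K) (h2 : 2 ≤ (d : ℝ) * (H * K)) (hζ0 : 0 < ζ) (hζ1 : ζ ≤ 1) (hC : 5 ≤ C)
    (hα : 0 < α) (hβ : β = C * √(d * (H : ℝ) ^ 2 * Real.log (d * (H * K) / ζ)))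
    (hx : ∀ k < K, x k 0 = x₁) (hr : ∀ k < K, ∀ h < H, ∀ y b, r k h y b ∈ Set.Icc (0 : ℝ) 1)
    (hrm : ∀ k < K, ∀ h < H, ∀ b, Measurable fun y => r k h y b)
    (hπ : ∀ k < K, oppoPolicy H ν ψ α 1 β x a r k ∈ policies S A H)
    (hV : ∀ k < K, ∀ h ≤ H, Measurable (oppoV H ν ψ α β x a r k h))
    (hW : ∀ k < K, ∀ h ≤ H, Measurable (oppoPolicyV H ν P ψ α β x a r k h))
    (hQ : ∀ k < K, ∀ h < H, ∀ b, Measurable fun y => oppoQ H ν ψ α β x a r k h y b)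
    (hgood : GoodEvent H ν P ψ α β x a r K (ζ / (3 * (H * K))))
    {π' : ℕ → S → A → ℝ} (hπ' : π' ∈ policies S A H) :
    ∑ k ∈ Finset.range K, (value H P x₁ π' (r k) -
        value H P x₁ (oppoPolicy H ν ψ α 1 β x a r k) (r k)) ≤
      H * (Real.log (Fintype.card A) / α + α * H ^ 2 * K / 2) +
      H * (2 * β * √(K * (6 * (d * Real.log (d * (H * K) / ζ))))) +
      2 * H * (H * (8 * √(K * Real.log (d * (H * K) / ζ)))) := by
  obtain ⟨hL, hlog1, hlog2, hlog3⟩ := log_estimates hd hH hK h2 hζ0 hζ1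
  set L := Real.log (d * (H * K) / ζ) with hLdef
  have hH' : (1 : ℝ) ≤ H := by exact_mod_cast hH
  have hd' : (1 : ℝ) ≤ d := by exact_mod_cast hd
  have hK' : (1 : ℝ) ≤ K := by exact_mod_cast hK
  have hβ' : β = C * (H * √(d * L)) := by
    rw [hβ, show (d : ℝ) * (H : ℝ) ^ 2 * L = H ^ 2 * (d * L) by ring,
      Real.sqrt_mul (by positivity), Real.sqrt_sq (by positivity)]
  have hdL : √(1 / 4 : ℝ) ≤ √(d * L) := Real.sqrt_le_sqrt (by nlinarith)
  rw [show (1 / 4 : ℝ) = (1 / 2) ^ 2 by norm_num, Real.sqrt_sq (by norm_num)] at hdL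
  have hβ5 : 5 * (H * √(d * L)) ≤ β := by rw [hβ']; gcongr
  have hβ0 : 0 ≤ β := le_trans (by positivity) hβ5
  -- The trivial bound `H` on a Bellman error is thus at most `2 β`, which allows capping the square
  -- root in the bonus at `1`, as the elliptical potential lemma demands.
  have hHβ : (H : ℝ) ≤ 2 * β := by nlinarith
  have hobs : ∀ h < H, ∀ k < K, oppoObs H ν ψ α β x a r h k ⬝ᵥ oppoObs H ν ψ α β x a r h k ≤
      d * H ^ 2 := fun h hh k hk =>
    hM.feature_dotProduct_self_le _ _ (hV k hk (h + 1) hh)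
      (oppoV_mem_Icc H ν ψ α β x a r k (h := h + 1) hh)
  have hdet : ∀ h < H, ∀ k ≤ K, Real.log (ridgeGram (oppoObs H ν ψ α β x a r h) k).det ≤
      d * (3 * L) := fun h hh k hk => by
    have h1 := log_det_ridgeGram_le (oppoObs H ν ψ α β x a r h) k fun t ht =>
      hobs h hh t (ht.trans_le hk)
    rw [Fintype.card_fin] at h1
    exact h1.trans (mul_le_mul_of_nonneg_left (hlog1 k hk) (by positivity))
  -- The log-determinant is at most `3 d L` and `2 log (1 / δ)` at most `6 L`, so the noise has
  -- length at most `3 √(d L)`; also `√d ≤ 2 √(d L)`. The sum is the reason for `C ≥ 5`.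
  have hconf : ∀ h < H, ∀ k < K, H * √((∑ t ∈ Finset.range k,
      valueNoise H ν P ψ α β x a r h t • oppoObs H ν ψ α β x a r h t) ⬝ᵥ
      ((ridgeGram (oppoObs H ν ψ α β x a r h) k)⁻¹ *ᵥ ∑ t ∈ Finset.range k,
        valueNoise H ν P ψ α β x a r h t • oppoObs H ν ψ α β x a r h t)) + √d ≤ β :=
      fun h hh k hk => by
    have h1 := ((hgood h hh).1 k hk).trans (add_le_add (hdet h hh k hk.le)
      (mul_le_mul_of_nonneg_left hlog2 two_pos.le))
    have h3 : (d : ℝ) * (3 * L) + 2 * (3 * L) ≤ 3 ^ 2 * (d * L) := by nlinarith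
    have h4 := Real.sqrt_le_sqrt (h1.trans h3)
    rw [Real.sqrt_mul (by positivity), Real.sqrt_sq (by positivity)] at h4
    have h5 : √(d : ℝ) ≤ √(2 ^ 2 * (d * L)) := Real.sqrt_le_sqrt (by nlinarith)
    rw [Real.sqrt_mul (by positivity), Real.sqrt_sq (by positivity)] at h5
    have h6 := mul_le_mul_of_nonneg_left h4 (by positivity : (0 : ℝ) ≤ H)
    have h7 : (0 : ℝ) ≤ √(d * L) := Real.sqrt_nonneg _
    nlinarith
  have hbounds : ∀ k < K, ∀ h < H, ∀ y b,
      r k h y b + ∫ x', oppoV H ν ψ α β x a r k (h + 1) x' ∂(P h (y, b)) ≤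
        oppoQ H ν ψ α β x a r k h y b ∧
      oppoQ H ν ψ α β x a r k h y b ≤
        r k h y b + ∫ x', oppoV H ν ψ α β x a r k (h + 1) x' ∂(P h (y, b)) +
        2 * (β * √(oppoFeature H ν ψ α β x a r k h y b ⬝ᵥ
        ((ridgeGram (oppoObs H ν ψ α β x a r h) k)⁻¹ *ᵥ
          oppoFeature H ν ψ α β x a r k h y b))) := fun k hk h hh y b => by
    obtain ⟨θ, hθd, hθ⟩ := hM.exists_integral_eq hh
    refine oppoQ_bounds (P := P) (ν := ν) (ψ := ψ) (α := α) (β := β) (x := x) (a := a) (r := r)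
      (k := k) (h := h) (y := y) (b := b) hh
      (fun t ht => hV t (ht.trans_lt hk) (h + 1) hh) hθd hθ (hr k hk h hh)
      (ε := valueNoise H ν P ψ α β x a r h) (fun t ht => ?_) (hconf h hh k hk)
    rw [valueNoise, integral_div]
    field_simp
    ring
  have hbonus : ∀ h < H, ∑ k ∈ Finset.range K, (oppoQ H ν ψ α β x a r k h (x k h) (a k h) -
      (r k h (x k h) (a k h) + ∫ y, oppoV H ν ψ α β x a r k (h + 1) y ∂(P h (x k h, a k h)))) ≤
      2 * β * √(K * (6 * (d * L))) := fun h hh => by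
    have hu : ∀ k, 0 ≤ oppoObs H ν ψ α β x a r h k ⬝ᵥ ((ridgeGram (oppoObs H ν ψ α β x a r h) k)⁻¹
        *ᵥ oppoObs H ν ψ α β x a r h k) := fun k =>
      (posDef_ridgeGram _ k).inv_dotProduct_self_nonneg _
    calc _ ≤ ∑ k ∈ Finset.range K, 2 * β * min 1 √(oppoObs H ν ψ α β x a r h k ⬝ᵥ
          ((ridgeGram (oppoObs H ν ψ α β x a r h) k)⁻¹ *ᵥ oppoObs H ν ψ α β x a r h k)) := by
          refine Finset.sum_le_sum fun k hk => ?_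
          have hk' := Finset.mem_range.1 hk
          have h1 := (hbounds k hk' h hh (x k h) (a k h)).2
          have h3 := oppoQ_mem H ν ψ α β x a r k hh (x k h) (a k h)
          have h4 := (hr k hk' h hh (x k h) (a k h)).1
          have h5 : 0 ≤ ∫ y, oppoV H ν ψ α β x a r k (h + 1) y ∂(P h (x k h, a k h)) :=
            integral_nonneg fun y => (oppoV_mem H ν ψ α β x a r k (h := h + 1) hh y).1
          have h6 : (0 : ℝ) ≤ h := Nat.cast_nonneg h
          rw [mul_min_of_nonneg _ _ (by positivity)]
          refine le_min (by linarith [h3.2]) ?_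
          have h7 : oppoFeature H ν ψ α β x a r k h (x k h) (a k h) =
            oppoObs H ν ψ α β x a r h k := rfl
          rw [h7] at h1
          linarith
      _ ≤ 2 * β * √(K * (6 * (d * L))) := by
          rw [← Finset.mul_sum]
          gcongr
          refine (sum_min_one_sqrt_le hu K).trans (Real.sqrt_le_sqrt ?_)
          gcongr
          have h1 := sum_min_one_inv_dotProduct_le (oppoObs H ν ψ α β x a r h) K
          have h3 := hdet h hh K le_rfl
          linarith
  have hnoise : ∀ h < H, -(∑ k ∈ Finset.range K, (actionNoise H ν P ψ α β x a r h k +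
      transNoise H ν P ψ α β x a r h k)) ≤ 8 * √(K * L) := fun h hh => by
    obtain ⟨-, h1, h3⟩ := hgood h hh
    have hℓ : Real.log (1 + K) + 2 * Real.log (1 / (ζ / (3 * (H * K)))) ≤ 8 * L := by linarith
    have h4 := (abs_le.1 (abs_le_of_sq_div_le (by linarith) hK hℓ h1)).1
    have h5 := (abs_le.1 (abs_le_of_sq_div_le (by linarith) hK hℓ h3)).1
    rw [Finset.sum_add_distrib]
    linarith
  have hpo := sum_value_sub_oppoV_le H ν P ψ α β x a r (x₁ := x₁) hH hα hr hrm hπ hV hQ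
    (fun k hk h hh y b => (hbounds k hk h hh y b).1) hπ'
  have hgap : ∑ k ∈ Finset.range K, (oppoV H ν ψ α β x a r k 0 x₁ -
      value H P x₁ (oppoPolicy H ν ψ α 1 β x a r k) (r k)) ≤
      H * (2 * β * √(K * (6 * (d * L)))) + 2 * H * (H * (8 * √(K * L))) := by
    have h1 : ∀ k ∈ Finset.range K, oppoV H ν ψ α β x a r k 0 x₁ -
        value H P x₁ (oppoPolicy H ν ψ α 1 β x a r k) (r k) =
        ∑ h ∈ Finset.range H, (oppoQ H ν ψ α β x a r k h (x k h) (a k h) -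
          (r k h (x k h) (a k h) + ∫ y, oppoV H ν ψ α β x a r k (h + 1) y
            ∂(P h (x k h, a k h)))) -
        2 * H * ∑ h ∈ Finset.range H, (actionNoise H ν P ψ α β x a r h k +
          transNoise H ν P ψ α β x a r h k) := fun k hk => by
      have hk' := Finset.mem_range.1 hk
      rw [value_eq_policyV (P := P) (hπ k hk') (hr k hk') (hrm k hk'),
        ← oppoV_sub_policyV_eq H ν P ψ α β x a r hH (hr k hk') (hV k hk') (hW k hk'), hx k hk']
      rfl
    rw [Finset.sum_congr rfl h1, Finset.sum_sub_distrib, ← Finset.mul_sum, Finset.sum_comm,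
      Finset.sum_comm (f := fun k h => actionNoise H ν P ψ α β x a r h k +
          transNoise H ν P ψ α β x a r h k)]
    have h3 := Finset.sum_le_sum fun h hh => hbonus h (Finset.mem_range.1 hh)
    have h4 := Finset.sum_le_sum fun h hh => hnoise h (Finset.mem_range.1 hh)
    rw [Finset.sum_const, Finset.card_range, nsmul_eq_mul] at h3 h4
    rw [Finset.sum_neg_distrib] at h4
    nlinarith
  have hsplit : ∑ k ∈ Finset.range K, (value H P x₁ π' (r k) -
        value H P x₁ (oppoPolicy H ν ψ α 1 β x a r k) (r k)) =
      ∑ k ∈ Finset.range K, (value H P x₁ π' (r k) - oppoV H ν ψ α β x a r k 0 x₁) +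
      ∑ k ∈ Finset.range K, (oppoV H ν ψ α β x a r k 0 x₁ -
        value H P x₁ (oppoPolicy H ν ψ α 1 β x a r k) (r k)) := by
    rw [← Finset.sum_add_distrib]
    exact Finset.sum_congr rfl fun k _ => by ring
  rw [hsplit]
  linarith

end RegretBound

/-! ### Assembling the theorem -/

section Main

/-- With the learning rate `α` and the bonus parameter `β` of OPPO, the three parts of the regret
bound are of the order `√(d² H³ T) log (dT / ζ)`. -/
theorem regret_parts_le {d H K ℓ L C M α β : ℝ} (hd : 1 ≤ d) (hH : 1 ≤ H) (hK : 1 ≤ K)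
    (hℓ : 0 < ℓ) (hL : 1 / 2 ≤ L) (hC : 0 ≤ C) (hM : 0 ≤ M) (hℓM : ℓ ≤ M * (d ^ 2 * L ^ 2))
    (hα : α = √(2 * ℓ / (H * (H * K)))) (hβ : β = C * √(d * H ^ 2 * L)) :
    H * (ℓ / α + α * H ^ 2 * K / 2) + H * (2 * β * √(K * (6 * (d * L)))) +
      2 * H * (H * (8 * √(K * L))) ≤
    (√(2 * M) + 5 * C + 32) * √(d ^ 2 * H ^ 3 * (H * K)) * L := by
  have hα0 : 0 < α := by rw [hα]; positivity
  have hα2 : α ^ 2 * (H ^ 2 * K) = 2 * ℓ := by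
    rw [hα, Real.sq_sqrt (by positivity)]; field_simp
  have hs : √(d ^ 2 * H ^ 3 * (H * K)) = d * H ^ 2 * √K := by
    rw [show d ^ 2 * H ^ 3 * (H * K) = (d * H ^ 2) ^ 2 * K by ring, Real.sqrt_mul (by positivity),
      Real.sqrt_sq (by positivity)]
  have h1 : ℓ / α + α * H ^ 2 * K / 2 ≤ √(2 * M) * (d * H * √K * L) := by
    -- The choice of `α` makes the two terms equal.
    have e1 : ℓ / α + α * H ^ 2 * K / 2 = α * (H ^ 2 * K) := by
      rw [show ℓ = α ^ 2 * (H ^ 2 * K) / 2 by linarith]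
      field_simp
      ring
    have e2 : α * (H ^ 2 * K) = √(2 * ℓ) * (H * √K) := by
      rw [← hα2, Real.sqrt_mul (by positivity), Real.sqrt_sq hα0.le, Real.sqrt_mul (by positivity),
        Real.sqrt_sq (by positivity)]
      rw [show α * (H * √K) * (H * √K) = α * (H ^ 2 * (√K * √K)) by ring,
        Real.mul_self_sqrt (by linarith)]
    have e3 : √(2 * ℓ) ≤ √(2 * M) * (d * L) := by
      rw [← Real.sqrt_sq (by positivity : 0 ≤ d * L), ← Real.sqrt_mul (by positivity)]
      exact Real.sqrt_le_sqrt (by nlinarith)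
    rw [e1, e2]
    calc _ ≤ √(2 * M) * (d * L) * (H * √K) := by gcongr
      _ = _ := by ring
  have h2 : 2 * β * √(K * (6 * (d * L))) ≤ 5 * C * (d * H * √K * L) := by
    have e1 : β = C * (H * √(d * L)) := by
      rw [hβ, show d * H ^ 2 * L = H ^ 2 * (d * L) by ring, Real.sqrt_mul (by positivity),
        Real.sqrt_sq (by positivity)]
    have e2 : √6 ≤ 5 / 2 := Real.sqrt_le_iff.2 ⟨by norm_num, by norm_num⟩
    have e3 := Real.mul_self_sqrt (by positivity : 0 ≤ d * L)
    calc 2 * β * √(K * (6 * (d * L))) = 2 * C * H * √K * √6 * (√(d * L) * √(d * L)) := by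
          rw [e1, Real.sqrt_mul (by positivity : 0 ≤ K),
            Real.sqrt_mul (by norm_num : (0 : ℝ) ≤ 6) (d * L)]
          ring
      _ ≤ 2 * C * H * √K * (5 / 2) * (√(d * L) * √(d * L)) := by gcongr
      _ = _ := by rw [e3]; ring
  have h3 : 8 * √(K * L) ≤ 16 * (d * √K * L) := by
    have e1 : √L ≤ 2 * L := Real.sqrt_le_iff.2 ⟨by linarith, by nlinarith⟩
    have e2 : √L ≤ 2 * (d * L) := by nlinarith
    rw [Real.sqrt_mul (by linarith)]
    have := mul_le_mul_of_nonneg_left e2 (Real.sqrt_nonneg K)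
    linarith
  rw [hs]
  calc _ ≤ H * (√(2 * M) * (d * H * √K * L)) + H * (5 * C * (d * H * √K * L)) +
        2 * H * (H * (16 * (d * √K * L))) := by gcongr
    _ = _ := by ring

variable {S A : Type*} [mS : MeasurableSpace S] [Fintype A] [MeasurableSpace A]
  {H K : ℕ} {P : ℕ → Kernel (S × A) S} {x₁ : S} {r π : ℕ → ℕ → S → A → ℝ}

/-- With one action all policies coincide and every difference of values is zero. The case is
separate because then `log |A| = 0` forces `α = 0`. -/
theorem regret_le_of_subsingleton [MeasurableSingletonClass A] [∀ h, IsMarkovKernel (P h)]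
    [Subsingleton A] (hπ : ∀ k < K, π k ∈ policies S A H) {B : ℝ} (hB : 0 ≤ B) :
    regret H K P x₁ r π ≤ B := by
  refine Real.iSup_le (fun π' => ?_) hB
  rw [Finset.sum_eq_zero fun k hk => ?_]
  · exact hB
  · have h1 : ∀ p ∈ policies S A H, ∀ h < H, ∀ y b, p h y b = 1 := fun p hp h hh y b => by
      have h2 := ((hp h hh).1 y).2
      rwa [Fintype.sum_subsingleton _ b] at h2
    rw [value, value, trajLaw_congr (π' := π k) fun h hh => ?_, sub_self]
    funext y b
    rw [h1 _ π'.2 h hh, h1 _ (hπ k (Finset.mem_range.1 hk)) h hh]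

/-- The trivial bound, needed only for `d = H = K = 1`. -/
theorem regret_le_mul [MeasurableSingletonClass A] [∀ h, IsMarkovKernel (P h)]
    (hπ : ∀ k < K, π k ∈ policies S A H)
    (hr : ∀ k < K, ∀ h < H, ∀ y b, r k h y b ∈ Set.Icc (0 : ℝ) 1) :
    regret H K P x₁ r π ≤ K * H := by
  refine Real.iSup_le (fun π' => ?_) (by positivity)
  calc _ ≤ ∑ k ∈ Finset.range K, (H : ℝ) := Finset.sum_le_sum fun k hk => by
        have hk' := Finset.mem_range.1 hk
        have h1 := value_mem_Icc (P := P) (x₁ := x₁) π'.2 (hr k hk')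
        have h2 := value_mem_Icc (P := P) (x₁ := x₁) (hπ k hk') (hr k hk')
        linarith [h1.2, h2.1]
    _ = K * H := by simp

end Main

theorem theorem1 :
    ∃ C₀ : ℝ, 1 < C₀ ∧ ∀ C : ℝ, C₀ ≤ C → ∀ M : ℝ, 0 < M → ∃ C' : ℝ, 0 < C' ∧
      ∀ (S : Type*) [MeasurableSpace S] (ν : Measure S) [SFinite ν]
        (A : Type*) [Fintype A] [Nonempty A] [MeasurableSpace A] [MeasurableSingletonClass A]
        (d H K : ℕ) (_ : 0 < H) (_ : 0 < K) (T : ℝ) (_ : T = (H : ℝ) * K)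
        (P : ℕ → Kernel (S × A) S) [∀ h, IsMarkovKernel (P h)] (x₁ : S)
        (ψ : S → A → S → EuclideanSpace ℝ (Fin d)) (_ : IsLinearMDP H ν P ψ)
        (ζ : ℝ) (_ : 0 < ζ) (_ : ζ ≤ 1)
        (_ : Real.log (Fintype.card A) ≤ M * ((d : ℝ) ^ 2 * Real.log (d * T / ζ) ^ 2))
        (α β : ℝ) (_ : α = √(2 * Real.log (Fintype.card A) / (H * T)))
        (_ : β = C * √(d * (H : ℝ) ^ 2 * Real.log (d * T / ζ)))
        (Ω : Type*) [MeasurableSpace Ω] (Pr : Measure Ω) [IsProbabilityMeasure Pr]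
        (𝓖 : Filtration ℕ ‹MeasurableSpace Ω›)
        (X : ℕ → ℕ → Ω → S) (Act : ℕ → ℕ → Ω → A) (r : ℕ → ℕ → Ω → S → A → ℝ)
        (π : ℕ → Ω → ℕ → S → A → ℝ)
        (_ : ∀ k ω, π k ω = oppoPolicy H ν ψ α 1 β (fun τ h => X τ h ω) (fun τ h => Act τ h ω)
          (fun τ h => r τ h ω) k)
        (_ : IsInteraction Pr 𝓖 H K P x₁ X Act r π),
        ENNReal.ofReal (1 - ζ) ≤
          Pr {ω | regret H K P x₁ (fun k h => r k h ω) (fun k => π k ω) ≤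
            C' * √((d : ℝ) ^ 2 * (H : ℝ) ^ 3 * T) * Real.log (d * T / ζ)} := by
  -- The constant `5` is what the confidence bound requires. In the final constant, `√(2 * M)` pays
  -- for policy optimization, `5 * C` for the bonuses and `32` for the martingales.
  refine ⟨5, by norm_num, fun C hC M hM => ⟨√(2 * M) + 5 * C + 32, by positivity, ?_⟩⟩
  intro S _ ν _ A _ _ _ _ d H K hH hK T hT P _ x₁ ψ hMDP ζ hζ0 hζ1 hA α β hα hβ Ω mΩ Pr _ 𝓖 X Act
    r π hπ hI
  obtain rfl : π = fun k ω => oppoPolicy H ν ψ α 1 β (fun τ h => X τ h ω) (fun τ h => Act τ h ω)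
      (fun τ h => r τ h ω) k := by
    funext k ω; exact hπ k ω
  subst hT
  have : Nonempty S := ⟨x₁⟩
  have hd := hMDP.dim_pos hH
  have hd' : (1 : ℝ) ≤ d := by exact_mod_cast hd
  have hH' : (1 : ℝ) ≤ H := by exact_mod_cast hH
  have hK' : (1 : ℝ) ≤ K := by exact_mod_cast hK
  have hHK : (1 : ℝ) ≤ H * K := by nlinarith
  have hL0 : 0 ≤ Real.log (d * (H * K) / ζ) := by
    refine Real.log_nonneg ((one_le_div hζ0).2 (hζ1.trans ?_))
    nlinarith
  have hC' : 0 ≤ √(2 * M) + 5 * C + 32 := by positivity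
  have hoppo : ∀ k < K, _ := fun k hk => jointlyMeasurable_oppo (ν := ν) (α := α) (β := β)
    (x := fun ω τ h => X τ h ω) (a := fun ω τ h => Act τ h ω) (r := fun ω τ h => r τ h ω)
    hMDP.measurable hI.state_measurable hI.action_measurable hI.reward_measurable hk
  have hpol : ∀ ω, ∀ k < K, oppoPolicy H ν ψ α 1 β (fun τ h => X τ h ω) (fun τ h => Act τ h ω)
      (fun τ h => r τ h ω) k ∈ policies S A H := fun ω k hk h hh =>
    ⟨oppoPolicy_mem_stdSimplex H ν ψ α β _ _ _ k h, fun b => ((hoppo k hk).1 h hh b).section ω⟩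
  have hall : (∀ ω, regret H K P x₁ (fun k h => r k h ω) (fun k => oppoPolicy H ν ψ α 1 β
      (fun τ h => X τ h ω) (fun τ h => Act τ h ω) (fun τ h => r τ h ω) k) ≤
      (√(2 * M) + 5 * C + 32) * √((d : ℝ) ^ 2 * (H : ℝ) ^ 3 * (H * K)) *
        Real.log (d * (H * K) / ζ)) → ENNReal.ofReal (1 - ζ) ≤
      Pr {ω | regret H K P x₁ (fun k h => r k h ω) (fun k => oppoPolicy H ν ψ α 1 β
        (fun τ h => X τ h ω) (fun τ h => Act τ h ω) (fun τ h => r τ h ω) k) ≤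
        (√(2 * M) + 5 * C + 32) * √((d : ℝ) ^ 2 * (H : ℝ) ^ 3 * (H * K)) *
        Real.log (d * (H * K) / ζ)} := fun h => by
    calc ENNReal.ofReal (1 - ζ) ≤ 1 := ENNReal.ofReal_le_one.2 (by linarith)
      _ = Pr Set.univ := measure_univ.symm
      _ ≤ _ := measure_mono fun ω _ => h ω
  rcases subsingleton_or_nontrivial A with hA1 | hA2
  · exact hall fun ω => regret_le_of_subsingleton (hpol ω) (by positivity)
  have hcard : (2 : ℝ) ≤ Fintype.card A := by exact_mod_cast Fintype.one_lt_card
  have hℓ : 1 / 2 ≤ Real.log (Fintype.card A) := by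
    have h1 := Real.one_sub_inv_le_log_of_pos (x := Fintype.card A) (by linarith)
    have h2 : ((Fintype.card A : ℝ))⁻¹ ≤ 1 / 2 := by rw [one_div]; exact inv_anti₀ two_pos hcard
    linarith
  -- If `d T < 2`, then `d = H = K = 1` and the logarithm `L` has no lower bound from `d T` alone.
  -- With at least two actions, however, the assumption on `log |A|` gives `1 / 2 ≤ M L²`, so `√(2
  -- M) L ≥ 1` covers the trivial bound on the regret.
  rcases Nat.lt_or_ge (d * (H * K)) 2 with h2 | h2
  · have hone : d * (H * K) = 1 := le_antisymm (by omega) (Nat.mul_pos hd (Nat.mul_pos hH hK))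
    have hd1 : d = 1 := Nat.eq_one_of_mul_eq_one_right hone
    have hHK1 : H * K = 1 := Nat.eq_one_of_mul_eq_one_left hone
    have hH1 : H = 1 := Nat.eq_one_of_mul_eq_one_right hHK1
    have hK1 : K = 1 := Nat.eq_one_of_mul_eq_one_left hHK1
    refine hall fun ω => (regret_le_mul (hpol ω) fun k hk h hh => hI.reward_mem k hk h hh ω).trans ?_
    subst hd1 hH1 hK1
    simp only [Nat.cast_one, one_pow, mul_one, Real.sqrt_one] at hA hL0 ⊢
    have h3 : 1 ≤ √(2 * M) * Real.log (1 / ζ) := by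
      rw [← Real.sqrt_sq hL0, ← Real.sqrt_mul (by positivity)]
      exact Real.one_le_sqrt.2 (by linarith)
    have h4 : 0 ≤ (5 * C + 32) * Real.log (1 / ζ) := by positivity
    linarith
  have h2' : 2 ≤ (d : ℝ) * (H * K) := by exact_mod_cast h2
  have hα0 : 0 < α := by rw [hα]; positivity
  have hgoodle : ∀ ω, GoodEvent H ν P ψ α β (fun τ h => X τ h ω) (fun τ h => Act τ h ω)
      (fun τ h => r τ h ω) K (ζ / (3 * (H * K))) →
      regret H K P x₁ (fun k h => r k h ω) (fun k => oppoPolicy H ν ψ α 1 β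
        (fun τ h => X τ h ω) (fun τ h => Act τ h ω) (fun τ h => r τ h ω) k) ≤
      (√(2 * M) + 5 * C + 32) * √((d : ℝ) ^ 2 * (H : ℝ) ^ 3 * (H * K)) *
        Real.log (d * (H * K) / ζ) := fun ω hω => by
    -- The good event does not involve `π'`, so one event serves all comparators.
    refine Real.iSup_le (fun π' => ?_) (by positivity)
    refine (regret_term_le_of_goodEvent hMDP hd hH hK h2' hζ0 hζ1 hC hα0 hβ
      (fun k hk => hI.initial k hk ω) (fun k hk h hh => hI.reward_mem k hk h hh ω)
      (fun k hk h hh b => JointlyMeasurable.section (f := fun ω y => r k h ω y b)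
        (hI.reward_measurable k hk h hh b) ω) (hpol ω)
      (fun k hk h hh => ((hoppo k hk).2.1 h hh).section ω)
      (fun k hk h hh => (jointlyMeasurable_oppoPolicyV (x := fun ω τ h => X τ h ω)
        (a := fun ω τ h => Act τ h ω) (r := fun ω τ h => r τ h ω) hMDP.measurable hI hk
        hh).section ω)
      (fun k hk h hh b => ((hoppo k hk).2.2 h hh b).section ω) hω π'.2).trans ?_
    exact regret_parts_le hd' hH' hK' (by linarith)
      (log_estimates hd hH hK h2' hζ0 hζ1).1 (by linarith) hM.le hA hα hβ
  have hbad := measure_not_goodEvent_le (x := fun ω τ h => X τ h ω)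
    (a := fun ω τ h => Act τ h ω) (r := fun ω τ h => r τ h ω) hMDP.measurable hI
    (δ := ζ / (3 * (H * K))) (by positivity)
  -- The level `δ = ζ / (3 H K)` suffices, as `K + 2 ≤ 3 K`.
  have hbad' : (H : ℝ) * (K + 2) * (ζ / (3 * (H * K))) ≤ ζ := by
    rw [← mul_div_assoc, div_le_iff₀ (by positivity)]
    nlinarith [mul_nonneg (mul_nonneg (by linarith : (0 : ℝ) ≤ H) hζ0.le) (sub_nonneg.2 hK')]
  rw [ENNReal.ofReal_sub _ hζ0.le, ENNReal.ofReal_one, tsub_le_iff_right]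
  -- The event about the regret, a supremum over policies, is not shown to be measurable;
  -- subadditivity over a cover avoids complements.
  have hcov : Set.univ ⊆ {ω | regret H K P x₁ (fun k h => r k h ω) (fun k => oppoPolicy H ν ψ α 1 β
      (fun τ h => X τ h ω) (fun τ h => Act τ h ω) (fun τ h => r τ h ω) k) ≤
      (√(2 * M) + 5 * C + 32) * √((d : ℝ) ^ 2 * (H : ℝ) ^ 3 * (H * K)) *
        Real.log (d * (H * K) / ζ)} ∪ {ω | ¬ GoodEvent H ν P ψ α β (fun τ h => X τ h ω)
        (fun τ h => Act τ h ω) (fun τ h => r τ h ω) K (ζ / (3 * (H * K)))} :=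
    fun ω _ => (em _).imp (hgoodle ω) id
  rw [← measure_univ (μ := Pr)]
  exact (measure_mono hcov).trans ((measure_union_le _ _).trans
    (add_le_add le_rfl (hbad.trans (ENNReal.ofReal_le_ofReal hbad'))))
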